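/- **Setting.** Let $H$ be a Hermitian matrix of size at least $2$ with eigenvalues $\lambda_0\le\lambda_1\le\dots$ (listed with multiplicity) and an orthonormal basis of eigenvectors $|\psi_m\rangle$, let $\Delta=\lambda_1-\lambda_0>0$ be its spectral gap, and suppose that $H$ is normalized so that all $\lambda_m\in S:=[-\pi+\Delta/4,\ \pi-\Delta/4]$ (so $\Delta<2\pi$). Let $|\psi\rangle$ be a unit vector with overlap $p_0=|\langle\psi_0|\psi\rangle|^2>0$. *Circuit.* For $t\in\mathbb R$ and $W\in\{I,S_{\rm ph}^\dagger\}$, $S_{\rm ph}=\mathrm{diag}(1,i)$, prepare $|0\rangle|\psi\rangle$, apply a Hadamard gate to the ancilla, the controlled evolution $e^{-itH}$, then $W$ and a Hadamard gate to the ancilla, and measure the ancilla; the recorded value is $\pm1$ ($+1$ for outcome $0$). The evolution time of this circuit is $|t|$. A *sample* at time $t$ consists of one run with $W=I$ (value $X$) and one independent run with $W=S_{\rm ph}^\dagger$ (value $Y$). *Rough-estimation stage.* A rough-estimation procedure takes a fixed number of independent samples at random times drawn from a fixed finite distribution, and computes from them a number $\lambda_{\rm prior}$. Set $I=[-\pi,\lambda_{\rm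 prior}+\Delta/4]$ and $I'=[-\pi,\lambda_{\rm prior}+3\Delta/4]$, which are separated by $D=\Delta/2$. Its maximal evolution time $T_{\max,1}$ is the largest possible $|t|$; its total evolution time $T_{\mathrm{total},1}$ is the number of circuit runs times $T_{\max,1}$. *Algorithm 2.* Given $\lambda_{\rm prior}$, integers $d,N,N_s$ and coefficients $\hat F_l=|\hat F_l|e^{i\phi_l}$, $-d\le l\le d$ (depending on $\lambda_{\rm prior}$), put $\mathcal F=\sum_l|\hat F_l|$, $J=\lceil\log_2(1/\epsilon)\rceil+1$ and $\tau_j=2^{\,j-1-\lceil\log_2(1/\epsilon)\rceil}\,\delta/(N\epsilon)$ for $1\le j\le J$. For each level $j$ and each $0\le n<N$ take $N_s$ independent samples: draw $r\in\{-d,\dots,d\}$ with $\mathbb P(r=l)=|\hat F_l|/\mathcal F$, take a sample $(X,Y)$ at time $r+n\tau_j$, and form $(X+iY)e^{i\phi_r}\mathcal F$; let $Z_{j,n}$ be the average of these $N_s$ values. Starting with the search interval $[-\pi,\pi]$, for $j=1,\dots,J$ let $(r_j^*,\theta_j^*)$ minimize $\frac1N\sum_{n=0}^{N-1}|Z_{j,n}-r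 e^{-i\theta n\tau_j}|^2$ over $r\in\mathbb C$ and $\theta$ in the search interval, and replace the search interval by $[\theta_j^*-\frac{\pi}{2\tau_j},\theta_j^*+\frac{\pi}{2\tau_j}]$. The output is $\theta^*=\theta_J^*$. The maximal evolution time $T_{\max,2}$ of constructing the loss functions is the maximum of $|r+n\tau_j|$ over all $j,n$ and $r\in\{-d,\dots,d\}$; the total evolution time $T_{\mathrm{total},2}$ is the sum of the evolution times of all circuit runs, in the worst case over the shifts $r$, i.e. $T_{\mathrm{total},2}=\sum_{j}\sum_n 2N_s(d+n\tau_j)$. *Notation.* $g=\widetilde\Theta_L(f)$ means $c f\le g\le C f L^k$, with $c,C>0$ and $k\in\mathbb N$ depending only on $\zeta$. Put $L_0=1+\log(p_0^{-1}\delta^{-1})$, $L_1=1+\log(p_0^{-1}\eta^{-1})+\log(1+\Delta^{-1})$, $L_2=1+\log(p_0^{-1}\delta^{-1}\eta^{-1}\epsilon^{-1})+\log(1+\Delta^{-1})$. **Statement.** Fix $\zeta>0$. For all $0<\Delta<2\pi$, $0<p_0\le1$, $0<\delta<1$, $0<\eta<1$ and $0<\epsilon<1/2$ one can choose, depending only on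 these numbers and $\zeta$ (not on $H$ and $|\psi\rangle$), a rough-estimation procedure, integers $d$, $N\ge2$, $N_s$, a number $q$, and for every $\lambda_{\rm prior}$ coefficients $\hat F_l$, with $$d=\widetilde\Theta_{L_0}(\Delta^{-1}),\quad q=\Theta(p_0\delta^2),\quad NN_s=\widetilde\Theta_{L_2}\!\left(p_0^{-2}\delta^{-(2+\zeta)}\right),\quad N_s=\Omega(p_0^{-2}),$$ and moreover $\min\{N,N_s\}=\widetilde\Theta_{L_2}(p_0^{-2})$ if $p_0^{-2}\le\delta^{-(2+\zeta)}$, such that for every $\lambda_{\rm prior}\in[-\pi,\pi-\Delta]$ the filter $F_q(x)=\sum_{l=-d}^{d}\hat F_l e^{-ilx}$ satisfies $|F_q(x)-1|\le q$ on $S\cap I$ and $|F_q(x)|\le q$ on $S\setminus I'$, and such that the following holds. * *Correctness.* For every $H$ and $|\psi\rangle$ as above with spectral gap $\Delta$ and overlap $p_0$: with probability at least $1-\eta$ over both stages, $|\lambda_{\rm prior}-\lambda_0|\le\Delta/4$ and $|\theta^*-\lambda_0|<\epsilon$ (the minimizers exist, and this holds for every choice of them). Moreover, if Algorithm 2 is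 started from any fixed $\lambda_{\rm prior}$ with $|\lambda_{\rm prior}-\lambda_0|\le\Delta/4$, then $\mathbb P(|\theta^*-\lambda_0|<\epsilon)\ge1-\eta$. * *Cost of the rough estimation.* $T_{\max,1}=\widetilde\Theta_{L_1}(\Delta^{-1})$ and $T_{\mathrm{total},1}=\widetilde\Theta_{L_1}(\Delta^{-1}p_0^{-2})$. * *Cost of constructing the loss functions.* $T_{\max,2}=d+(N-1)\tau_J=d+(1-\tfrac1N)\,\delta/\epsilon$ (so $T_{\max,2}\le d+\delta/\epsilon$, with $d=\widetilde\Theta_{L_0}(\Delta^{-1})$), and $T_{\mathrm{total},2}=\widetilde\Theta_{L_2}\!\left(p_0^{-2}\delta^{-(2+\zeta)}(\Delta^{-1}+\delta/\epsilon)\right)$. -/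

import Mathlib

open scoped BigOperators

noncomputable section

namespace QCELS

/-! ## The one-ancilla circuit -/

/-- The state space `ℂ^M` of the system register. -/
abbrev Sys (M : ℕ) := EuclideanSpace ℂ (Fin M)

/-- The Hadamard gate. -/
def hadamardGate : Matrix (Fin 2) (Fin 2) ℂ :=
  ((1 / Real.sqrt 2 : ℝ) : ℂ) • !![1, 1; 1, -1]

/-- The adjoint of the phase gate `S = diag(1, i)`. -/
def sDagger : Matrix (Fin 2) (Fin 2) ℂ := !![1, 0; 0, -Complex.I]

/-- The time evolution `exp(-i t H)`. -/
def evolution {M : ℕ} (H : Matrix (Fin M) (Fin M) ℂ) (t : ℝ) : Matrix (Fin M) (Fin M) ℂ :=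
  NormedSpace.exp ((-(Complex.I * (t : ℂ))) • H)

/-- A joint state of the ancilla qubit and the system is a pair of system vectors
`s 0, s 1`, standing for `|0⟩ ⊗ s 0 + |1⟩ ⊗ s 1`; this is a gate acting on the ancilla. -/
def onAncilla {M : ℕ} (G : Matrix (Fin 2) (Fin 2) ℂ) (s : Fin 2 → Sys M) : Fin 2 → Sys M :=
  fun a => ∑ b, G a b • s b

/-- The gate `U` on the system, controlled by the ancilla. -/
def controlled {M : ℕ} (U : Matrix (Fin M) (Fin M) ℂ) (s : Fin 2 → Sys M) : Fin 2 → Sys M :=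
  ![s 0, Matrix.toEuclideanLin U (s 1)]

/-- The state before the measurement: Hadamard gate on the ancilla, controlled
`exp(-i t H)`, gate `W` on the ancilla, Hadamard gate on the ancilla,
applied to `|0⟩ ⊗ |ψ⟩`. -/
def circuitState {M : ℕ} (H : Matrix (Fin M) (Fin M) ℂ) (ψ : Sys M)
    (W : Matrix (Fin 2) (Fin 2) ℂ) (t : ℝ) : Fin 2 → Sys M :=
  onAncilla hadamardGate (onAncilla W (controlled (evolution H t)
    (onAncilla hadamardGate ![ψ, 0])))

/-- The probability that measuring the ancilla gives the outcome `a`. -/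
def outcomeProb {M : ℕ} (H : Matrix (Fin M) (Fin M) ℂ) (ψ : Sys M)
    (W : Matrix (Fin 2) (Fin 2) ℂ) (t : ℝ) (a : Fin 2) : ℝ :=
  ‖circuitState H ψ W t a‖ ^ 2

/-- The recorded value: `1` for the outcome `0` and `-1` for the outcome `1`. -/
def outcomeValue (a : Fin 2) : ℝ := if a = 0 then 1 else -1

/-- The record of one sample: the index of the randomly drawn evolution time, the outcome
of the circuit with `W = I`, and the outcome of the circuit with `W = S†`. -/
abbrev Sample (K : ℕ) := Fin K × Fin 2 × Fin 2

/-- The probability of a sample, if the index `l` is drawn with probability `p l`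
and both circuits are then run, independently, with evolution time `t l`. -/
def sampleProb {M K : ℕ} (H : Matrix (Fin M) (Fin M) ℂ) (ψ : Sys M)
    (p t : Fin K → ℝ) (s : Sample K) : ℝ :=
  p s.1 * outcomeProb H ψ 1 (t s.1) s.2.1 * outcomeProb H ψ sDagger (t s.1) s.2.2

/-- The probability of the event `E` under the weights `w` on a finite sample space. -/
def prob {Ω : Type} [Fintype Ω] (w : Ω → ℝ) (E : Ω → Prop) : ℝ :=
  ∑ ω, Set.indicator {ω | E ω} w ω

/-! ## Rough estimation -/

/-- A rough-estimation procedure: independent samples of the circuit at random evolution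
times drawn from a finite distribution, and a classical post-processing of the samples. -/
structure RoughEstimator where
  /-- number of possible evolution times -/
  numTimes : ℕ
  /-- the possible evolution times -/
  time : Fin numTimes → ℝ
  /-- the probabilities with which they are drawn -/
  weight : Fin numTimes → ℝ
  weight_pos : ∀ l, 0 < weight l
  weight_sum : ∑ l, weight l = 1
  /-- number of samples -/
  numSamples : ℕ
  /-- the estimate computed from the samples -/
  estimate : (Fin numSamples → Sample numTimes) → ℝ

namespace RoughEstimator

/-- The samples of the rough-estimation stage. -/
abbrev Data (A : RoughEstimator) := Fin A.numSamples → Sample A.numTimes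

/-- The law of the samples. -/
def dataProb (A : RoughEstimator) {M : ℕ} (H : Matrix (Fin M) (Fin M) ℂ) (ψ : Sys M)
    (ω : A.Data) : ℝ :=
  ∏ k, sampleProb H ψ A.weight A.time (ω k)

/-- The maximal evolution time. -/
def maxTime (A : RoughEstimator) : ℝ := ⨆ l, |A.time l|

/-- The total evolution time, in the worst case over the drawn times;
each sample runs two circuits. -/
def totalTime (A : RoughEstimator) : ℝ := 2 * A.numSamples * A.maxTime

end RoughEstimator

/-! ## The eigenvalue filter -/

/-- The integers `-d, ..., d`. -/
def shift (d : ℕ) (l : Fin (2 * d + 1)) : ℤ := (l : ℤ) - (d : ℤ)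

/-- The trigonometric polynomial `∑_{l=-d}^{d} F̂_l exp(-i l x)`; this sign makes the
expectation of the data generated below equal to `⟨ψ| F(H) exp(-i n τ H) |ψ⟩`. -/
def trigPoly {d : ℕ} (F : Fin (2 * d + 1) → ℂ) (x : ℝ) : ℂ :=
  ∑ l, F l * Complex.exp (-(Complex.I * (shift d l : ℂ) * (x : ℂ)))

/-- The interval `I`. -/
def innerInterval (lamPrior Δ : ℝ) : Set ℝ := Set.Icc (-Real.pi) (lamPrior + Δ / 4)

/-- The interval `I'`. -/
def outerInterval (lamPrior Δ : ℝ) : Set ℝ := Set.Icc (-Real.pi) (lamPrior + 3 * Δ / 4)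

/-- The range in which all the eigenvalues are assumed to lie. -/
def spectralRange (Δ : ℝ) : Set ℝ := Set.Icc (-Real.pi + Δ / 4) (Real.pi - Δ / 4)

/-- The filter is within `q` of `1` on `I` and within `q` of `0` off `I'`,
at all points of the spectral range. -/
def IsFilter {d : ℕ} (F : Fin (2 * d + 1) → ℂ) (q lamPrior Δ : ℝ) : Prop :=
  (∀ x ∈ spectralRange Δ ∩ innerInterval lamPrior Δ, ‖trigPoly F x - 1‖ ≤ q) ∧
  (∀ x ∈ spectralRange Δ \ outerInterval lamPrior Δ, ‖trigPoly F x‖ ≤ q)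

/-- `∑_l |F̂_l|`. -/
def filterMass {d : ℕ} (F : Fin (2 * d + 1) → ℂ) : ℝ := ∑ l, ‖F l‖

/-- The distribution `β_l = |F̂_l| / ∑_j |F̂_j|` of the random shift. -/
def shiftProb {d : ℕ} (F : Fin (2 * d + 1) → ℂ) (l : Fin (2 * d + 1)) : ℝ :=
  ‖F l‖ / filterMass F

/-! ## Multi-level QCELS with filtered data -/

/-- The number `J` of levels. -/
def numLevels (ε : ℝ) : ℕ := ⌈Real.logb 2 (1 / ε)⌉₊ + 1

/-- The time steps `τ_j`; levels are numbered from `0`, so that `timeStep δ ε N j` is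
the time step of the `(j+1)`-st level. -/
def timeStep (δ ε : ℝ) (N : ℕ) (j : ℕ) : ℝ :=
  (2 : ℝ) ^ ((j : ℤ) - (⌈Real.logb 2 (1 / ε)⌉₊ : ℤ)) * (δ / (N * ε))

/-- All the samples taken by the data generator: sample `k` for the data point `n`
at level `j`. -/
abbrev FilteredData (J N Ns d : ℕ) := Fin J → Fin N → Fin Ns → Sample (2 * d + 1)

/-- The law of the samples: they are independent, with evolution time `r + n τ_j`,
where `r` has the distribution `β`. -/
def filteredDataProb {M J N Ns d : ℕ} (H : Matrix (Fin M) (Fin M) ℂ) (ψ : Sys M)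
    (τ : ℕ → ℝ) (F : Fin (2 * d + 1) → ℂ) (ω : FilteredData J N Ns d) : ℝ :=
  ∏ j : Fin J, ∏ n : Fin N, ∏ k : Fin Ns,
    sampleProb H ψ (shiftProb F) (fun l => (shift d l : ℝ) + (n : ℕ) * τ j) (ω j n k)

/-- The value `Z_{k,n,q}` of one sample. -/
def sampleValue {d : ℕ} (F : Fin (2 * d + 1) → ℂ) (s : Sample (2 * d + 1)) : ℂ :=
  ((outcomeValue s.2.1 : ℂ) + Complex.I * (outcomeValue s.2.2 : ℂ)) *
    Complex.exp (Complex.I * (Complex.arg (F s.1) : ℂ)) * (filterMass F : ℂ)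

/-- The data point `Z_{n,q}` at level `j`. -/
def dataPoint {J N Ns d : ℕ} (F : Fin (2 * d + 1) → ℂ) (ω : FilteredData J N Ns d)
    (j : Fin J) (n : Fin N) : ℂ :=
  (1 / (Ns : ℂ)) * ∑ k, sampleValue F (ω j n k)

/-- The loss function. -/
def loss {N : ℕ} (Z : Fin N → ℂ) (τ : ℝ) (r : ℂ) (θ : ℝ) : ℝ :=
  (1 / (N : ℝ)) * ∑ n : Fin N,
    ‖Z n - r * Complex.exp (-(Complex.I * (θ : ℂ) * ((n : ℕ) : ℂ) * (τ : ℂ)))‖ ^ 2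

/-- The search interval for `θ` at each level: `[-π, π]` at the first level, and
`[θ_j - π/(2τ_j), θ_j + π/(2τ_j)]` after level `j`. -/
def searchInterval (τ θ : ℕ → ℝ) : ℕ → Set ℝ
  | 0 => Set.Icc (-Real.pi) Real.pi
  | j + 1 => Set.Icc (θ j - Real.pi / (2 * τ j)) (θ j + Real.pi / (2 * τ j))

/-- `(r, θ)` is a possible sequence of minimizers in the run of the algorithm
on the data `Z`. -/
def IsRun {J N : ℕ} (τ : ℕ → ℝ) (Z : Fin J → Fin N → ℂ) (r : ℕ → ℂ) (θ : ℕ → ℝ) : Prop :=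
  ∀ j : Fin J, θ j ∈ searchInterval τ θ j ∧
    ∀ r' : ℂ, ∀ θ' ∈ searchInterval τ θ j,
      loss (Z j) (τ j) (r j) (θ j) ≤ loss (Z j) (τ j) r' θ'

/-- The algorithm runs on the data `Z`, and its output, the last `θ`, is less than `ε` away
from `lam0` for every choice of the minimizers. -/
def Succeeds {J N : ℕ} (τ : ℕ → ℝ) (Z : Fin J → Fin N → ℂ) (ε lam0 : ℝ) : Prop :=
  (∃ r θ, IsRun τ Z r θ) ∧ ∀ r θ, IsRun τ Z r θ → |θ (J - 1) - lam0| < ε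

/-- The maximal evolution time for the construction of the loss functions: the largest of all
the durations `|r + n τ_j|`. -/
def lossMaxTime (J N d : ℕ) (τ : ℕ → ℝ) : ℝ :=
  ⨆ i : Fin J × Fin N × Fin (2 * d + 1), |(shift d i.2.2 : ℝ) + (i.2.1 : ℕ) * τ i.1|

/-- The total evolution time for the construction of the loss functions, in the worst case
over the random shifts `r`; each of the `Ns` samples runs two circuits. -/
def lossTotalTime (J N Ns d : ℕ) (τ : ℕ → ℝ) : ℝ :=
  ∑ j : Fin J, ∑ n : Fin N,
    2 * (Ns : ℝ) * ⨆ l : Fin (2 * d + 1), |(shift d l : ℝ) + (n : ℕ) * τ j|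

/-! ## Asymptotic notation -/

/-- `g = Θ̃(f)` with constants `c`, `C` and the polylogarithmic factor `L ^ k`, where `L ≥ 1`. -/
def ThetaTilde (c C : ℝ) (k : ℕ) (L f g : ℝ) : Prop := c * f ≤ g ∧ g ≤ C * f * L ^ k

end QCELS

end

/-!
The ancilla bit has mean `Re ⟨ψ, W e^{-itH} ψ⟩`, so a sample at time `t` estimates the signal
`∑ₘ pₘ exp(-i t λₘ)`, and drawing the shift `r` with probability proportional to `|F̂_r|` turns this
into an estimate of `∑ₘ pₘ F(λₘ) exp(-i n τ λₘ)`. With a filter `F` close to the indicator function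
of an interval that contains `λ₀` but no other eigenvalue, the data are
`p₀ exp(-i n τ λ₀)` up to noise. Such an `F` is the convolution of the indicator function with a
normalized power of the Fejér kernel; the sum of its coefficients is only logarithmic in the
degree, so the noise is controlled by Hoeffding's inequality.

Minimizing the loss over `r` amounts to maximizing the correlation `|∑ₙ Zₙ exp(i θ n τ)|`. Far from
`λ₀`, where `N |θ - λ₀| τ > 2π`, the correlation of the pure signal is a small fraction of its
maximum. Closer to it the correlation drops quadratically, whereas by Abel summation the noise gains
at most a multiple of `N |θ - λ₀| τ` times its largest partial sum; hence `N |θ - λ₀| τ < δ` at the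
maximum. As the noise of different data points is independent, the partial sums are small enough as
soon as `N Nₛ` is of order `p₀⁻² δ⁻²` up to logarithms. Each level thus confines `λ₀` to the search
interval of the next, whose time step is twice as long.

For the rough estimate, the weight of `|ψ⟩` below each point of a grid of step `Δ / 8` is estimated
from one common set of filtered samples; the first grid point below which it reaches
`p₀ / 2` is close to `λ₀`.
-/

noncomputable section

namespace QCELS

open MeasureTheory ProbabilityTheory

section Circuit

variable {M : ℕ} {H : Matrix (Fin M) (Fin M) ℂ} {lam : Fin M → ℝ}
  {v : OrthonormalBasis (Fin M) ℂ (Sys M)} {ψ : Sys M}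

open scoped Matrix.Norms.Operator in
theorem exp_mulVec_of_mulVec_eq_smul {n : Type*} [Fintype n] [DecidableEq n] {A : Matrix n n ℂ}
    {x : n → ℂ} {μ : ℂ} (h : A.mulVec x = μ • x) :
    (NormedSpace.exp A).mulVec x = Complex.exp μ • x := by
  have hpow (k : ℕ) : (A ^ k).mulVec x = μ ^ k • x := by
    induction k with
    | zero => simp
    | succ k ih =>
      rw [pow_succ, ← Matrix.mulVec_mulVec, h, Matrix.mulVec_smul, ih, smul_smul, pow_succ,
        mul_comm]
  have hcont : Continuous (Matrix.mulVec.addMonoidHomLeft x : Matrix n n ℂ →+ n → ℂ) := by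
    change Continuous fun B : Matrix n n ℂ => B.mulVec x
    fun_prop
  have hleft := (NormedSpace.exp_series_hasSum_exp' (𝕂 := ℂ) A).map _ hcont
  have hright := (NormedSpace.exp_series_hasSum_exp' (𝕂 := ℂ) μ).smul_const x
  rw [Complex.exp_eq_exp_ℂ]
  refine hleft.unique (hright.congr_fun fun k => ?_)
  change ((k.factorial : ℂ)⁻¹ • A ^ k).mulVec x = ((k.factorial : ℂ)⁻¹ • μ ^ k) • x
  rw [Matrix.smul_mulVec, hpow, smul_smul, smul_eq_mul]

/-- The orthonormal basis `v` consists of eigenvectors of `H`, with eigenvalues `lam`. -/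
def IsEigenbasis (H : Matrix (Fin M) (Fin M) ℂ) (lam : Fin M → ℝ)
    (v : OrthonormalBasis (Fin M) ℂ (Sys M)) : Prop :=
  ∀ m, Matrix.toEuclideanLin H (v m) = (lam m : ℂ) • v m

/-- The overlaps `|⟨v m, ψ⟩|²`, that is, the spectral distribution of the state `ψ`. -/
def overlap (v : OrthonormalBasis (Fin M) ℂ (Sys M)) (ψ : Sys M) (m : Fin M) : ℝ :=
  ‖inner ℂ (v m) ψ‖ ^ 2

/-- The Fourier transform `∑ₘ pₘ exp(-i t λₘ)` of a spectral distribution. -/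
def signal (p lam : Fin M → ℝ) (t : ℝ) : ℂ :=
  ∑ m, (p m : ℂ) * Complex.exp (-(Complex.I * (t : ℂ) * (lam m : ℂ)))

theorem overlap_mem_stdSimplex (v : OrthonormalBasis (Fin M) ℂ (Sys M)) (hψ : ‖ψ‖ = 1) :
    overlap v ψ ∈ stdSimplex ℝ (Fin M) :=
  ⟨fun _ => sq_nonneg _, by simp only [overlap, v.sum_sq_norm_inner_right, hψ, one_pow]⟩

theorem IsEigenbasis.evolution_apply (h : IsEigenbasis H lam v) (t : ℝ) (m : Fin M) :
    Matrix.toEuclideanLin (evolution H t) (v m)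
      = Complex.exp (-(Complex.I * (t : ℂ) * (lam m : ℂ))) • v m := by
  have hH : H.mulVec (v m).ofLp = (lam m : ℂ) • (v m).ofLp := by
    simpa [Matrix.toEuclideanLin] using congrArg WithLp.ofLp (h m)
  have hexp := exp_mulVec_of_mulVec_eq_smul (A := (-(Complex.I * (t : ℂ))) • H)
    (x := (v m).ofLp) (μ := -(Complex.I * (t : ℂ) * (lam m : ℂ))) (by
      rw [Matrix.smul_mulVec, hH, smul_smul, neg_mul])
  apply (WithLp.equiv 2 (Fin M → ℂ)).injective
  simpa [Matrix.toEuclideanLin, evolution] using hexp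

theorem IsEigenbasis.inner_evolution_right (h : IsEigenbasis H lam v) (t : ℝ) (m : Fin M) :
    inner ℂ (v m) (Matrix.toEuclideanLin (evolution H t) ψ)
      = Complex.exp (-(Complex.I * (t : ℂ) * (lam m : ℂ))) * inner ℂ (v m) ψ := by
  conv_lhs => rw [← v.sum_repr' ψ]
  simp only [map_sum, map_smul, h.evolution_apply, inner_sum, inner_smul_right, v.inner_eq_ite,
    mul_ite, mul_one, mul_zero, Finset.sum_ite_eq, Finset.mem_univ, if_true]
  exact mul_comm _ _

theorem IsEigenbasis.norm_evolution (h : IsEigenbasis H lam v) (t : ℝ) :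
    ‖Matrix.toEuclideanLin (evolution H t) ψ‖ = ‖ψ‖ := by
  rw [← pow_left_inj₀ (norm_nonneg _) (norm_nonneg _) two_ne_zero, ← v.sum_sq_norm_inner_right,
    ← v.sum_sq_norm_inner_right]
  simp [h.inner_evolution_right, Complex.norm_exp]

theorem IsEigenbasis.inner_evolution (h : IsEigenbasis H lam v) (t : ℝ) :
    inner ℂ ψ (Matrix.toEuclideanLin (evolution H t) ψ) = signal (overlap v ψ) lam t := by
  rw [← v.sum_inner_mul_inner]
  refine Finset.sum_congr rfl fun m _ => ?_
  rw [h.inner_evolution_right, ← inner_conj_symm ψ (v m), overlap, Complex.ofReal_pow,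
    ← Complex.conj_mul']
  ring

theorem norm_half_smul_add_smul_sq {E : Type*} [NormedAddCommGroup E] [InnerProductSpace ℂ E]
    {x y : E} (hx : ‖x‖ = 1) (hy : ‖y‖ = 1) {w : ℂ} (hw : ‖w‖ = 1) :
    ‖(1 / 2 : ℂ) • (x + w • y)‖ ^ 2 = (1 + (w * inner ℂ x y).re) / 2 := by
  rw [norm_smul, mul_pow, @norm_add_sq ℂ, inner_smul_right, norm_smul, hw, hx, hy]
  norm_num
  ring

theorem norm_outcomeValue (a : Fin 2) : ‖(outcomeValue a : ℂ)‖ = 1 := by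
  unfold outcomeValue
  split_ifs <;> simp

theorem circuitState_diag (w : ℂ) (t : ℝ) (a : Fin 2) :
    circuitState H ψ !![1, 0; 0, w] t a
      = (1 / 2 : ℂ) • (ψ + (outcomeValue a * w : ℂ) •
          Matrix.toEuclideanLin (evolution H t) ψ) := by
  have hs : ((1 / Real.sqrt 2 : ℝ) : ℂ) * ((1 / Real.sqrt 2 : ℝ) : ℂ) = 1 / 2 := by
    rw [← Complex.ofReal_mul, div_mul_div_comm, Real.mul_self_sqrt (by norm_num)]
    norm_num
  generalize hs' : ((1 / Real.sqrt 2 : ℝ) : ℂ) = s at hs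
  fin_cases a <;>
    simp only [circuitState, onAncilla, controlled, hadamardGate, Fin.sum_univ_two, outcomeValue,
      hs', Matrix.smul_of, Matrix.smul_cons, Matrix.of_apply, Matrix.cons_val',
      Matrix.cons_val_zero, Matrix.cons_val_one, Matrix.cons_val_fin_one, map_smul, smul_zero,
      add_zero, ← hs,
      Fin.zero_eta, Fin.mk_one, Fin.isValue, if_true, one_ne_zero, if_false, smul_eq_mul,
      Matrix.smul_empty, Complex.ofReal_one, Complex.ofReal_neg] <;>
    module

theorem IsEigenbasis.norm_circuitState_sq (h : IsEigenbasis H lam v) (hψ : ‖ψ‖ = 1) {w : ℂ}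
    (hw : ‖w‖ = 1) (t : ℝ) (a : Fin 2) :
    ‖circuitState H ψ !![1, 0; 0, w] t a‖ ^ 2
      = (1 + outcomeValue a * (w * signal (overlap v ψ) lam t).re) / 2 := by
  rw [circuitState_diag, norm_half_smul_add_smul_sq hψ ((h.norm_evolution t).trans hψ)
    (by rw [norm_mul, norm_outcomeValue, hw, one_mul]), h.inner_evolution, mul_assoc,
    Complex.re_ofReal_mul]

/-- The circuits with `W = I` and `W = S†` measure the real and the imaginary part of `g`:
this is all that the analysis of the algorithm uses of the quantum data. -/
def Measures (H : Matrix (Fin M) (Fin M) ℂ) (ψ : Sys M) (g : ℝ → ℂ) : Prop :=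
  ∀ t a, outcomeProb H ψ 1 t a = (1 + outcomeValue a * (g t).re) / 2 ∧
    outcomeProb H ψ sDagger t a = (1 + outcomeValue a * (g t).im) / 2

theorem IsEigenbasis.measures (h : IsEigenbasis H lam v) (hψ : ‖ψ‖ = 1) :
    Measures H ψ (signal (overlap v ψ) lam) := by
  refine fun t a => ⟨?_, ?_⟩
  · rw [outcomeProb, Matrix.one_fin_two, h.norm_circuitState_sq hψ norm_one, one_mul]
  · rw [outcomeProb, sDagger, h.norm_circuitState_sq hψ (by simp)]
    simp

end Circuit

section Sample

variable {M K : ℕ} {H : Matrix (Fin M) (Fin M) ℂ} {ψ : Sys M} {g : ℝ → ℂ} {p : Fin K → ℝ}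

theorem Measures.sampleProb_mem_stdSimplex (hg : Measures H ψ g) (hp : p ∈ stdSimplex ℝ (Fin K))
    (t : Fin K → ℝ) : sampleProb H ψ p t ∈ stdSimplex ℝ (Sample K) := by
  refine ⟨fun s => mul_nonneg (mul_nonneg (hp.1 _) (sq_nonneg _)) (sq_nonneg _), ?_⟩
  rw [Fintype.sum_prod_type, ← hp.2]
  refine Finset.sum_congr rfl fun l _ => ?_
  simp only [Fintype.sum_prod_type, Fin.sum_univ_two, sampleProb, (hg _ _).1, (hg _ _).2,
    outcomeValue, if_true, one_ne_zero, if_false]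
  ring

/-- The statistic `a l * (X + i Y)` of a sample `(l, X, Y)`. -/
def weightedValue (a : Fin K → ℂ) (s : Sample K) : ℂ :=
  a s.1 * ((outcomeValue s.2.1 : ℂ) + Complex.I * (outcomeValue s.2.2 : ℂ))

theorem Measures.sum_sampleProb_mul_weightedValue (hg : Measures H ψ g) (p t : Fin K → ℝ)
    (a : Fin K → ℂ) :
    ∑ s, (sampleProb H ψ p t s : ℂ) * weightedValue a s = ∑ l, (p l : ℂ) * a l * g (t l) := by
  rw [Fintype.sum_prod_type]
  refine Finset.sum_congr rfl fun l _ => ?_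
  rw [← Complex.re_add_im (g (t l))]
  simp only [Fintype.sum_prod_type, Fin.sum_univ_two, sampleProb, (hg _ _).1, (hg _ _).2,
    outcomeValue, weightedValue, if_true, one_ne_zero, if_false]
  push_cast
  ring

theorem norm_weightedValue_le {a : Fin K → ℂ} {B : ℝ} (ha : ∀ l, ‖a l‖ ≤ B) (s : Sample K) :
    ‖weightedValue a s‖ ≤ 2 * B := by
  have h : ‖(outcomeValue s.2.1 : ℂ) + Complex.I * (outcomeValue s.2.2 : ℂ)‖ ≤ 2 := by
    refine (norm_add_le _ _).trans_eq ?_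
    rw [norm_mul, norm_outcomeValue, norm_outcomeValue, Complex.norm_I]
    norm_num
  rw [weightedValue, norm_mul, mul_comm]
  exact mul_le_mul h (ha _) (norm_nonneg _) zero_le_two

end Sample

section Probability

variable {Ω : Type} [Fintype Ω] {w : Ω → ℝ}

/-- The measure with point masses `w ω`, which makes Mathlib's probability theory available for
`prob`. -/
def weightMeasure [MeasurableSpace Ω] (w : Ω → ℝ) : Measure Ω :=
  ∑ ω, ENNReal.ofReal (w ω) • Measure.dirac ω

section Measure

variable [MeasurableSpace Ω] [MeasurableSingletonClass Ω]

theorem weightMeasure_singleton (w : Ω → ℝ) (ω : Ω) :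
    weightMeasure w {ω} = ENNReal.ofReal (w ω) := by
  classical
  simp [weightMeasure, Measure.finsetSum_apply, Set.indicator_apply]

instance isFiniteMeasure_weightMeasure (w : Ω → ℝ) : IsFiniteMeasure (weightMeasure w) :=
  ⟨by simp [weightMeasure, Measure.finsetSum_apply, ENNReal.sum_lt_top]⟩

theorem weightMeasure_real (hw : ∀ ω, 0 ≤ w ω) (E : Ω → Prop) :
    (weightMeasure w).real {ω | E ω} = prob w E := by
  classical
  rw [← Set.coe_toFinset {ω | E ω}, ← sum_measureReal_singleton, prob]
  simp only [measureReal_def, weightMeasure_singleton, ENNReal.toReal_ofReal (hw _),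
    Set.toFinset_ofPred, Finset.sum_filter, Set.indicator_apply, Set.mem_ofPred_eq]

theorem isProbabilityMeasure_weightMeasure (hw : w ∈ stdSimplex ℝ Ω) :
    IsProbabilityMeasure (weightMeasure w) := by
  rw [isProbabilityMeasure_iff_real, ← Set.ofPred_true, weightMeasure_real hw.1, ← hw.2]
  simp [prob]

theorem integral_weightMeasure (hw : ∀ ω, 0 ≤ w ω) (f : Ω → ℝ) :
    ∫ ω, f ω ∂weightMeasure w = ∑ ω, w ω * f ω := by
  rw [integral_fintype .of_finite]
  simp [measureReal_def, weightMeasure_singleton, hw]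

theorem weightMeasure_pi {ι : Type} [Fintype ι] [DecidableEq ι] {w : ι → Ω → ℝ}
    (hw : ∀ i, w i ∈ stdSimplex ℝ Ω) :
    weightMeasure (fun ω : ι → Ω => ∏ i, w i (ω i)) = Measure.pi fun i => weightMeasure (w i) := by
  refine Measure.ext_of_singleton fun ω => ?_
  rw [Measure.pi_singleton, weightMeasure_singleton,
    ENNReal.ofReal_prod_of_nonneg fun i _ => (hw i).1 _]
  simp only [weightMeasure_singleton]

end Measure

theorem prob_mono (hw : ∀ ω, 0 ≤ w ω) {E E' : Ω → Prop} (h : ∀ ω, E ω → E' ω) :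
    prob w E ≤ prob w E' :=
  Finset.sum_le_sum fun ω _ =>
    Set.indicator_le_indicator_of_subset (fun _ hω => h _ hω) (fun ω => hw ω) ω

theorem prob_or_le (hw : ∀ ω, 0 ≤ w ω) (E E' : Ω → Prop) :
    prob w (fun ω => E ω ∨ E' ω) ≤ prob w E + prob w E' := by
  let _ : MeasurableSpace Ω := ⊤
  simp only [← weightMeasure_real hw]
  exact measureReal_union_le _ _

theorem prob_exists_le (hw : ∀ ω, 0 ≤ w ω) {κ : Type*} [Fintype κ] {E : κ → Ω → Prop} {b : ℝ}
    (hb : ∀ i, prob w (E i) ≤ b) : prob w (fun ω => ∃ i, E i ω) ≤ Fintype.card κ * b := by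
  let _ : MeasurableSpace Ω := ⊤
  simp only [← weightMeasure_real hw, Set.ofPred_exists] at hb ⊢
  refine (measureReal_iUnion_fintype_le _).trans ((Finset.sum_le_sum fun i _ => hb i).trans_eq ?_)
  rw [Finset.sum_const, nsmul_eq_mul, Finset.card_univ]

theorem one_sub_le_prob (hw : w ∈ stdSimplex ℝ Ω) {E B : Ω → Prop} (h : ∀ ω, ¬ B ω → E ω) {b : ℝ}
    (hB : prob w B ≤ b) : 1 - b ≤ prob w E := by
  let _ : MeasurableSpace Ω := ⊤
  have := isProbabilityMeasure_weightMeasure hw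
  refine (sub_le_sub_left hB 1).trans (le_of_eq_of_le ?_ (prob_mono hw.1 h))
  simp only [← weightMeasure_real hw.1]
  exact (probReal_compl_eq_one_sub .of_discrete).symm

theorem prob_equiv {Ω' : Type} [Fintype Ω'] (e : Ω ≃ Ω') (w : Ω' → ℝ) (E : Ω' → Prop) :
    prob (fun ω => w (e ω)) (fun ω => E (e ω)) = prob w E :=
  Fintype.sum_equiv e _ _ fun _ => rfl

theorem norm_sum_smul_le {E : Type*} [NormedAddCommGroup E] [NormedSpace ℝ E]
    (hw : w ∈ stdSimplex ℝ Ω) {f : Ω → E} {b : ℝ} (hf : ∀ ω, ‖f ω‖ ≤ b) :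
    ‖∑ ω, w ω • f ω‖ ≤ b :=
  mem_closedBall_zero_iff.1 <| (convex_closedBall (0 : E) b).sum_mem (fun ω _ => hw.1 ω) hw.2
    fun ω _ => mem_closedBall_zero_iff.2 (hf ω)

end Probability

section Hoeffding

variable {ι Ω : Type} [Fintype ι] [DecidableEq ι] [Fintype Ω] {w : ι → Ω → ℝ}

theorem prod_mem_stdSimplex (hw : ∀ i, w i ∈ stdSimplex ℝ Ω) :
    (fun ω : ι → Ω => ∏ i, w i (ω i)) ∈ stdSimplex ℝ (ι → Ω) := by
  refine ⟨fun ω => Finset.prod_nonneg fun i _ => (hw i).1 _, ?_⟩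
  rw [← Fintype.piFinset_univ, ← Finset.prod_univ_sum fun _ => Finset.univ]
  exact Finset.prod_eq_one fun i _ => (hw i).2

theorem hasSubgaussianMGF_weightMeasure [MeasurableSpace Ω] [DiscreteMeasurableSpace Ω] {w : Ω → ℝ}
    (hw : w ∈ stdSimplex ℝ Ω) {f : Ω → ℝ} {b : ℝ} (hf : ∀ x, |f x| ≤ b)
    (h0 : ∑ x, w x * f x = 0) :
    HasSubgaussianMGF f (‖b‖₊ ^ 2) (weightMeasure w) := by
  have := isProbabilityMeasure_weightMeasure hw
  have h := hasSubgaussianMGF_of_mem_Icc_of_integral_eq_zero (μ := weightMeasure w)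
    (Measurable.of_discrete (f := f)).aemeasurable (ae_of_all _ fun x => abs_le.1 (hf x))
    ((integral_weightMeasure hw.1 f).trans h0)
  convert h using 2
  rw [sub_neg_eq_add, ← two_mul, nnnorm_mul, Real.nnnorm_ofNat]
  field_simp

theorem prob_sum_ge_le (hw : ∀ i, w i ∈ stdSimplex ℝ Ω) (s : Finset ι) {f : ι → Ω → ℝ}
    {b : ι → ℝ} (hf : ∀ i ∈ s, ∀ x, |f i x| ≤ b i)
    (h0 : ∀ i ∈ s, ∑ x, w i x * f i x = 0) {V t : ℝ}
    (hb : ∑ i ∈ s, b i ^ 2 ≤ V) (ht : 0 ≤ t) :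
    prob (fun ω : ι → Ω => ∏ i, w i (ω i)) (fun ω => t ≤ ∑ i ∈ s, f i (ω i))
      ≤ Real.exp (-(t ^ 2 / (2 * V))) := by
  let _ : MeasurableSpace Ω := ⊤
  have (i : ι) := isProbabilityMeasure_weightMeasure (hw i)
  have hsum := HasSubgaussianMGF.sum_of_iIndepFun (s := s)
    (iIndepFun_pi fun i => (Measurable.of_discrete (f := f i)).aemeasurable) fun i hi =>
      HasSubgaussianMGF.of_map (μ := Measure.pi fun i => weightMeasure (w i)) (X := f i)
        (measurable_pi_apply i).aemeasurable <| by
          rw [(measurePreserving_eval _ i).map_eq]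
          exact hasSubgaussianMGF_weightMeasure (hw i) (hf i hi) (h0 i hi)
  have hV : ((∑ i ∈ s, ‖b i‖₊ ^ 2 : NNReal) : ℝ) ≤ V := by simpa using hb
  have hsubG : HasSubgaussianMGF (fun ω : ι → Ω => ∑ i ∈ s, f i (ω i))
      ⟨V, (NNReal.coe_nonneg _).trans hV⟩ (Measure.pi fun i => weightMeasure (w i)) :=
    ⟨hsum.integrable_exp_mul, fun r => (hsum.mgf_le r).trans <| Real.exp_le_exp.2 <| by
      gcongr
      exact hV⟩
  rw [← weightMeasure_real (prod_mem_stdSimplex hw).1, weightMeasure_pi hw, ← neg_div]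
  exact hsubG.measure_ge_le ht

theorem prob_abs_sum_ge_le (hw : ∀ i, w i ∈ stdSimplex ℝ Ω) (s : Finset ι) {f : ι → Ω → ℝ}
    {b : ι → ℝ} (hf : ∀ i ∈ s, ∀ x, |f i x| ≤ b i)
    (h0 : ∀ i ∈ s, ∑ x, w i x * f i x = 0) {V t : ℝ}
    (hb : ∑ i ∈ s, b i ^ 2 ≤ V) (ht : 0 ≤ t) :
    prob (fun ω : ι → Ω => ∏ i, w i (ω i)) (fun ω => t ≤ |∑ i ∈ s, f i (ω i)|)
      ≤ 2 * Real.exp (-(t ^ 2 / (2 * V))) := by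
  have hp := (prod_mem_stdSimplex hw).1
  have hupper := prob_sum_ge_le hw s hf h0 hb ht
  have hlower := prob_sum_ge_le hw s (f := fun i x => -f i x)
    (fun i hi x => (abs_neg _).trans_le (hf i hi x)) (fun i hi => by simp [h0 i hi]) hb ht
  have hor := (prob_mono hp (E := fun ω => t ≤ |∑ i ∈ s, f i (ω i)|)
    (E' := fun ω => t ≤ ∑ i ∈ s, f i (ω i) ∨ t ≤ ∑ i ∈ s, -f i (ω i)) fun ω h => by
      rw [Finset.sum_neg_distrib]; exact le_abs.1 h).trans (prob_or_le hp _ _)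
  linarith

theorem prob_norm_sum_ge_le (hw : ∀ i, w i ∈ stdSimplex ℝ Ω) (s : Finset ι) {f : ι → Ω → ℂ}
    {b : ι → ℝ} (hf : ∀ i ∈ s, ∀ x, ‖f i x‖ ≤ b i)
    (h0 : ∀ i ∈ s, ∑ x, (w i x : ℂ) * f i x = 0) {V t : ℝ}
    (hb : ∑ i ∈ s, b i ^ 2 ≤ V) (ht : 0 ≤ t) :
    prob (fun ω : ι → Ω => ∏ i, w i (ω i)) (fun ω => 2 * t ≤ ‖∑ i ∈ s, f i (ω i)‖)
      ≤ 4 * Real.exp (-(t ^ 2 / (2 * V))) := by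
  have hp := (prod_mem_stdSimplex hw).1
  have hre := prob_abs_sum_ge_le hw s (f := fun i x => (f i x).re)
    (fun i hi x => (Complex.abs_re_le_norm _).trans (hf i hi x))
    (fun i hi => by simpa using congrArg Complex.re (h0 i hi)) hb ht
  have him := prob_abs_sum_ge_le hw s (f := fun i x => (f i x).im)
    (fun i hi x => (Complex.abs_im_le_norm _).trans (hf i hi x))
    (fun i hi => by simpa using congrArg Complex.im (h0 i hi)) hb ht
  have hor := (prob_mono hp (E := fun ω => 2 * t ≤ ‖∑ i ∈ s, f i (ω i)‖)
    (E' := fun ω => t ≤ |∑ i ∈ s, (f i (ω i)).re| ∨ t ≤ |∑ i ∈ s, (f i (ω i)).im|) fun ω h => by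
      have hnorm := Complex.norm_le_abs_re_add_abs_im (∑ i ∈ s, f i (ω i))
      rw [Complex.re_sum, Complex.im_sum] at hnorm
      by_contra! hsmall
      linarith [hsmall.1, hsmall.2]).trans (prob_or_le hp _ _)
  linarith

theorem prob_abs_average_sub_ge_le {w : Ω → ℝ} (hw : w ∈ stdSimplex ℝ Ω) {f : Ω → ℝ} {B : ℝ}
    (hf : ∀ x, |f x| ≤ B) (n : ℕ) {t : ℝ} (ht : 0 ≤ t) :
    prob (fun ω : Fin n → Ω => ∏ k, w (ω k))
      (fun ω => t ≤ |(∑ k, f (ω k)) / n - ∑ x, w x * f x|)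
      ≤ 2 * Real.exp (-(n * t ^ 2 / (8 * B ^ 2))) := by
  set μ := ∑ x, w x * f x
  have hμ : |μ| ≤ B := norm_sum_smul_le hw (f := f) hf
  have hcentered (x : Ω) : |f x - μ| ≤ 2 * B := by linarith [abs_sub (f x) μ, hf x]
  have hzero : ∑ x, w x * (f x - μ) = 0 := by
    simp only [mul_sub, Finset.sum_sub_distrib, ← Finset.sum_mul, hw.2, one_mul, sub_self, μ]
  have hsum := prob_abs_sum_ge_le (ι := Fin n) (fun _ => hw) Finset.univ (fun _ _ => hcentered)
    (fun _ _ => hzero) (V := n * (2 * B) ^ 2) (t := n * t) (by simp) (by positivity)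
  refine (prob_mono (prod_mem_stdSimplex fun _ : Fin n => hw).1 fun ω hω => ?_).trans
    (hsum.trans_eq ?_)
  · rcases n.eq_zero_or_pos with rfl | hn
    · simp
    · have hn' : (0 : ℝ) < n := mod_cast hn
      have hscale : |∑ k, (f (ω k) - μ)| = n * |(∑ k, f (ω k)) / n - μ| := by
        rw [← abs_of_pos hn', ← abs_mul, abs_of_pos hn', mul_sub, mul_div_cancel₀ _ hn'.ne',
          Finset.sum_sub_distrib, Finset.sum_const, Finset.card_univ, Fintype.card_fin,
          nsmul_eq_mul]
      rw [hscale]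
      gcongr
  · congr 3
    field_simp
    ring

end Hoeffding

section Dirichlet

/-- The exponential sum `∑_{k < M} exp(i k x)`. -/
def dirichletSum (M : ℕ) (x : ℝ) : ℂ :=
  ∑ k ∈ Finset.range M, Complex.exp (Complex.I * x) ^ k

@[fun_prop]
theorem continuous_dirichletSum (M : ℕ) : Continuous (dirichletSum M) := by
  unfold dirichletSum
  fun_prop

theorem dirichletSum_add_two_pi (M : ℕ) (x : ℝ) :
    dirichletSum M (x + 2 * Real.pi) = dirichletSum M x := by
  have hperiod : Complex.I * ((x + 2 * Real.pi : ℝ) : ℂ)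
      = Complex.I * x + 2 * Real.pi * Complex.I := by
    push_cast
    ring
  simp only [dirichletSum, hperiod, Complex.exp_periodic _]

theorem dirichletSum_neg (M : ℕ) (x : ℝ) :
    dirichletSum M (-x) = (starRingEnd ℂ) (dirichletSum M x) := by
  simp [dirichletSum, ← Complex.exp_conj]

theorem norm_dirichletSum_neg (M : ℕ) (x : ℝ) :
    ‖dirichletSum M (-x)‖ = ‖dirichletSum M x‖ := by
  rw [dirichletSum_neg, RCLike.norm_conj]

theorem div_pi_le_sin_half {w x : ℝ} (hw : 0 ≤ w) (hx : w ≤ x) (hx' : x ≤ 2 * Real.pi - w) :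
    w / Real.pi ≤ Real.sin (x / 2) := by
  rcases le_total x Real.pi with h | h
  · calc w / Real.pi ≤ 2 / Real.pi * (x / 2) := by
          rw [div_mul_div_cancel₀' two_ne_zero]
          exact div_le_div_of_nonneg_right hx Real.pi_nonneg
      _ ≤ Real.sin (x / 2) := Real.mul_le_sin (by linarith) (by linarith)
  · calc w / Real.pi ≤ 2 / Real.pi * (Real.pi - x / 2) := by
          rw [div_mul_eq_mul_div]
          exact div_le_div_of_nonneg_right (by linarith) Real.pi_nonneg
      _ ≤ Real.sin (Real.pi - x / 2) := Real.mul_le_sin (by linarith) (by linarith)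
      _ = Real.sin (x / 2) := Real.sin_pi_sub _

theorem norm_dirichletSum_le (M : ℕ) {w x : ℝ} (hw : 0 < w) (hx : w ≤ x)
    (hx' : x ≤ 2 * Real.pi - w) : ‖dirichletSum M x‖ ≤ Real.pi / w := by
  have hsin := div_pi_le_sin_half hw.le hx hx'
  have hpos : 0 < w / Real.pi := div_pos hw Real.pi_pos
  have hgeom : ‖dirichletSum M x‖ * (2 * Real.sin (x / 2)) ≤ 2 := by
    rw [← Real.norm_of_nonneg (mul_nonneg zero_le_two (hpos.le.trans hsin)),
      ← Complex.norm_exp_I_mul_ofReal_sub_one, ← norm_mul, dirichletSum, geom_sum_mul]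
    refine (norm_sub_le _ _).trans_eq ?_
    rw [norm_pow, mul_comm, Complex.norm_exp_ofReal_mul_I, one_pow, norm_one, one_add_one_eq_two]
  have hmul := mul_le_mul_of_nonneg_left hsin (norm_nonneg (dirichletSum M x))
  rw [← inv_div, ← one_div, le_div_iff₀ hpos]
  linarith

theorem normSq_dirichletSum (B : ℕ) (x : ℝ) :
    ((‖dirichletSum (B + 1) x‖ ^ 2 : ℝ) : ℂ)
      = Complex.exp (-(Complex.I * B * x)) * dirichletSum (B + 1) x ^ 2 := by
  have hconj : (starRingEnd ℂ) (dirichletSum (B + 1) x)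
      = Complex.exp (-(Complex.I * B * x)) * dirichletSum (B + 1) x := by
    rw [← dirichletSum_neg, dirichletSum, dirichletSum, Finset.mul_sum, ← Finset.sum_range_reflect]
    refine Finset.sum_congr rfl fun k hk => ?_
    obtain ⟨n, rfl⟩ := Nat.exists_eq_add_of_le (Nat.le_of_lt_succ (Finset.mem_range.1 hk))
    rw [← Complex.exp_nat_mul, ← Complex.exp_nat_mul, ← Complex.exp_add, Nat.add_sub_cancel,
      Nat.add_sub_cancel_left]
    congr 1
    push_cast
    ring
  push_cast
  rw [← Complex.conj_mul', hconj]
  ring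

end Dirichlet

section Kernel

open Polynomial in
/-- The coefficients of `(1 + X + ⋯ + X ^ B) ^ (2 m)`, which are up to a shift of the index by
`m B` the Fourier coefficients of the `m`-th power of the Fejér kernel. -/
def kernelCoeff (m B j : ℕ) : ℝ :=
  ((∑ k ∈ Finset.range (B + 1), (X : ℝ[X]) ^ k) ^ (2 * m)).coeff j

/-- The `m`-th power of the (unnormalized) Fejér kernel of degree `B`. -/
def kernel (m B : ℕ) (x : ℝ) : ℝ := ‖dirichletSum (B + 1) x‖ ^ (2 * m)

@[fun_prop]
theorem continuous_kernel (m B : ℕ) : Continuous (kernel m B) :=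
  (continuous_dirichletSum _).norm.pow _

theorem kernel_nonneg (m B : ℕ) (x : ℝ) : 0 ≤ kernel m B x := pow_nonneg (norm_nonneg _) _

theorem kernel_add_two_pi (m B : ℕ) (x : ℝ) : kernel m B (x + 2 * Real.pi) = kernel m B x := by
  rw [kernel, dirichletSum_add_two_pi, kernel]

open Polynomial in
theorem dirichletSum_pow_eq_sum_kernelCoeff (m B : ℕ) (x : ℝ) :
    dirichletSum (B + 1) x ^ (2 * m) = ∑ l ∈ Finset.range (2 * (m * B) + 1),
      (kernelCoeff m B l : ℂ) * Complex.exp (Complex.I * x) ^ l := by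
  have hdegree : ((∑ k ∈ Finset.range (B + 1), (X : ℝ[X]) ^ k) ^ (2 * m)).natDegree
      < 2 * (m * B) + 1 := by
    rw [← mul_assoc, Nat.lt_add_one_iff]
    refine natDegree_pow_le_of_le _ (natDegree_sum_le_of_forall_le _ _ fun k hk => ?_)
    rw [natDegree_X_pow]
    exact Nat.le_of_lt_succ (Finset.mem_range.1 hk)
  have heval := aeval_eq_sum_range' hdegree (Complex.exp (Complex.I * x))
  simpa only [map_pow, map_sum, aeval_X, Complex.real_smul, dirichletSum, kernelCoeff] using heval

theorem kernel_eq_sum (m B : ℕ) (x : ℝ) :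
    (kernel m B x : ℂ) = ∑ l : Fin (2 * (m * B) + 1), (kernelCoeff m B l : ℂ) *
      Complex.exp (Complex.I * (shift (m * B) l : ℂ) * (x : ℂ)) := by
  have hpow : (kernel m B x : ℂ) = Complex.exp (-(Complex.I * ((m * B : ℕ) : ℂ) * x))
      * dirichletSum (B + 1) x ^ (2 * m) := by
    rw [kernel, pow_mul, Complex.ofReal_pow, normSq_dirichletSum, mul_pow, ← pow_mul,
      ← Complex.exp_nat_mul]
    congr 2
    push_cast
    ring
  rw [hpow, dirichletSum_pow_eq_sum_kernelCoeff, Finset.sum_range, Finset.mul_sum]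
  refine Finset.sum_congr rfl fun l _ => ?_
  rw [← Complex.exp_nat_mul, mul_left_comm, ← Complex.exp_add, shift]
  congr 2
  push_cast
  ring

theorem integral_exp_I_int (n : ℤ) :
    ∫ x in (0 : ℝ)..(2 * Real.pi), Complex.exp (Complex.I * (n : ℂ) * (x : ℂ))
      = if n = 0 then 2 * (Real.pi : ℂ) else 0 := by
  split_ifs with h
  · simp [h]
  · have hperiod : Complex.I * (n : ℂ) * ((2 * Real.pi : ℝ) : ℂ)
        = n * (2 * Real.pi * Complex.I) := by
      push_cast
      ring
    rw [integral_exp_mul_complex (mul_ne_zero Complex.I_ne_zero (Int.cast_ne_zero.2 h)), hperiod,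
      Complex.exp_int_mul_two_pi_mul_I]
    simp

theorem norm_integral_exp_I_int_le {n : ℤ} (h : n ≠ 0) (a b : ℝ) :
    ‖∫ x in a..b, Complex.exp (Complex.I * (n : ℂ) * (x : ℂ))‖ ≤ 2 / |(n : ℝ)| := by
  have hunit (x : ℝ) : ‖Complex.exp (Complex.I * (n : ℂ) * (x : ℂ))‖ = 1 := by
    simp [Complex.norm_exp]
  have hnorm : ‖Complex.I * (n : ℂ)‖ = |(n : ℝ)| := by simp
  rw [integral_exp_mul_complex (mul_ne_zero Complex.I_ne_zero (Int.cast_ne_zero.2 h)), norm_div,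
    hnorm]
  gcongr
  refine (norm_sub_le _ _).trans_eq ?_
  rw [hunit, hunit, one_add_one_eq_two]

theorem shift_sub_eq_zero_iff {d : ℕ} (l j : Fin (2 * d + 1)) :
    shift d l - shift d j = 0 ↔ l = j := by
  rw [shift, shift, Fin.ext_iff]
  omega

theorem integral_kernel_mul_exp (m B : ℕ) (j : Fin (2 * (m * B) + 1)) :
    ∫ x in (0 : ℝ)..(2 * Real.pi), (kernel m B x : ℂ) *
      Complex.exp (-(Complex.I * (shift (m * B) j : ℂ) * (x : ℂ)))
      = 2 * Real.pi * kernelCoeff m B j := by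
  have hexpand (x : ℝ) : (kernel m B x : ℂ) *
      Complex.exp (-(Complex.I * (shift (m * B) j : ℂ) * (x : ℂ)))
      = ∑ l : Fin (2 * (m * B) + 1), (kernelCoeff m B l : ℂ) *
      Complex.exp (Complex.I * ((shift (m * B) l - shift (m * B) j : ℤ) : ℂ) * (x : ℂ)) := by
    rw [kernel_eq_sum, Finset.sum_mul]
    refine Finset.sum_congr rfl fun l _ => ?_
    rw [mul_assoc, ← Complex.exp_add]
    congr 2
    push_cast
    ring
  simp only [hexpand]
  rw [intervalIntegral.integral_finsetSum
    (fun l _ => (Continuous.intervalIntegrable (by fun_prop) _ _))]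
  simp only [intervalIntegral.integral_const_mul, integral_exp_I_int, shift_sub_eq_zero_iff,
    mul_ite, mul_zero, Finset.sum_ite_eq', Finset.mem_univ, if_true]
  exact mul_comm _ _

/-- The index of the shift `0`. -/
def midIndex (d : ℕ) : Fin (2 * d + 1) := ⟨d, by omega⟩

@[simp]
theorem shift_midIndex (d : ℕ) : shift d (midIndex d) = 0 := by simp [shift, midIndex]

theorem integral_kernel (m B : ℕ) :
    ∫ x in (0 : ℝ)..(2 * Real.pi), kernel m B x = 2 * Real.pi * kernelCoeff m B (m * B) := by
  have h := integral_kernel_mul_exp m B (midIndex (m * B))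
  simp only [shift_midIndex, Int.cast_zero, mul_zero, zero_mul, neg_zero, Complex.exp_zero,
    mul_one, intervalIntegral.integral_ofReal] at h
  exact_mod_cast h

theorem abs_kernelCoeff_le (m B : ℕ) (j : Fin (2 * (m * B) + 1)) :
    |kernelCoeff m B j| ≤ kernelCoeff m B (m * B) := by
  have hint : ‖∫ x in (0 : ℝ)..(2 * Real.pi), (kernel m B x : ℂ) *
      Complex.exp (-(Complex.I * (shift (m * B) j : ℂ) * (x : ℂ)))‖
      ≤ ∫ x in (0 : ℝ)..(2 * Real.pi), kernel m B x := by
    refine (intervalIntegral.norm_integral_le_integral_norm Real.two_pi_pos.le).trans_eq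
      (intervalIntegral.integral_congr fun x _ => ?_)
    simp [Complex.norm_exp, abs_of_nonneg (kernel_nonneg m B x)]
  rw [integral_kernel_mul_exp, integral_kernel] at hint
  refine le_of_mul_le_mul_left ?_ Real.two_pi_pos
  simpa [abs_of_pos Real.pi_pos] using hint

theorem kernelCoeff_mid_ge (m B : ℕ) :
    ((B : ℝ) + 1) ^ (2 * m) ≤ (2 * (m * B : ℕ) + 1) * kernelCoeff m B (m * B) := by
  have hzero : kernel m B 0 = ((B : ℝ) + 1) ^ (2 * m) := by
    simp only [kernel, dirichletSum, Complex.ofReal_zero, mul_zero, Complex.exp_zero, one_pow,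
      Finset.sum_const, Finset.card_range, nsmul_eq_mul, mul_one, Complex.norm_natCast]
    rw [Nat.cast_add_one]
  have hsum : kernel m B 0 = ∑ l : Fin (2 * (m * B) + 1), kernelCoeff m B l := by
    exact_mod_cast (by simpa using kernel_eq_sum m B 0 :
      (kernel m B 0 : ℂ) = ∑ l : Fin (2 * (m * B) + 1), (kernelCoeff m B l : ℂ))
  rw [← hzero, hsum]
  refine (Finset.sum_le_sum fun l _ =>
    (le_abs_self _).trans (abs_kernelCoeff_le m B l)).trans_eq ?_
  simp

theorem kernelCoeff_mid_pos (m B : ℕ) : 0 < kernelCoeff m B (m * B) :=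
  pos_of_mul_pos_right ((by positivity : (0 : ℝ) < (B + 1) ^ (2 * m)).trans_le
    (kernelCoeff_mid_ge m B)) (by positivity)

theorem kernelCoeff_one_mid (B : ℕ) : kernelCoeff 1 B B = B + 1 := by
  simp only [kernelCoeff, mul_one, sq, Polynomial.coeff_mul, Polynomial.finsetSum_coeff,
    Polynomial.coeff_X_pow, Finset.sum_ite_eq, Finset.mem_range]
  rw [Finset.sum_congr rfl (g := fun _ => 1)]
  · simp
  · intro p hp
    have := Finset.HasAntidiagonal.mem_antidiagonal.1 hp
    rw [if_pos (by omega), if_pos (by omega), one_mul]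

theorem integral_normSq_dirichletSum (B : ℕ) :
    ∫ x in (0 : ℝ)..(2 * Real.pi), ‖dirichletSum (B + 1) x‖ ^ 2 = 2 * Real.pi * (B + 1) := by
  simpa only [kernel, mul_one, one_mul, kernelCoeff_one_mid] using integral_kernel 1 B

theorem integral_kernel_tail_le (m B : ℕ) {w s t : ℝ} (hw : 0 < w) (hs : w ≤ s) (hst : s ≤ t)
    (ht : t ≤ 2 * Real.pi - w) :
    ∫ x in s..t, kernel (m + 1) B x ≤ (Real.pi / w) ^ (2 * m) * (2 * Real.pi * (B + 1)) := by
  have hc : Continuous fun x => ‖dirichletSum (B + 1) x‖ ^ 2 := by fun_prop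
  calc ∫ x in s..t, kernel (m + 1) B x
      ≤ ∫ x in s..t, (Real.pi / w) ^ (2 * m) * ‖dirichletSum (B + 1) x‖ ^ 2 := by
        refine intervalIntegral.integral_mono_on hst
          (Continuous.intervalIntegrable (by fun_prop) _ _)
          ((continuous_const.mul hc).intervalIntegrable _ _) fun x hx => ?_
        rw [kernel, mul_add_one, pow_add]
        gcongr
        exact norm_dirichletSum_le _ hw (hs.trans hx.1) (hx.2.trans ht)
    _ = (Real.pi / w) ^ (2 * m) * ∫ x in s..t, ‖dirichletSum (B + 1) x‖ ^ 2 :=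
        intervalIntegral.integral_const_mul _ _
    _ ≤ (Real.pi / w) ^ (2 * m) * (2 * Real.pi * (B + 1)) := by
        rw [← integral_normSq_dirichletSum]
        gcongr
        exact intervalIntegral.integral_mono_interval (by linarith) hst (by linarith)
          (ae_of_all _ fun x => sq_nonneg _) (hc.intervalIntegrable _ _)

end Kernel

section KernelMass

variable {m B : ℕ} {w q s t : ℝ}

/-- The mass of `[s, t]` under the `m`-th power of the Fejér kernel, normalized to have mass `1`
on a period. -/
def kernelMass (m B : ℕ) (s t : ℝ) : ℝ :=
  (∫ x in s..t, kernel m B x) / (2 * Real.pi * kernelCoeff m B (m * B))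

theorem two_pi_mul_kernelCoeff_mid_pos (m B : ℕ) : 0 < 2 * Real.pi * kernelCoeff m B (m * B) :=
  mul_pos Real.two_pi_pos (kernelCoeff_mid_pos m B)

theorem intervalIntegrable_kernel (m B : ℕ) (s t : ℝ) :
    IntervalIntegrable (kernel m B) volume s t :=
  (continuous_kernel m B).intervalIntegrable s t

theorem kernelMass_period (m B : ℕ) (s : ℝ) : kernelMass m B s (s + 2 * Real.pi) = 1 := by
  have hperiod : Function.Periodic (kernel m B) (2 * Real.pi) := kernel_add_two_pi m B
  rw [kernelMass, hperiod.intervalIntegral_add_eq s 0, zero_add, integral_kernel,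
    div_self (two_pi_mul_kernelCoeff_mid_pos m B).ne']

theorem kernelMass_add_adjacent (m B : ℕ) (r s t : ℝ) :
    kernelMass m B r s + kernelMass m B s t = kernelMass m B r t := by
  rw [kernelMass, kernelMass, ← add_div, intervalIntegral.integral_add_adjacent_intervals
    (intervalIntegrable_kernel m B r s) (intervalIntegrable_kernel m B s t), kernelMass]

theorem kernelMass_add_two_pi (m B : ℕ) (s t : ℝ) :
    kernelMass m B (s + 2 * Real.pi) (t + 2 * Real.pi) = kernelMass m B s t := by
  rw [kernelMass, ← intervalIntegral.integral_comp_add_right (kernel m B) (2 * Real.pi)]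
  simp only [kernel_add_two_pi, kernelMass]

theorem kernelMass_nonneg (m B : ℕ) (hst : s ≤ t) : 0 ≤ kernelMass m B s t :=
  div_nonneg (intervalIntegral.integral_nonneg hst fun _ _ => kernel_nonneg _ _ _)
    (two_pi_mul_kernelCoeff_mid_pos m B).le

theorem kernelMass_le_one (m B : ℕ) (ht : t ≤ s + 2 * Real.pi) :
    kernelMass m B s t ≤ 1 := by
  rw [← kernelMass_period m B s, ← kernelMass_add_adjacent m B s t (s + 2 * Real.pi)]
  exact le_add_of_nonneg_right (kernelMass_nonneg m B ht)

theorem kernelMass_tail_le (m B : ℕ) (hw : 0 < w) (hs : w ≤ s) (hst : s ≤ t)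
    (ht : t ≤ 2 * Real.pi - w) :
    kernelMass (m + 1) B s t ≤ 2 * (m + 1) * (Real.pi / w / (B + 1)) ^ (2 * m) := by
  have hpos := kernelCoeff_mid_pos (m + 1) B
  have hcoeff : ((B : ℝ) + 1) ^ (2 * m + 1)
      ≤ 2 * (m + 1) * kernelCoeff (m + 1) B ((m + 1) * B) := by
    refine le_of_mul_le_mul_right ?_ (by positivity : (0 : ℝ) < B + 1)
    calc ((B : ℝ) + 1) ^ (2 * m + 1) * (B + 1) = (B + 1) ^ (2 * (m + 1)) := by ring
      _ ≤ (2 * ((m + 1) * B : ℕ) + 1) * kernelCoeff (m + 1) B ((m + 1) * B) :=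
          kernelCoeff_mid_ge (m + 1) B
      _ ≤ 2 * (m + 1) * (B + 1) * kernelCoeff (m + 1) B ((m + 1) * B) := by
          gcongr
          push_cast
          linarith [m.cast_nonneg (α := ℝ)]
      _ = 2 * (m + 1) * kernelCoeff (m + 1) B ((m + 1) * B) * (B + 1) := by ring
  rw [kernelMass, div_le_iff₀ (two_pi_mul_kernelCoeff_mid_pos _ _)]
  calc ∫ x in s..t, kernel (m + 1) B x
      ≤ (Real.pi / w) ^ (2 * m) * (2 * Real.pi * (B + 1)) :=
        integral_kernel_tail_le m B hw hs hst ht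
    _ = (Real.pi / w / (B + 1)) ^ (2 * m) * (2 * Real.pi) * (B + 1) ^ (2 * m + 1) := by
        rw [div_pow _ ((B : ℝ) + 1), pow_succ]
        field_simp
    _ ≤ (Real.pi / w / (B + 1)) ^ (2 * m) * (2 * Real.pi)
        * (2 * (m + 1) * kernelCoeff (m + 1) B ((m + 1) * B)) := by gcongr
    _ = 2 * (m + 1) * (Real.pi / w / (B + 1)) ^ (2 * m)
        * (2 * Real.pi * kernelCoeff (m + 1) B ((m + 1) * B)) := by ring

/-- The power of the Fejér kernel that makes the error of the step filter at most `q`. -/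
def filterPower (q : ℝ) : ℕ := ⌈Real.log (2 / q)⌉₊ + 1

/-- The degree of the Fejér kernel that makes the transition width of the step filter at
most `w`. -/
def filterBase (w : ℝ) : ℕ := ⌈4 * Real.pi / w⌉₊

theorem two_mul_succ_div_sixteen_pow_le {k : ℕ} (hq : 0 < q) (hk : Real.log (2 / q) ≤ k) :
    2 * ((k : ℝ) + 1) / 16 ^ k ≤ q := by
  have hexp : 2 / q ≤ 8 ^ k := by
    calc 2 / q ≤ Real.exp 1 ^ k := by
          rwa [Real.exp_one_pow, ← Real.log_le_iff_le_exp (by positivity)]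
      _ ≤ 8 ^ k := by
          gcongr
          linarith [Real.exp_one_lt_d9]
  have hlin : (k : ℝ) + 1 ≤ 2 ^ k := by exact_mod_cast (Nat.lt_two_pow_self : k < 2 ^ k)
  rw [div_le_iff₀ (by positivity), show (16 : ℝ) ^ k = 8 ^ k * 2 ^ k by rw [← mul_pow]; norm_num,
    ← mul_assoc]
  exact mul_le_mul ((div_le_iff₀' hq).1 hexp) hlin (by positivity) (by positivity)

theorem kernelMass_filter_tail_le (hw : 0 < w) (hq : 0 < q) (hs : w ≤ s) (hst : s ≤ t)
    (ht : t ≤ 2 * Real.pi - w) : kernelMass (filterPower q) (filterBase w) s t ≤ q := by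
  set k := ⌈Real.log (2 / q)⌉₊
  have hratio : Real.pi / w / (filterBase w + 1) ≤ 1 / 4 := by
    rw [div_le_iff₀ (by positivity)]
    have hceil : 4 * Real.pi / w ≤ filterBase w := Nat.le_ceil _
    rw [mul_div_assoc] at hceil
    linarith
  calc kernelMass (k + 1) (filterBase w) s t
      ≤ 2 * (k + 1) * (Real.pi / w / (filterBase w + 1)) ^ (2 * k) :=
        kernelMass_tail_le k _ hw hs hst ht
    _ ≤ 2 * (k + 1) * (1 / 4) ^ (2 * k) := by gcongr
    _ = 2 * (k + 1) / 16 ^ k := by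
        rw [pow_mul, show ((1 : ℝ) / 4) ^ 2 = 1 / 16 by norm_num, one_div_pow, mul_one_div]
    _ ≤ q := two_mul_succ_div_sixteen_pow_le hq (Nat.le_ceil _)

end KernelMass

section StepFilter

variable {m B : ℕ} {b w q x : ℝ}

/-- The coefficients of the convolution of the normalized kernel with the indicator function
of `[-π, b]`. -/
def stepFilter (m B : ℕ) (b : ℝ) (l : Fin (2 * (m * B) + 1)) : ℂ :=
  (kernelCoeff m B l / (2 * Real.pi * kernelCoeff m B (m * B)) : ℝ) *
    ∫ y in (-Real.pi)..b, Complex.exp (Complex.I * (shift (m * B) l : ℂ) * (y : ℂ))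

theorem trigPoly_stepFilter (m B : ℕ) (b x : ℝ) :
    trigPoly (stepFilter m B b) x = (kernelMass m B (-Real.pi - x) (b - x) : ℂ) := by
  have hexpand : ((∫ y in (-Real.pi)..b, kernel m B (y - x) : ℝ) : ℂ)
      = ∑ l : Fin (2 * (m * B) + 1), (kernelCoeff m B l : ℂ) *
        (Complex.exp (-(Complex.I * (shift (m * B) l : ℂ) * (x : ℂ))) *
        ∫ y in (-Real.pi)..b, Complex.exp (Complex.I * (shift (m * B) l : ℂ) * (y : ℂ))) := by
    rw [← intervalIntegral.integral_ofReal]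
    simp only [kernel_eq_sum]
    rw [intervalIntegral.integral_finsetSum
      (fun l _ => (Continuous.intervalIntegrable (by fun_prop) _ _))]
    refine Finset.sum_congr rfl fun l _ => ?_
    rw [intervalIntegral.integral_const_mul, ← intervalIntegral.integral_const_mul (Complex.exp _)]
    congr 1
    refine intervalIntegral.integral_congr fun y _ => ?_
    rw [← Complex.exp_add]
    congr 1
    push_cast
    ring
  rw [kernelMass, ← intervalIntegral.integral_comp_sub_right (fun y => kernel m B y) x,
    Complex.ofReal_div, hexpand, trigPoly, Finset.sum_div]
  refine Finset.sum_congr rfl fun l _ => ?_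
  rw [stepFilter]
  push_cast
  ring

theorem exists_trigPoly_stepFilter_eq (hb : b ∈ Set.Icc (-Real.pi) Real.pi) (x : ℝ) :
    ∃ y ∈ Set.Icc (0 : ℝ) 1, trigPoly (stepFilter m B b) x = (y : ℂ) :=
  ⟨_, ⟨kernelMass_nonneg m B (by linarith [hb.1]), kernelMass_le_one m B (by linarith [hb.2])⟩,
    trigPoly_stepFilter m B b x⟩

theorem norm_trigPoly_stepFilter_sub_one_le (hw : 0 < w) (hq : 0 < q) (hb : b ≤ Real.pi)
    (hx : -Real.pi + w ≤ x) (hx' : x ≤ b - w) :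
    ‖trigPoly (stepFilter (filterPower q) (filterBase w) b) x - 1‖ ≤ q := by
  have hle : b - x ≤ -Real.pi - x + 2 * Real.pi := by linarith
  have hsplit : kernelMass (filterPower q) (filterBase w) (-Real.pi - x) (b - x) - 1
      = -kernelMass (filterPower q) (filterBase w) (b - x) (-Real.pi - x + 2 * Real.pi) := by
    rw [← kernelMass_period (filterPower q) (filterBase w) (-Real.pi - x),
      ← kernelMass_add_adjacent _ _ _ (b - x) (-Real.pi - x + 2 * Real.pi), sub_add_cancel_left]
  rw [trigPoly_stepFilter, ← Complex.ofReal_one, ← Complex.ofReal_sub, hsplit, Complex.norm_real,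
    norm_neg, Real.norm_of_nonneg (kernelMass_nonneg _ _ hle)]
  exact kernelMass_filter_tail_le hw hq (by linarith) hle (by linarith)

theorem norm_trigPoly_stepFilter_le (hw : 0 < w) (hq : 0 < q) (hb : -Real.pi ≤ b)
    (hx : b + w ≤ x) (hx' : x ≤ Real.pi - w) :
    ‖trigPoly (stepFilter (filterPower q) (filterBase w) b) x‖ ≤ q := by
  rw [trigPoly_stepFilter, Complex.norm_real,
    Real.norm_of_nonneg (kernelMass_nonneg _ _ (by linarith)), ← kernelMass_add_two_pi]
  exact kernelMass_filter_tail_le hw hq (by linarith) (by linarith) (by linarith)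

theorem norm_integral_exp_I_int_mul_le (n : ℤ) (hb : b ∈ Set.Icc (-Real.pi) Real.pi) :
    ‖∫ y in (-Real.pi)..b, Complex.exp (Complex.I * (n : ℂ) * (y : ℂ))‖
      ≤ 2 * Real.pi / (1 + |(n : ℝ)|) := by
  rcases eq_or_ne n 0 with rfl | hn
  · have hlen : |b + Real.pi| ≤ 2 * Real.pi := abs_le.2 ⟨by linarith [hb.1, Real.pi_pos],
      by linarith [hb.2]⟩
    simpa [← Complex.ofReal_add] using hlen
  · have hone : (1 : ℝ) ≤ |(n : ℝ)| := by exact_mod_cast Int.one_le_abs hn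
    refine (norm_integral_exp_I_int_le hn _ _).trans ?_
    rw [div_le_div_iff₀ (by positivity) (by positivity)]
    nlinarith [Real.pi_gt_three]

theorem norm_stepFilter_le (hb : b ∈ Set.Icc (-Real.pi) Real.pi) (l : Fin (2 * (m * B) + 1)) :
    ‖stepFilter m B b l‖ ≤ 1 / (1 + |(shift (m * B) l : ℝ)|) := by
  have hpos := two_pi_mul_kernelCoeff_mid_pos m B
  have hcoeff : ‖((kernelCoeff m B l / (2 * Real.pi * kernelCoeff m B (m * B)) : ℝ) : ℂ)‖
      ≤ 1 / (2 * Real.pi) := by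
    rw [Complex.norm_real, Real.norm_eq_abs, abs_div, abs_of_pos hpos,
      div_le_div_iff₀ hpos Real.two_pi_pos, one_mul, mul_comm]
    exact mul_le_mul_of_nonneg_left (abs_kernelCoeff_le m B l) Real.two_pi_pos.le
  rw [stepFilter, norm_mul]
  refine (mul_le_mul hcoeff (norm_integral_exp_I_int_mul_le _ hb) (norm_nonneg _)
    (by positivity)).trans_eq ?_
  field_simp

theorem filterMass_stepFilter_pos (hb : -Real.pi < b) : 0 < filterMass (stepFilter m B b) := by
  refine Finset.sum_pos' (fun _ _ => norm_nonneg _) ⟨midIndex (m * B), Finset.mem_univ _, ?_⟩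
  rw [norm_pos_iff, stepFilter, shift_midIndex]
  refine mul_ne_zero (Complex.ofReal_ne_zero.2
    (div_pos (kernelCoeff_mid_pos m B) (two_pi_mul_kernelCoeff_mid_pos m B)).ne') ?_
  simpa [← Complex.ofReal_add] using (by linarith : b + Real.pi ≠ 0)

/-- The sum of `1 / (1 + |l|)` over `-d ≤ l ≤ d`, an upper bound for the mass of a step filter of
degree `d`. -/
def harmonicMass (d : ℕ) : ℝ := ∑ l : Fin (2 * d + 1), 1 / (1 + |(shift d l : ℝ)|)

theorem filterMass_stepFilter_le (hb : b ∈ Set.Icc (-Real.pi) Real.pi) :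
    filterMass (stepFilter m B b) ≤ harmonicMass (m * B) :=
  Finset.sum_le_sum fun l _ => norm_stepFilter_le hb l

theorem harmonicMass_pos (d : ℕ) : 0 < harmonicMass d :=
  Finset.sum_pos (fun _ _ => by positivity) Finset.univ_nonempty

theorem harmonicMass_eq (d : ℕ) :
    harmonicMass d = (harmonic (d + 1) : ℝ) + harmonic (d + 1) - 1 := by
  have hneg : ∑ k ∈ Finset.range d, 1 / (1 + |((k : ℤ) - d : ℝ)|) = harmonic (d + 1) - 1 := by
    rw [← Finset.sum_range_reflect, harmonic, Finset.sum_range_succ']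
    push_cast
    rw [inv_one, add_sub_cancel_right]
    refine Finset.sum_congr rfl fun k hk => ?_
    have hcast : ((d - 1 - k : ℕ) : ℝ) = d - 1 - k := by
      rw [Nat.sub_sub, Nat.cast_sub (by have := Finset.mem_range.1 hk; omega)]
      push_cast
      ring
    rw [hcast, show (d - 1 - k - d : ℝ) = -(k + 1) by ring, abs_neg, abs_of_nonneg (by positivity),
      one_div, add_comm]
  have hnonneg : ∑ k ∈ Finset.range (d + 1), 1 / (1 + |(((d + k : ℕ) : ℤ) - d : ℝ)|)
      = harmonic (d + 1) := by
    rw [harmonic]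
    push_cast
    refine Finset.sum_congr rfl fun k _ => ?_
    rw [add_sub_cancel_left, abs_of_nonneg k.cast_nonneg, one_div, add_comm]
  have hrange : harmonicMass d
      = ∑ k ∈ Finset.range (d + (d + 1)), 1 / (1 + |((k : ℤ) - d : ℝ)|) := by
    rw [show d + (d + 1) = 2 * d + 1 by ring,
      ← Fin.sum_univ_eq_sum_range (fun k : ℕ => 1 / (1 + |((k : ℤ) - d : ℝ)|))]
    simp [harmonicMass, shift]
  rw [hrange, Finset.sum_range_add, hneg, hnonneg]
  ring

theorem harmonicMass_le (d : ℕ) : harmonicMass d ≤ 2 * (1 + Real.log (d + 1)) := by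
  have h := harmonic_le_one_add_log (d + 1)
  push_cast at h
  rw [harmonicMass_eq]
  linarith

end StepFilter

section Loss

variable {J N : ℕ} {Z : Fin N → ℂ} {r : ℂ} {τ θ : ℝ}

/-- The correlation `(1/N) ∑ₙ Zₙ exp(i θ n τ)` of the data with the frequency `θ`. For fixed `θ`
it is the minimizer over `r` of the loss function. -/
def corr (Z : Fin N → ℂ) (τ θ : ℝ) : ℂ :=
  (1 / (N : ℂ)) * ∑ n : Fin N,
    Z n * Complex.exp (Complex.I * (θ : ℂ) * ((n : ℕ) : ℂ) * (τ : ℂ))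

theorem mul_corr [NeZero N] (Z : Fin N → ℂ) (τ θ : ℝ) :
    (N : ℂ) * corr Z τ θ =
      ∑ n : Fin N, Z n * Complex.exp (Complex.I * (θ : ℂ) * ((n : ℕ) : ℂ) * (τ : ℂ)) := by
  rw [corr, ← mul_assoc, mul_one_div_cancel (NeZero.ne (N : ℂ)), one_mul]

theorem norm_sub_sq_complex (a r : ℂ) :
    ‖a - r‖ ^ 2 = ‖a‖ ^ 2 - 2 * (a * (starRingEnd ℂ) r).re + ‖r‖ ^ 2 := by
  simp only [Complex.sq_norm, Complex.normSq_sub]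
  ring

theorem loss_eq [NeZero N] (Z : Fin N → ℂ) (τ : ℝ) (r : ℂ) (θ : ℝ) :
    loss Z τ r θ
      = (1 / (N : ℝ)) * ∑ n, ‖Z n‖ ^ 2 - ‖corr Z τ θ‖ ^ 2 + ‖r - corr Z τ θ‖ ^ 2 := by
  let u : Fin N → ℂ := fun n => Complex.exp (Complex.I * (θ : ℂ) * ((n : ℕ) : ℂ) * (τ : ℂ))
  have hu : ∀ n, ‖u n‖ = 1 := fun n => by simp [u, Complex.norm_exp]
  have hterm : ∀ n : Fin N,
      ‖Z n - r * Complex.exp (-(Complex.I * (θ : ℂ) * ((n : ℕ) : ℂ) * (τ : ℂ)))‖ ^ 2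
        = ‖Z n‖ ^ 2 - 2 * (Z n * u n * (starRingEnd ℂ) r).re + ‖r‖ ^ 2 := fun n => by
    rw [← mul_one ‖Z n - _‖, ← hu n, ← norm_mul, sub_mul, mul_assoc r, ← Complex.exp_add,
      neg_add_cancel, Complex.exp_zero, mul_one, norm_sub_sq_complex, norm_mul, hu, mul_one]
  have hcross : ∑ n : Fin N, (Z n * u n * (starRingEnd ℂ) r).re
      = N * (corr Z τ θ * (starRingEnd ℂ) r).re := by
    rw [← Complex.re_sum, ← Finset.sum_mul, ← mul_corr, mul_assoc, ← Complex.ofReal_natCast,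
      Complex.re_ofReal_mul]
  rw [loss, Finset.sum_congr rfl fun n _ => hterm n, Finset.sum_add_distrib,
    Finset.sum_sub_distrib, ← Finset.mul_sum, hcross, norm_sub_rev r,
    norm_sub_sq_complex (corr Z τ θ) r]
  have hN : (N : ℝ) ≠ 0 := NeZero.ne _
  simp only [Finset.sum_const, Finset.card_univ, Fintype.card_fin, nsmul_eq_mul]
  field_simp
  ring

theorem norm_corr_le_of_loss_le [NeZero N] {θ' : ℝ}
    (h : loss Z τ r θ ≤ loss Z τ (corr Z τ θ') θ') : ‖corr Z τ θ'‖ ≤ ‖corr Z τ θ‖ := by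
  rw [loss_eq, loss_eq, sub_self, norm_zero] at h
  refine (pow_le_pow_iff_left₀ (norm_nonneg _) (norm_nonneg _) two_ne_zero).1 ?_
  linarith [sq_nonneg ‖r - corr Z τ θ‖]

theorem exists_loss_minimizer [NeZero N] (Z : Fin N → ℂ) (τ : ℝ) {s : Set ℝ} (hs : IsCompact s)
    (hne : s.Nonempty) :
    ∃ θ ∈ s, ∀ r' : ℂ, ∀ θ' ∈ s, loss Z τ (corr Z τ θ) θ ≤ loss Z τ r' θ' := by
  have hcont : Continuous fun θ => ‖corr Z τ θ‖ := by
    unfold corr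
    fun_prop
  obtain ⟨θ, hθ, hmax⟩ := hs.exists_isMaxOn hne hcont.continuousOn
  refine ⟨θ, hθ, fun r' θ' hθ' => ?_⟩
  have hle : ‖corr Z τ θ'‖ ^ 2 ≤ ‖corr Z τ θ‖ ^ 2 :=
    pow_le_pow_left₀ (norm_nonneg _) (hmax hθ') 2
  rw [loss_eq, loss_eq, sub_self, norm_zero]
  linarith [sq_nonneg ‖r' - corr Z τ θ'‖]

theorem exists_isRun [NeZero N] {τ : ℕ → ℝ} (hτ : ∀ j, 0 < τ j) (Z : Fin J → Fin N → ℂ) :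
    ∃ r θ, IsRun τ Z r θ := by
  let Z' : ℕ → Fin N → ℂ := fun j => if h : j < J then Z ⟨j, h⟩ else 0
  have hwidth : ∀ (j : ℕ) (t : ℝ), t - Real.pi / (2 * τ j) ≤ t + Real.pi / (2 * τ j) :=
    fun j t => by linarith [div_pos Real.pi_pos (mul_pos two_pos (hτ j))]
  obtain ⟨θ₀, hθ₀, hmin₀⟩ := exists_loss_minimizer (Z' 0) (τ 0)
    isCompact_Icc (Set.nonempty_Icc.2 (neg_le_self Real.pi_nonneg))
  choose next hnext hmin using fun j t => exists_loss_minimizer (Z' (j + 1)) (τ (j + 1))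
    isCompact_Icc (Set.nonempty_Icc.2 (hwidth j t))
  let θ : ℕ → ℝ := fun j => Nat.rec θ₀ next j
  refine ⟨fun j => corr (Z' j) (τ j) (θ j), θ, fun ⟨j, hj⟩ => ?_⟩
  have hZ : Z ⟨j, hj⟩ = Z' j := by simp [Z', hj]
  rw [hZ]
  cases j with
  | zero => exact ⟨hθ₀, hmin₀⟩
  | succ j => exact ⟨hnext j (θ j), hmin j (θ j)⟩

end Loss

section CenteredPhases

variable {N : ℕ} {y : ℝ}

/-- The phases `exp(i n y)`, `0 ≤ n < N`, rotated by a common factor that makes them symmetric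
about the real axis. -/
def centeredPhase (N : ℕ) (y : ℝ) (n : ℕ) : ℂ :=
  Complex.exp (Complex.I * ((((n : ℝ) - ((N : ℝ) - 1) / 2) * y : ℝ) : ℂ))

/-- The sum of the centered phases, which is real. -/
def centeredCosSum (N : ℕ) (y : ℝ) : ℝ :=
  ∑ n ∈ Finset.range N, Real.cos (((n : ℝ) - ((N : ℝ) - 1) / 2) * y)

theorem centeredPhase_eq (N : ℕ) (y : ℝ) (n : ℕ) :
    centeredPhase N y n = centeredPhase N y 0 * Complex.exp (Complex.I * y) ^ n := by
  rw [centeredPhase, centeredPhase, ← Complex.exp_nat_mul, ← Complex.exp_add]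
  push_cast
  ring_nf

theorem norm_centeredPhase (N : ℕ) (y : ℝ) (n : ℕ) : ‖centeredPhase N y n‖ = 1 := by
  rw [centeredPhase, mul_comm, Complex.norm_exp_ofReal_mul_I]

theorem norm_centeredPhase_succ_sub_le (N : ℕ) (y : ℝ) (n : ℕ) :
    ‖centeredPhase N y (n + 1) - centeredPhase N y n‖ ≤ |y| := by
  have hfactor : centeredPhase N y (n + 1) - centeredPhase N y n
      = centeredPhase N y n * (Complex.exp (Complex.I * y) - 1) := by
    rw [centeredPhase_eq N y (n + 1), centeredPhase_eq N y n]
    ring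
  rw [hfactor, norm_mul, norm_centeredPhase, one_mul]
  exact Real.norm_exp_I_mul_ofReal_sub_one_le

theorem sum_sin_centered (N : ℕ) (y : ℝ) :
    ∑ n ∈ Finset.range N, Real.sin (((n : ℝ) - ((N : ℝ) - 1) / 2) * y) = 0 := by
  have hodd : ∀ n ∈ Finset.range N, Real.sin ((((N - 1 - n : ℕ) : ℝ) - ((N : ℝ) - 1) / 2) * y)
      = -Real.sin (((n : ℝ) - ((N : ℝ) - 1) / 2) * y) := fun n hn => by
    have hn := Finset.mem_range.1 hn
    have hcast : ((N - 1 - n : ℕ) : ℝ) = (N : ℝ) - 1 - n := by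
      rw [Nat.cast_sub (by omega), Nat.cast_sub (by omega), Nat.cast_one]
    rw [← Real.sin_neg, hcast]
    ring_nf
  have hreflect := Finset.sum_range_reflect
    (fun n : ℕ => Real.sin (((n : ℝ) - ((N : ℝ) - 1) / 2) * y)) N
  rw [Finset.sum_congr rfl hodd, Finset.sum_neg_distrib] at hreflect
  linarith

theorem sum_centeredPhase (N : ℕ) (y : ℝ) :
    ∑ n ∈ Finset.range N, centeredPhase N y n = (centeredCosSum N y : ℂ) := by
  apply Complex.ext
  · simp only [centeredPhase, centeredCosSum, mul_comm Complex.I, Complex.re_sum,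
      Complex.exp_ofReal_mul_I_re, Complex.ofReal_re]
  · simp only [centeredPhase, mul_comm Complex.I, Complex.im_sum, Complex.exp_ofReal_mul_I_im,
      Complex.ofReal_im, sum_sin_centered]

theorem norm_mul_dirichletSum_add (N : ℕ) (c : ℂ) (a : ℕ → ℂ) (y : ℝ) :
    ‖c * dirichletSum N y + ∑ n ∈ Finset.range N, a n * Complex.exp (Complex.I * y) ^ n‖
      = ‖c * centeredCosSum N y + ∑ n ∈ Finset.range N, a n * centeredPhase N y n‖ := by
  rw [← one_mul ‖c * dirichletSum N y + _‖, ← norm_centeredPhase N y 0, ← norm_mul,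
    ← sum_centeredPhase, mul_add, dirichletSum, Finset.mul_sum, Finset.mul_sum, Finset.mul_sum,
    Finset.mul_sum]
  congr 2 <;>
  · refine Finset.sum_congr rfl fun n _ => ?_
    rw [centeredPhase_eq N y n, mul_left_comm]

theorem centeredCosSum_le (N : ℕ) (y : ℝ) : centeredCosSum N y ≤ N :=
  (Finset.sum_le_sum fun _ _ => Real.cos_le_one _).trans_eq (by simp)

theorem centeredCosSum_nonneg (hy : N * |y| ≤ Real.pi) : 0 ≤ centeredCosSum N y := by
  refine Finset.sum_nonneg fun n hn => ?_
  have hn : (n : ℝ) + 1 ≤ N := by exact_mod_cast Finset.mem_range.1 hn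
  have habs : |((n : ℝ) - ((N : ℝ) - 1) / 2) * y| ≤ Real.pi / 2 := by
    have hle : |(n : ℝ) - ((N : ℝ) - 1) / 2| ≤ N / 2 :=
      abs_le.2 ⟨by linarith [n.cast_nonneg (α := ℝ)], by linarith⟩
    rw [abs_mul]
    linarith [mul_le_mul_of_nonneg_right hle (abs_nonneg y)]
  exact Real.cos_nonneg_of_mem_Icc (abs_le.1 habs)

theorem centeredCosSum_two_mul (h : ℕ) (y : ℝ) :
    centeredCosSum (2 * h) y = 2 * Real.cos (h * y / 2) * centeredCosSum h y := by
  rw [centeredCosSum, centeredCosSum, two_mul h, Finset.sum_range_add, ← Finset.sum_add_distrib,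
    Finset.mul_sum]
  refine Finset.sum_congr rfl fun n _ => ?_
  have hleft : ((n : ℝ) - (((h + h : ℕ) : ℝ) - 1) / 2) * y
      = ((n : ℝ) - ((h : ℝ) - 1) / 2) * y - h * y / 2 := by
    push_cast
    ring
  have hright : (((h + n : ℕ) : ℝ) - (((h + h : ℕ) : ℝ) - 1) / 2) * y
      = ((n : ℝ) - ((h : ℝ) - 1) / 2) * y + h * y / 2 := by
    push_cast
    ring
  rw [hleft, hright, Real.cos_add, Real.cos_sub]
  ring

theorem centeredCosSum_mem_Icc (hev : Even N) (hy : N * |y| ≤ 2 * Real.pi) :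
    centeredCosSum N y ∈ Set.Icc 0 (N * (1 - (N * |y|) ^ 2 / (8 * Real.pi ^ 2))) := by
  obtain ⟨h, rfl⟩ := hev.two_dvd
  push_cast at hy ⊢
  have habs : |(h : ℝ) * y| ≤ Real.pi := by
    rw [abs_mul, Nat.abs_cast]
    linarith
  have hcos_nonneg : 0 ≤ Real.cos (h * y / 2) :=
    Real.cos_nonneg_of_mem_Icc ⟨by linarith [(abs_le.1 habs).1], by linarith [(abs_le.1 habs).2]⟩
  have hcos_le : Real.cos (h * y / 2) ≤ 1 - (2 * h * |y|) ^ 2 / (8 * Real.pi ^ 2) := by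
    have habs_half : |h * y / 2| ≤ Real.pi := by
      rw [abs_div, abs_two]
      linarith [Real.pi_pos]
    refine (Real.cos_le_one_sub_mul_cos_sq habs_half).trans_eq ?_
    rw [mul_pow, sq_abs]
    field_simp
    ring
  have hhalf := centeredCosSum_nonneg (N := h) (y := y) (by linarith)
  rw [centeredCosSum_two_mul]
  refine ⟨by positivity, ?_⟩
  calc 2 * Real.cos (h * y / 2) * centeredCosSum h y
      ≤ 2 * (1 - (2 * h * |y|) ^ 2 / (8 * Real.pi ^ 2)) * h :=
        mul_le_mul (by linarith) (centeredCosSum_le h y) hhalf (by linarith)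
    _ = 2 * h * (1 - (2 * h * |y|) ^ 2 / (8 * Real.pi ^ 2)) := by ring

theorem norm_sum_mul_centeredPhase_sub_le (hN : 0 < N) {a : ℕ → ℂ} {S : ℝ}
    (hS : ∀ k ≤ N, ‖∑ n ∈ Finset.range k, a n‖ ≤ S) (y : ℝ) :
    ‖∑ n ∈ Finset.range N, a n * centeredPhase N y n - ∑ n ∈ Finset.range N, a n‖
      ≤ 3 / 2 * (N * |y|) * S := by
  have hS0 : 0 ≤ S := (norm_nonneg _).trans (hS 0 (Nat.zero_le _))
  have hdiff : ∑ n ∈ Finset.range N, a n * centeredPhase N y n - ∑ n ∈ Finset.range N, a n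
      = ∑ n ∈ Finset.range N, (centeredPhase N y n - 1) • a n := by
    rw [← Finset.sum_sub_distrib]
    refine Finset.sum_congr rfl fun n _ => ?_
    rw [smul_eq_mul]
    ring
  have hlast : ‖centeredPhase N y (N - 1) - 1‖ ≤ N * |y| / 2 := by
    have hN1 : (1 : ℝ) ≤ N := by exact_mod_cast hN
    refine Real.norm_exp_I_mul_ofReal_sub_one_le.trans ?_
    rw [Real.norm_eq_abs, abs_mul, Nat.cast_pred hN,
      show (N : ℝ) - 1 - ((N : ℝ) - 1) / 2 = ((N : ℝ) - 1) / 2 by ring,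
      abs_of_nonneg (by linarith)]
    linarith [abs_nonneg y]
  rw [hdiff, Finset.sum_range_by_parts]
  calc _ ≤ N * |y| / 2 * S + ((N - 1 : ℕ) : ℝ) * (|y| * S) := by
        refine (norm_sub_le _ _).trans (add_le_add ?_ ?_)
        · rw [norm_smul]
          gcongr
          exact hS N le_rfl
        · refine (norm_sum_le_of_le (n := fun _ => |y| * S) _ fun n hn => ?_).trans_eq (by simp)
          rw [norm_smul, sub_sub_sub_cancel_right]
          gcongr
          · exact norm_centeredPhase_succ_sub_le N y n
          · exact hS _ (by have := Finset.mem_range.1 hn; omega)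
    _ ≤ N * |y| / 2 * S + N * (|y| * S) := by
        gcongr
        omega
    _ = 3 / 2 * (N * |y|) * S := by ring

end CenteredPhases

section Localization

variable {N : ℕ} {p δ y : ℝ} {a : ℕ → ℂ}

theorem sub_div_three_le_norm_sub {A B : ℝ} {e : ℂ} (hA : 0 < A) (hB : 0 ≤ B) (hBA : B ≤ A)
    (he : ‖e‖ ≤ A / 20) : (A - B) / 3 ≤ ‖(A : ℂ) + e‖ - ‖(B : ℂ) + e‖ := by
  have hsq : (‖(A : ℂ) + e‖ - ‖(B : ℂ) + e‖) * (‖(A : ℂ) + e‖ + ‖(B : ℂ) + e‖)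
      = (A - B) * (A + B + 2 * e.re) := by
    rw [mul_comm, ← sq_sub_sq]
    simp only [Complex.sq_norm, Complex.normSq_apply, Complex.add_re, Complex.add_im,
      Complex.ofReal_re, Complex.ofReal_im]
    ring
  have hre := (abs_le.1 (Complex.abs_re_le_norm e)).1
  have hnormA : ‖(A : ℂ)‖ = A := by rw [Complex.norm_real, Real.norm_of_nonneg hA.le]
  have hnormB : ‖(B : ℂ)‖ = B := by rw [Complex.norm_real, Real.norm_of_nonneg hB]
  have hupperA := norm_add_le (A : ℂ) e
  have hupperB := norm_add_le (B : ℂ) e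
  have hlowerA := norm_sub_le_norm_add (A : ℂ) e
  have hpos : 0 < ‖(A : ℂ) + e‖ + ‖(B : ℂ) + e‖ := by linarith [norm_nonneg ((B : ℂ) + e)]
  refine le_of_mul_le_mul_right ?_ hpos
  calc (A - B) / 3 * (‖(A : ℂ) + e‖ + ‖(B : ℂ) + e‖)
      ≤ (A - B) / 3 * (3 * (A + B + 2 * e.re)) :=
        mul_le_mul_of_nonneg_left (by linarith) (by linarith)
    _ = (‖(A : ℂ) + e‖ - ‖(B : ℂ) + e‖) * (‖(A : ℂ) + e‖ + ‖(B : ℂ) + e‖) := by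
        rw [hsq]
        ring

theorem norm_dirichletSum_le_half (hN : 4 ≤ N) (hy : 2 * Real.pi < N * |y|)
    (hy' : |y| ≤ Real.pi + 1) : ‖dirichletSum N y‖ ≤ N / 2 := by
  have hpi := Real.pi_gt_three
  have hpi' := Real.pi_le_four
  have hN' : (4 : ℝ) ≤ N := by exact_mod_cast hN
  have hy0 : 0 < |y| := by
    by_contra! h
    linarith [mul_nonpos_of_nonneg_of_nonpos N.cast_nonneg h]
  have habs : ‖dirichletSum N y‖ = ‖dirichletSum N |y|‖ := by
    rcases abs_choice y with h | h <;> simp only [h, norm_dirichletSum_neg]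
  rw [habs]
  rcases le_total |y| Real.pi with h | h
  · refine (norm_dirichletSum_le N hy0 le_rfl (by linarith)).trans ?_
    rw [div_le_iff₀ hy0]
    linarith
  · refine (norm_dirichletSum_le N (w := 2) two_pos (by linarith) (by linarith)).trans ?_
    linarith

theorem norm_sum_mul_exp_pow_le {c : ℝ} (ha : ∀ n < N, ‖a n‖ ≤ c) (y : ℝ) :
    ‖∑ n ∈ Finset.range N, a n * Complex.exp (Complex.I * y) ^ n‖ ≤ N * c := by
  refine (norm_sum_le_of_le _ fun n hn => ?_).trans_eq
    (by rw [Finset.sum_const, Finset.card_range, nsmul_eq_mul])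
  rw [norm_mul, norm_pow, mul_comm Complex.I, Complex.norm_exp_ofReal_mul_I, one_pow, mul_one]
  exact ha n (Finset.mem_range.1 hn)

theorem norm_correlation_lt_of_two_pi_lt (hN : 4 ≤ N) (hp : 0 < p) (hy : |y| ≤ Real.pi + 1)
    (hy' : 2 * Real.pi < N * |y|) (ha : ∀ n < N, ‖a n‖ ≤ p / 20) :
    ‖(p : ℂ) * dirichletSum N y + ∑ n ∈ Finset.range N, a n * Complex.exp (Complex.I * y) ^ n‖
      < ‖(N : ℂ) * p + ∑ n ∈ Finset.range N, a n‖ := by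
  have hNp : 0 < N * p := mul_pos (by exact_mod_cast (by omega : 0 < N)) hp
  have hnormp : ‖(p : ℂ)‖ = p := by rw [Complex.norm_real, Real.norm_of_nonneg hp.le]
  have hsum : ‖∑ n ∈ Finset.range N, a n‖ ≤ N * (p / 20) := by
    simpa using norm_sum_mul_exp_pow_le ha 0
  have hmain := mul_le_mul_of_nonneg_left (norm_dirichletSum_le_half hN hy' hy) hp.le
  have hlower := norm_sub_le_norm_add ((N : ℂ) * p) (∑ n ∈ Finset.range N, a n)
  rw [norm_mul, Complex.norm_natCast, hnormp] at hlower
  refine (norm_add_le _ _).trans_lt ?_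
  rw [norm_mul, hnormp]
  linarith [norm_sum_mul_exp_pow_le ha y]

theorem mul_abs_lt_of_le_norm_correlation_of_le_two_pi (hN : 0 < N) (hev : Even N) (hp : 0 < p)
    (hδ : 0 < δ) (hy : N * |y| ≤ 2 * Real.pi) (ha : ∀ n < N, ‖a n‖ ≤ p / 20)
    (hS : ∀ k ≤ N, ‖∑ n ∈ Finset.range k, a n‖ ≤ N * (p * δ / 400))
    (hmax : ‖(N : ℂ) * p + ∑ n ∈ Finset.range N, a n‖ ≤ ‖(p : ℂ) * dirichletSum N y
      + ∑ n ∈ Finset.range N, a n * Complex.exp (Complex.I * y) ^ n‖) :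
    N * |y| < δ := by
  have hNp : 0 < N * p := mul_pos (by exact_mod_cast hN) hp
  obtain ⟨hR0, hR⟩ := centeredCosSum_mem_Icc hev hy
  set R := centeredCosSum N y
  set u := (N : ℝ) * |y|
  set E := ∑ n ∈ Finset.range N, a n
  have hE : ‖E‖ ≤ N * p / 20 := by
    simpa [mul_div_assoc] using norm_sum_mul_exp_pow_le ha 0
  have hdrop : N * p * (u ^ 2 / (8 * Real.pi ^ 2)) ≤ N * p - p * R := by
    linarith [mul_le_mul_of_nonneg_left hR hp.le]
  have hgain : (N * p - p * R) / 3 ≤ ‖((N * p : ℝ) : ℂ) + E‖ - ‖((p * R : ℝ) : ℂ) + E‖ :=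
    sub_div_three_le_norm_sub hNp (mul_nonneg hp.le hR0)
      (by linarith [(by positivity : 0 ≤ N * p * (u ^ 2 / (8 * Real.pi ^ 2)))]) hE
  have hnoise : ‖((N * p : ℝ) : ℂ) + E‖
      ≤ ‖((p * R : ℝ) : ℂ) + E‖ + 3 / 2 * u * (N * (p * δ / 400)) := by
    rw [norm_mul_dirichletSum_add] at hmax
    push_cast
    refine hmax.trans ?_
    rw [← add_sub_cancel E (∑ n ∈ Finset.range N, a n * centeredPhase N y n), ← add_assoc]
    exact (norm_add_le _ _).trans
      (add_le_add_right (norm_sum_mul_centeredPhase_sub_le hN hS y) _)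
  have hquad : u ^ 2 / (8 * Real.pi ^ 2) ≤ 9 / 800 * u * δ := by
    refine le_of_mul_le_mul_left ?_ hNp
    linarith
  rw [div_le_iff₀ (by positivity)] at hquad
  have hpi : Real.pi ^ 2 < 10 := by nlinarith [Real.pi_lt_d2, Real.pi_pos]
  by_contra! hle
  have hu : 0 < u := hδ.trans_le hle
  have huδ : 0 < u * δ := mul_pos hu hδ
  have hlt : u ^ 2 < u * δ := by nlinarith
  nlinarith

/-- The noise enters twice: the size of its partial sums limits, by Abel summation, how much it can
gain from the phases, so that the quadratic drop of the signal wins once `δ ≤ N |y|`. -/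
theorem mul_abs_lt_of_le_norm_correlation (hN : 4 ≤ N) (hev : Even N) (hp : 0 < p) (hδ : 0 < δ)
    (hy : |y| ≤ Real.pi + 1) (ha : ∀ n < N, ‖a n‖ ≤ p / 20)
    (hS : ∀ k ≤ N, ‖∑ n ∈ Finset.range k, a n‖ ≤ N * (p * δ / 400))
    (hmax : ‖(N : ℂ) * p + ∑ n ∈ Finset.range N, a n‖ ≤ ‖(p : ℂ) * dirichletSum N y
      + ∑ n ∈ Finset.range N, a n * Complex.exp (Complex.I * y) ^ n‖) :
    N * |y| < δ := by
  rcases le_or_gt (N * |y|) (2 * Real.pi) with hle | hlt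
  · exact mul_abs_lt_of_le_norm_correlation_of_le_two_pi (by omega) hev hp hδ hle ha hS hmax
  · exact absurd hmax (norm_correlation_lt_of_two_pi_lt hN hp hy hlt ha).not_ge

end Localization

section TimeStep

variable {δ ε : ℝ} {N : ℕ}

theorem timeStep_pos [NeZero N] (hδ : 0 < δ) (hε : 0 < ε) (j : ℕ) : 0 < timeStep δ ε N j := by
  have hN : 0 < N := NeZero.pos N
  unfold timeStep
  positivity

theorem timeStep_succ (δ ε : ℝ) (N j : ℕ) :
    timeStep δ ε N (j + 1) = 2 * timeStep δ ε N j := by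
  rw [timeStep, timeStep, Nat.cast_succ, add_sub_right_comm, zpow_add_one₀ two_ne_zero]
  ring

theorem mul_timeStep_last [NeZero N] (δ ε : ℝ) :
    N * timeStep δ ε N (numLevels ε - 1) = δ / ε := by
  have hN : (N : ℝ) ≠ 0 := NeZero.ne _
  rw [timeStep, numLevels, Nat.add_sub_cancel, sub_self, zpow_zero, one_mul,
    ← mul_div_assoc, mul_div_mul_left _ _ hN]

theorem mul_timeStep_zero_le [NeZero N] (hδ : 0 < δ) (hε : 0 < ε) :
    N * timeStep δ ε N 0 ≤ δ := by
  have hN : (N : ℝ) ≠ 0 := NeZero.ne _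
  have hceil : 1 / ε ≤ 2 ^ ⌈Real.logb 2 (1 / ε)⌉₊ := by
    rw [← Real.rpow_natCast, ← Real.logb_le_iff_le_rpow one_lt_two (by positivity)]
    exact Nat.le_ceil _
  calc N * timeStep δ ε N 0 = δ * (1 / ε / 2 ^ ⌈Real.logb 2 (1 / ε)⌉₊) := by
        rw [timeStep, Nat.cast_zero, zero_sub, zpow_neg, zpow_natCast]
        field_simp
    _ ≤ δ := mul_le_of_le_one_right hδ.le ((div_le_one (by positivity)).2 hceil)

end TimeStep

section Levels

variable {N : ℕ} {p δ ε lam τ θ : ℝ}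

theorem sum_range_dite_eq_sum_filter (b : Fin N → ℂ) {k : ℕ} (hk : k ≤ N) :
    ∑ n ∈ Finset.range k, (if h : n < N then b ⟨n, h⟩ else 0)
      = ∑ n ∈ {n : Fin N | (n : ℕ) < k}, b n := by
  rw [Finset.sum_filter, Finset.sum_fin_eq_sum_range]
  have hk' := Finset.range_subset_range.2 hk
  rw [← Finset.sum_subset hk' fun n _ hn => by simp [mt Finset.mem_range.2 hn]]
  exact Finset.sum_congr rfl fun n hn => by simp [Finset.mem_range.1 hn]

/-- The deviation of the data from `p exp(-i lam n τ)`, rotated by `exp(i lam n τ)`. -/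
def noise (Z : Fin N → ℂ) (p lam τ : ℝ) (n : Fin N) : ℂ :=
  Z n * Complex.exp (Complex.I * (lam : ℂ) * ((n : ℕ) : ℂ) * (τ : ℂ)) - p

theorem mul_corr_eq_dirichletSum [NeZero N] (Z : Fin N → ℂ) (p lam τ θ : ℝ) :
    (N : ℂ) * corr Z τ θ = (p : ℂ) * dirichletSum N ((θ - lam) * τ)
      + ∑ n ∈ Finset.range N, (if h : n < N then noise Z p lam τ ⟨n, h⟩ else 0)
        * Complex.exp (Complex.I * (((θ - lam) * τ : ℝ) : ℂ)) ^ n := by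
  rw [mul_corr, dirichletSum, Finset.mul_sum, ← Finset.sum_add_distrib, Finset.sum_range]
  refine Finset.sum_congr rfl fun n _ => ?_
  have hexp : Complex.exp (Complex.I * (θ : ℂ) * ((n : ℕ) : ℂ) * (τ : ℂ))
      = Complex.exp (Complex.I * (lam : ℂ) * ((n : ℕ) : ℂ) * (τ : ℂ)) *
        Complex.exp (Complex.I * (((θ - lam) * τ : ℝ) : ℂ)) ^ (n : ℕ) := by
    rw [← Complex.exp_nat_mul, ← Complex.exp_add]
    push_cast
    ring_nf
  rw [dif_pos n.2, ← add_mul, noise, add_sub_cancel, hexp, Fin.eta, mul_assoc (Z n)]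

/-- The noise on every data point is small compared with the signal strength `p`, and the average
noise on every initial segment is smaller still, by the factor `δ`. -/
structure SmallNoise (Z : Fin N → ℂ) (p δ lam τ : ℝ) : Prop where
  norm_noise_le : ∀ n, ‖noise Z p lam τ n‖ ≤ p / 20
  norm_sum_noise_le : ∀ k ≤ N,
    ‖∑ n ∈ {n : Fin N | (n : ℕ) < k}, noise Z p lam τ n‖ ≤ N * (p * δ / 400)

theorem SmallNoise.mul_abs_lt {Z : Fin N → ℂ} (hZ : SmallNoise Z p δ lam τ) (hN : 4 ≤ N)
    (hev : Even N) (hp : 0 < p) (hδ : 0 < δ) (hcorr : ‖corr Z τ lam‖ ≤ ‖corr Z τ θ‖)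
    (hθ : |(θ - lam) * τ| ≤ Real.pi + 1) : N * |(θ - lam) * τ| < δ := by
  have : NeZero N := ⟨by omega⟩
  have hmax := mul_le_mul_of_nonneg_left hcorr (norm_nonneg (N : ℂ))
  rw [← norm_mul, ← norm_mul, mul_corr_eq_dirichletSum Z p lam τ lam,
    mul_corr_eq_dirichletSum Z p lam τ θ] at hmax
  refine mul_abs_lt_of_le_norm_correlation hN hev hp hδ hθ (fun n hn => ?_) (fun k hk => ?_)
    (le_of_eq_of_le ?_ hmax)
  · rw [dif_pos hn]
    exact hZ.norm_noise_le _
  · rw [sum_range_dite_eq_sum_filter _ hk]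
    exact hZ.norm_sum_noise_le k hk
  · simp [dirichletSum, mul_comm (p : ℂ)]

variable {J : ℕ} {τ θ : ℕ → ℝ} {Z : Fin J → Fin N → ℂ} {r : ℕ → ℂ}

theorem IsRun.norm_corr_le [NeZero N] (hrun : IsRun τ Z r θ) (j : Fin J)
    (hlam : lam ∈ searchInterval τ θ j) : ‖corr (Z j) (τ j) lam‖ ≤ ‖corr (Z j) (τ j) (θ j)‖ :=
  norm_corr_le_of_loss_le ((hrun j).2 _ _ hlam)

theorem abs_sub_mul_le_of_mem_searchInterval_zero {x : ℝ} (hτ : 0 < τ 0) (hτ' : τ 0 ≤ 1 / 4)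
    (hx : x ∈ searchInterval τ θ 0) (hlam : lam ∈ Set.Icc (-Real.pi) Real.pi) :
    |(x - lam) * τ 0| ≤ Real.pi + 1 := by
  have hdist : |x - lam| ≤ 2 * Real.pi :=
    abs_le.2 ⟨by linarith [hx.1, hlam.2], by linarith [hx.2, hlam.1]⟩
  rw [abs_mul, abs_of_pos hτ]
  calc |x - lam| * τ 0 ≤ 2 * Real.pi * (1 / 4) := mul_le_mul hdist hτ' hτ.le Real.two_pi_pos.le
    _ ≤ Real.pi + 1 := by linarith [Real.pi_pos]

theorem mem_searchInterval_succ {j : ℕ} (hτ : 0 < τ j) (hclose : |(θ j - lam) * τ j| ≤ 1 / 4) :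
    lam ∈ searchInterval τ θ (j + 1) := by
  have hdist : |θ j - lam| ≤ Real.pi / (2 * τ j) := by
    rw [le_div_iff₀ (by positivity)]
    rw [abs_mul, abs_of_pos hτ] at hclose
    linarith [Real.pi_gt_three]
  exact ⟨by linarith [(abs_le.1 hdist).2], by linarith [(abs_le.1 hdist).1]⟩

theorem abs_sub_mul_le_of_mem_searchInterval_succ {j : ℕ} {x : ℝ} (hτ : 0 < τ j)
    (hsucc : τ (j + 1) = 2 * τ j) (hclose : |(θ j - lam) * τ j| ≤ 1 / 4)
    (hx : x ∈ searchInterval τ θ (j + 1)) : |(x - lam) * τ (j + 1)| ≤ Real.pi + 1 := by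
  have hdist : |x - θ j| ≤ Real.pi / (2 * τ j) :=
    abs_le.2 ⟨by linarith [hx.1], by linarith [hx.2]⟩
  rw [abs_mul, abs_of_pos hτ] at hclose
  rw [hsucc, abs_mul, abs_of_pos (by positivity : 0 < 2 * τ j)]
  calc |x - lam| * (2 * τ j) ≤ (|x - θ j| + |θ j - lam|) * (2 * τ j) := by
        gcongr
        exact abs_sub_le _ _ _
    _ ≤ (Real.pi / (2 * τ j) + |θ j - lam|) * (2 * τ j) := by gcongr
    _ = Real.pi + 2 * (|θ j - lam| * τ j) := by
        field_simp
    _ ≤ Real.pi + 1 := by linarith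

theorem IsRun.mul_abs_lt (hrun : IsRun τ Z r θ) (hN : 4 ≤ N) (hev : Even N) (hp : 0 < p)
    (hδ : 0 < δ) (hδ' : δ ≤ 1) (hlam : lam ∈ Set.Icc (-Real.pi) Real.pi)
    (hZ : ∀ j : Fin J, SmallNoise (Z j) p δ lam (τ j)) (hτ : ∀ j, 0 < τ j)
    (hτ₀ : N * τ 0 ≤ δ) (hsucc : ∀ j, τ (j + 1) = 2 * τ j) (j : Fin J) :
    N * |(θ j - lam) * τ j| < δ := by
  have : NeZero N := ⟨by omega⟩
  have hN' : (4 : ℝ) ≤ N := by exact_mod_cast hN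
  obtain ⟨j, hj⟩ := j
  induction j with
  | zero =>
    have hτ₀' : τ 0 ≤ 1 / 4 := by nlinarith [hτ 0]
    exact (hZ ⟨0, hj⟩).mul_abs_lt hN hev hp hδ (hrun.norm_corr_le ⟨0, hj⟩ hlam)
      (abs_sub_mul_le_of_mem_searchInterval_zero (hτ 0) hτ₀' (hrun ⟨0, hj⟩).1 hlam)
  | succ j ih =>
    have hclose : |(θ j - lam) * τ j| ≤ 1 / 4 := by
      have hprev := ih (by omega)
      nlinarith [abs_nonneg ((θ j - lam) * τ j)]
    exact (hZ ⟨j + 1, hj⟩).mul_abs_lt hN hev hp hδ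
      (hrun.norm_corr_le ⟨j + 1, hj⟩ (mem_searchInterval_succ (hτ j) hclose))
      (abs_sub_mul_le_of_mem_searchInterval_succ (hτ j) (hsucc j) hclose (hrun ⟨j + 1, hj⟩).1)

theorem succeeds_of_smallNoise (hN : 4 ≤ N) (hev : Even N) (hp : 0 < p) (hδ : 0 < δ)
    (hδ' : δ ≤ 1) (hε : 0 < ε) (hlam : lam ∈ Set.Icc (-Real.pi) Real.pi)
    {Z : Fin (numLevels ε) → Fin N → ℂ}
    (hZ : ∀ j, SmallNoise (Z j) p δ lam (timeStep δ ε N j)) :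
    Succeeds (timeStep δ ε N) Z ε lam := by
  have : NeZero N := ⟨by omega⟩
  have hτ := timeStep_pos (N := N) hδ hε
  refine ⟨exists_isRun hτ Z, fun r θ hrun => ?_⟩
  have hlast := hrun.mul_abs_lt hN hev hp hδ hδ' hlam hZ hτ (mul_timeStep_zero_le hδ hε)
    (timeStep_succ δ ε N) ⟨numLevels ε - 1, Nat.sub_lt (Nat.succ_pos _) one_pos⟩
  rw [abs_mul, abs_of_pos (hτ _), mul_left_comm, mul_timeStep_last, ← mul_div_assoc,
    div_lt_iff₀ hε, mul_comm δ] at hlast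
  exact lt_of_mul_lt_mul_right hlast hδ.le

end Levels

section Filtered

variable {M d : ℕ} {H : Matrix (Fin M) (Fin M) ℂ} {ψ : Sys M} {p lam : Fin M → ℝ} {m₀ : Fin M}
  {F : Fin (2 * d + 1) → ℂ} {q : ℝ}

/-- The signal of the spectral distribution `p` after applying the filter `F`: the mean of a
sample value for the evolution time `t`. -/
def filteredSignal (p lam : Fin M → ℝ) (F : Fin (2 * d + 1) → ℂ) (t : ℝ) : ℂ :=
  ∑ m, (p m : ℂ) * Complex.exp (-(Complex.I * (t : ℂ) * (lam m : ℂ))) * trigPoly F (lam m)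

theorem sum_mul_signal (a : Fin (2 * d + 1) → ℂ) (t : ℝ) :
    ∑ l, a l * signal p lam ((shift d l : ℝ) + t) = filteredSignal p lam a t := by
  simp only [signal, filteredSignal, trigPoly, Finset.mul_sum]
  rw [Finset.sum_comm]
  refine Finset.sum_congr rfl fun m _ => Finset.sum_congr rfl fun l _ => ?_
  have hexp : Complex.exp (-(Complex.I * (((shift d l : ℝ) + t : ℝ) : ℂ) * (lam m : ℂ)))
      = Complex.exp (-(Complex.I * (t : ℂ) * (lam m : ℂ))) *
        Complex.exp (-(Complex.I * (shift d l : ℂ) * (lam m : ℂ))) := by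
    rw [← Complex.exp_add]
    congr 1
    push_cast
    ring
  rw [hexp]
  ring

theorem shiftProb_mem_stdSimplex (hF : 0 < filterMass F) :
    shiftProb F ∈ stdSimplex ℝ (Fin (2 * d + 1)) := by
  refine ⟨fun l => div_nonneg (norm_nonneg _) hF.le, ?_⟩
  simp only [shiftProb, ← Finset.sum_div]
  exact div_self hF.ne'

theorem sampleValue_eq_weightedValue (F : Fin (2 * d + 1) → ℂ) (s : Sample (2 * d + 1)) :
    sampleValue F s = weightedValue
      (fun l => Complex.exp (Complex.I * (Complex.arg (F l) : ℂ)) * (filterMass F : ℂ)) s := by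
  rw [sampleValue, weightedValue]
  ring

theorem norm_sampleValue_le (hF : 0 < filterMass F) (s : Sample (2 * d + 1)) :
    ‖sampleValue F s‖ ≤ 2 * filterMass F := by
  rw [sampleValue_eq_weightedValue]
  refine norm_weightedValue_le (fun l => ?_) s
  rw [norm_mul, mul_comm Complex.I, Complex.norm_exp_ofReal_mul_I, one_mul, Complex.norm_real,
    Real.norm_of_nonneg hF.le]

theorem shiftProb_mul_exp_arg (hF : 0 < filterMass F) (l : Fin (2 * d + 1)) :
    (shiftProb F l : ℂ) * (Complex.exp (Complex.I * (Complex.arg (F l) : ℂ)) * (filterMass F : ℂ))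
      = F l := by
  have hF' : (filterMass F : ℂ) ≠ 0 := mod_cast hF.ne'
  conv_rhs => rw [← Complex.norm_mul_exp_arg_mul_I (F l), mul_comm _ Complex.I]
  rw [shiftProb, Complex.ofReal_div]
  field_simp

theorem sum_sampleProb_mul_sampleValue (hg : Measures H ψ (signal p lam)) (hF : 0 < filterMass F)
    (t : ℝ) :
    ∑ s, (sampleProb H ψ (shiftProb F) (fun l => (shift d l : ℝ) + t) s : ℂ) * sampleValue F s
      = filteredSignal p lam F t := by
  simp only [sampleValue_eq_weightedValue]
  rw [hg.sum_sampleProb_mul_weightedValue, ← sum_mul_signal]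
  exact Finset.sum_congr rfl fun l _ => by rw [shiftProb_mul_exp_arg hF]

/-- The sample value for the evolution time `t`, centered and then rotated by `exp(i t x)`. -/
def centeredValue (p lam : Fin M → ℝ) (F : Fin (2 * d + 1) → ℂ) (x t : ℝ)
    (s : Sample (2 * d + 1)) : ℂ :=
  (sampleValue F s - filteredSignal p lam F t) * Complex.exp (Complex.I * (t : ℂ) * (x : ℂ))

theorem norm_centeredValue_le (hg : Measures H ψ (signal p lam)) (hF : 0 < filterMass F) (x t : ℝ)
    (s : Sample (2 * d + 1)) : ‖centeredValue p lam F x t s‖ ≤ 4 * filterMass F := by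
  have hmean : ‖filteredSignal p lam F t‖ ≤ 2 * filterMass F := by
    rw [← sum_sampleProb_mul_sampleValue hg hF]
    simpa only [Complex.real_smul] using norm_sum_smul_le
      (hg.sampleProb_mem_stdSimplex (shiftProb_mem_stdSimplex hF) _) (norm_sampleValue_le hF)
  have hexp : ‖Complex.exp (Complex.I * (t : ℂ) * (x : ℂ))‖ = 1 := by simp [Complex.norm_exp]
  rw [centeredValue, norm_mul, hexp, mul_one]
  linarith [norm_sub_le (sampleValue F s) (filteredSignal p lam F t), norm_sampleValue_le hF s]

theorem sum_sampleProb_mul_centeredValue (hg : Measures H ψ (signal p lam))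
    (hF : 0 < filterMass F) (x t : ℝ) :
    ∑ s, (sampleProb H ψ (shiftProb F) (fun l => (shift d l : ℝ) + t) s : ℂ) *
      centeredValue p lam F x t s = 0 := by
  have hmass : (∑ s, (sampleProb H ψ (shiftProb F) (fun l => (shift d l : ℝ) + t) s : ℂ)) = 1 :=
    mod_cast (hg.sampleProb_mem_stdSimplex (shiftProb_mem_stdSimplex hF) _).2
  simp only [centeredValue, ← mul_assoc, ← Finset.sum_mul, mul_sub, Finset.sum_sub_distrib]
  rw [hmass, sum_sampleProb_mul_sampleValue hg hF, one_mul, sub_self, zero_mul]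

/-- The filter `F` is within `q` of `1` at the eigenvalue with index `m₀`, and within `q` of `0`
at all the others. -/
def Isolates (F : Fin (2 * d + 1) → ℂ) (lam : Fin M → ℝ) (m₀ : Fin M) (q : ℝ) : Prop :=
  ‖trigPoly F (lam m₀) - 1‖ ≤ q ∧ ∀ m ≠ m₀, ‖trigPoly F (lam m)‖ ≤ q

theorem Isolates.norm_filteredSignal_sub_le (h : Isolates F lam m₀ q)
    (hp : p ∈ stdSimplex ℝ (Fin M)) (t : ℝ) :
    ‖filteredSignal p lam F t * Complex.exp (Complex.I * (t : ℂ) * (lam m₀ : ℂ)) - p m₀‖ ≤ q := by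
  have hsum : filteredSignal p lam F t * Complex.exp (Complex.I * (t : ℂ) * (lam m₀ : ℂ)) - p m₀
      = ∑ m, (p m : ℂ) * (Complex.exp (-(Complex.I * (t : ℂ) * ((lam m - lam m₀ : ℝ) : ℂ))) *
        (trigPoly F (lam m) - if m = m₀ then 1 else 0)) := by
    have hp₀ : (p m₀ : ℂ) = ∑ m, (p m : ℂ) *
        (Complex.exp (-(Complex.I * (t : ℂ) * ((lam m - lam m₀ : ℝ) : ℂ))) *
          if m = m₀ then 1 else 0) := by
      simp
    rw [filteredSignal, Finset.sum_mul, hp₀, ← Finset.sum_sub_distrib]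
    refine Finset.sum_congr rfl fun m _ => ?_
    have hexp : Complex.exp (-(Complex.I * (t : ℂ) * ((lam m - lam m₀ : ℝ) : ℂ)))
        = Complex.exp (-(Complex.I * (t : ℂ) * (lam m : ℂ))) *
          Complex.exp (Complex.I * (t : ℂ) * (lam m₀ : ℂ)) := by
      rw [← Complex.exp_add]
      congr 1
      push_cast
      ring
    rw [hexp]
    ring
  simp only [hsum, ← Complex.real_smul (x := p _)]
  refine norm_sum_smul_le hp fun m => ?_
  have hexp : ‖Complex.exp (-(Complex.I * (t : ℂ) * ((lam m - lam m₀ : ℝ) : ℂ)))‖ = 1 := by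
    simp [Complex.norm_exp]
  rw [norm_mul, hexp, one_mul]
  by_cases hm : m = m₀
  · rw [if_pos hm, hm]
    exact h.1
  · rw [if_neg hm, sub_zero]
    exact h.2 m hm

variable {J N Ns : ℕ} {τ : ℕ → ℝ}

theorem filteredDataProb_mem_stdSimplex {g : ℝ → ℂ} (hg : Measures H ψ g)
    (hF : 0 < filterMass F) (τ : ℕ → ℝ) :
    filteredDataProb H ψ τ F ∈ stdSimplex ℝ (FilteredData J N Ns d) :=
  prod_mem_stdSimplex fun _ => prod_mem_stdSimplex fun _ => prod_mem_stdSimplex fun _ =>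
    hg.sampleProb_mem_stdSimplex (shiftProb_mem_stdSimplex hF) _

theorem prob_norm_sum_centeredValue_ge_le (hg : Measures H ψ (signal p lam))
    (hF : 0 < filterMass F) {b : ℝ} (hb : filterMass F ≤ b) (x : ℝ) (j : Fin J) {A : Finset (Fin N)}
    {m : ℝ} (hA : A.card ≤ m) {r : ℝ} (hr : 0 ≤ r) :
    prob (filteredDataProb H ψ τ F : FilteredData J N Ns d → ℝ)
      (fun ω => 2 * r ≤ ‖∑ n ∈ A, ∑ k, centeredValue p lam F x ((n : ℕ) * τ j) (ω j n k)‖)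
      ≤ 4 * Real.exp (-(r ^ 2 / (2 * (Ns * (m * (4 * b) ^ 2))))) := by
  -- Uncurrying turns the nested product law into a single product over triples `(j, n, k)`.
  let uncurried := (Equiv.curry (Fin J) (Fin N × Fin Ns) (Sample (2 * d + 1))).trans
    (Equiv.piCongrRight fun _ => Equiv.curry (Fin N) (Fin Ns) _)
  have hvariance : ∑ _i ∈ {j} ×ˢ A ×ˢ (Finset.univ : Finset (Fin Ns)), (4 * b) ^ 2
      ≤ Ns * (m * (4 * b) ^ 2) := by
    rw [Finset.sum_const, nsmul_eq_mul, Finset.card_product, Finset.card_product,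
      Finset.card_singleton, Finset.card_univ, Fintype.card_fin, one_mul, Nat.cast_mul,
      mul_comm (A.card : ℝ), mul_assoc]
    gcongr
  have h := prob_norm_sum_ge_le (ι := Fin J × Fin N × Fin Ns)
    (fun i => hg.sampleProb_mem_stdSimplex (shiftProb_mem_stdSimplex hF)
      fun l => (shift d l : ℝ) + (i.2.1 : ℕ) * τ i.1)
    ({j} ×ˢ A ×ˢ Finset.univ) (f := fun i => centeredValue p lam F x ((i.2.1 : ℕ) * τ i.1))
    (fun i _ s => (norm_centeredValue_le hg hF x _ s).trans (by gcongr))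
    (fun i _ => sum_sampleProb_mul_centeredValue hg hF x _) hvariance hr
  simp only [Finset.sum_product, Finset.sum_singleton, Fintype.prod_prod_type] at h
  rw [← prob_equiv uncurried]
  exact h

theorem noise_dataPoint (hNs : 0 < Ns) (p₀ x : ℝ) (ω : FilteredData J N Ns d) (j : Fin J)
    (n : Fin N) :
    noise (dataPoint F ω j) p₀ x (τ j) n
      = (1 / (Ns : ℂ)) * ∑ k, centeredValue p lam F x ((n : ℕ) * τ j) (ω j n k)
        + (filteredSignal p lam F ((n : ℕ) * τ j) *
          Complex.exp (Complex.I * (((n : ℕ) * τ j : ℝ) : ℂ) * (x : ℂ)) - p₀) := by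
  have hNs' : (Ns : ℂ) ≠ 0 := mod_cast hNs.ne'
  have hphase : Complex.I * (x : ℂ) * ((n : ℕ) : ℂ) * (τ j : ℂ)
      = Complex.I * (((n : ℕ) * τ j : ℝ) : ℂ) * (x : ℂ) := by
    push_cast
    ring
  simp only [noise, hphase, centeredValue]
  rw [← Finset.sum_mul, Finset.sum_sub_distrib, dataPoint, Finset.sum_const, Finset.card_univ,
    Fintype.card_fin, nsmul_eq_mul]
  field_simp
  ring

theorem Isolates.norm_sum_noise_dataPoint_le (h : Isolates F lam m₀ q)
    (hp : p ∈ stdSimplex ℝ (Fin M)) (hNs : 0 < Ns) (ω : FilteredData J N Ns d) (j : Fin J)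
    (A : Finset (Fin N)) :
    ‖∑ n ∈ A, noise (dataPoint F ω j) (p m₀) (lam m₀) (τ j) n‖
      ≤ ‖∑ n ∈ A, ∑ k, centeredValue p lam F (lam m₀) ((n : ℕ) * τ j) (ω j n k)‖ / Ns
        + A.card * q := by
  rw [Finset.sum_congr rfl fun n _ => noise_dataPoint (p := p) (lam := lam) hNs _ _ ω j n,
    Finset.sum_add_distrib, ← Finset.mul_sum]
  refine (norm_add_le _ _).trans (add_le_add (le_of_eq ?_) ?_)
  · rw [norm_mul, norm_div, norm_one, Complex.norm_natCast, one_div_mul_eq_div]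
  · rw [← nsmul_eq_mul]
    exact norm_sum_le_of_le _ (fun n _ => h.norm_filteredSignal_sub_le hp _) |>.trans_eq
      (Finset.sum_const q)

theorem Isolates.prob_norm_sum_noise_ge_le (h : Isolates F lam m₀ q)
    (hg : Measures H ψ (signal p lam)) (hp : p ∈ stdSimplex ℝ (Fin M)) (hF : 0 < filterMass F)
    {b : ℝ} (hb : filterMass F ≤ b) (hNs : 0 < Ns) (j : Fin J) {A : Finset (Fin N)} {m : ℝ}
    (hA : A.card ≤ m) {x : ℝ} (hx : 0 ≤ x) :
    prob (filteredDataProb H ψ τ F : FilteredData J N Ns d → ℝ)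
      (fun ω => x + A.card * q ≤ ‖∑ n ∈ A, noise (dataPoint F ω j) (p m₀) (lam m₀) (τ j) n‖)
      ≤ 4 * Real.exp (-(Ns * x ^ 2 / (128 * b ^ 2 * m))) := by
  have hNs' : (0 : ℝ) < Ns := mod_cast hNs
  refine (prob_mono (filteredDataProb_mem_stdSimplex hg hF τ).1 fun ω hω => ?_).trans
    ((prob_norm_sum_centeredValue_ge_le hg hF hb (lam m₀) j hA (r := Ns * x / 2)
      (by positivity)).trans_eq ?_)
  · have hcentered := (le_div_iff₀ hNs').1
      (le_of_add_le_add_right (hω.trans (h.norm_sum_noise_dataPoint_le hp hNs ω j A)))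
    linarith
  · congr 3
    field_simp
    ring

end Filtered

section SecondStage

variable {M d J N Ns : ℕ} {H : Matrix (Fin M) (Fin M) ℂ} {ψ : Sys M} {p lam : Fin M → ℝ}
  {m₀ : Fin M} {F : Fin (2 * d + 1) → ℂ} {τ : ℕ → ℝ} {δ ε q b L : ℝ}

theorem Isolates.prob_noise_gt_le (h : Isolates F lam m₀ q) (hg : Measures H ψ (signal p lam))
    (hp : p ∈ stdSimplex ℝ (Fin M)) (hF : 0 < filterMass F) (hb : filterMass F ≤ b) (hNs : 0 < Ns)
    (hq : q ≤ p m₀ / 40) (hL : 204800 * b ^ 2 * L ≤ Ns * p m₀ ^ 2) (j : Fin J) (n : Fin N) :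
    prob (filteredDataProb H ψ τ F : FilteredData J N Ns d → ℝ)
      (fun ω => p m₀ / 20 < ‖noise (dataPoint F ω j) (p m₀) (lam m₀) (τ j) n‖)
      ≤ 4 * Real.exp (-L) := by
  have hb₀ : 0 < b := hF.trans_le hb
  refine (prob_mono (filteredDataProb_mem_stdSimplex hg hF τ).1 fun ω hω => ?_).trans
    ((h.prob_norm_sum_noise_ge_le hg hp hF hb hNs j (A := {n}) (m := 1) (by simp)
      (x := p m₀ / 40) (div_nonneg (hp.1 _) (by norm_num))).trans ?_)
  · rw [Finset.sum_singleton, Finset.card_singleton]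
    push_cast
    linarith
  · gcongr
    rw [le_div_iff₀ (by positivity)]
    linarith

theorem Isolates.prob_norm_sum_noise_gt_le (h : Isolates F lam m₀ q)
    (hg : Measures H ψ (signal p lam)) (hp : p ∈ stdSimplex ℝ (Fin M)) (hF : 0 < filterMass F)
    (hb : filterMass F ≤ b) (hN : 0 < N) (hNs : 0 < Ns) (hδ : 0 ≤ δ) (hNδ : 1 ≤ N * δ ^ 2)
    (hq : q ≤ p m₀ * δ / 800) (hL : 81920000 * b ^ 2 * L ≤ Ns * p m₀ ^ 2) (j : Fin J)
    (A : Finset (Fin N)) :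
    prob (filteredDataProb H ψ τ F : FilteredData J N Ns d → ℝ)
      (fun ω => N * (p m₀ * δ / 400) < ‖∑ n ∈ A, noise (dataPoint F ω j) (p m₀) (lam m₀) (τ j) n‖)
      ≤ 4 * Real.exp (-L) := by
  have hb₀ : 0 < b := hF.trans_le hb
  have hpδ : 0 ≤ p m₀ * δ := mul_nonneg (hp.1 _) hδ
  have hcard : (A.card : ℝ) ≤ N := mod_cast (Finset.card_le_univ A).trans_eq (Fintype.card_fin N)
  refine (prob_mono (filteredDataProb_mem_stdSimplex hg hF τ).1 fun ω hω => ?_).trans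
    ((h.prob_norm_sum_noise_ge_le hg hp hF hb hNs j hcard (x := N * (p m₀ * δ / 800))
      (by positivity)).trans ?_)
  · have hbias : A.card * q ≤ N * (p m₀ * δ / 800) :=
      (mul_le_mul_of_nonneg_left hq A.card.cast_nonneg).trans
        (mul_le_mul_of_nonneg_right hcard (by positivity))
    linarith
  · gcongr
    have hscaled : 81920000 * b ^ 2 * L ≤ Ns * p m₀ ^ 2 * (N * δ ^ 2) :=
      hL.trans (le_mul_of_one_le_right (by positivity) hNδ)
    rw [le_div_iff₀ (by positivity)]
    calc L * (128 * b ^ 2 * N) = N / 640000 * (81920000 * b ^ 2 * L) := by ring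
      _ ≤ N / 640000 * (Ns * p m₀ ^ 2 * (N * δ ^ 2)) := by gcongr
      _ = Ns * (N * (p m₀ * δ / 800)) ^ 2 := by ring

theorem Isolates.prob_not_smallNoise_le (h : Isolates F lam m₀ q)
    (hg : Measures H ψ (signal p lam)) (hp : p ∈ stdSimplex ℝ (Fin M)) (hF : 0 < filterMass F)
    (hb : filterMass F ≤ b) (hN : 0 < N) (hNs : 0 < Ns) (hδ : 0 ≤ δ) (hδ' : δ ≤ 1)
    (hNδ : 1 ≤ N * δ ^ 2) (hq : q ≤ p m₀ * δ ^ 2 / 800)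
    (hL : 81920000 * b ^ 2 * L ≤ Ns * p m₀ ^ 2) (j : Fin J) :
    prob (filteredDataProb H ψ τ F : FilteredData J N Ns d → ℝ)
      (fun ω => ¬ SmallNoise (dataPoint F ω j) (p m₀) δ (lam m₀) (τ j))
      ≤ 12 * N * Real.exp (-L) := by
  have hw := (filteredDataProb_mem_stdSimplex (J := J) (N := N) (Ns := Ns) hg hF τ).1
  have hpδ : p m₀ * δ ≤ p m₀ := mul_le_of_le_one_right (hp.1 _) hδ'
  have hq' : q ≤ p m₀ * δ / 800 := by nlinarith [mul_nonneg (hp.1 m₀) hδ]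
  have hL' : 204800 * b ^ 2 * L ≤ Ns * p m₀ ^ 2 := by
    have : 0 ≤ (Ns : ℝ) * p m₀ ^ 2 := by positivity
    nlinarith
  have hN' : (1 : ℝ) ≤ N := mod_cast hN
  have hsplit := (prob_mono hw
    (E := fun ω => ¬ SmallNoise (dataPoint F ω j) (p m₀) δ (lam m₀) (τ j))
    fun ω hω => ?_).trans <| (prob_or_le hw _ _).trans <| add_le_add
      (prob_exists_le hw fun n : Fin N =>
        h.prob_noise_gt_le hg hp hF hb hNs (hq'.trans (by linarith [hp.1 m₀])) hL' j n)
      (prob_exists_le hw fun k : Fin (N + 1) =>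
        h.prob_norm_sum_noise_gt_le hg hp hF hb hN hNs hδ hNδ hq' hL j
          {n : Fin N | (n : ℕ) < k})
  · rw [Fintype.card_fin, Fintype.card_fin] at hsplit
    push_cast at hsplit
    nlinarith [Real.exp_pos (-L)]
  · by_contra! hsmall
    exact hω ⟨hsmall.1, fun k hk => hsmall.2 ⟨k, Nat.lt_succ_of_le hk⟩⟩

theorem Isolates.one_sub_le_prob_succeeds (h : Isolates F lam m₀ q)
    (hg : Measures H ψ (signal p lam)) (hp : p ∈ stdSimplex ℝ (Fin M)) (hp₀ : 0 < p m₀)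
    (hlam : lam m₀ ∈ Set.Icc (-Real.pi) Real.pi) (hF : 0 < filterMass F) (hb : filterMass F ≤ b)
    (hN : 4 ≤ N) (hev : Even N) (hNs : 0 < Ns) (hδ : 0 < δ) (hδ' : δ ≤ 1) (hε : 0 < ε)
    (hNδ : 1 ≤ N * δ ^ 2) (hq : q ≤ p m₀ * δ ^ 2 / 800)
    (hL : 81920000 * b ^ 2 * L ≤ Ns * p m₀ ^ 2) :
    1 - 12 * numLevels ε * N * Real.exp (-L) ≤
      prob (filteredDataProb H ψ (timeStep δ ε N) F : FilteredData (numLevels ε) N Ns d → ℝ)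
        (fun ω => Succeeds (timeStep δ ε N) (dataPoint F ω) ε (lam m₀)) := by
  have hw := filteredDataProb_mem_stdSimplex (J := numLevels ε) (N := N) (Ns := Ns) hg hF
    (timeStep δ ε N)
  refine one_sub_le_prob hw
    (B := fun ω => ∃ j : Fin (numLevels ε),
      ¬ SmallNoise (dataPoint F ω j) (p m₀) δ (lam m₀) (timeStep δ ε N j)) (fun ω hω => ?_) ?_
  · exact succeeds_of_smallNoise hN hev hp₀ hδ hδ' hε hlam fun j => not_exists_not.1 hω j
  · refine (prob_exists_le hw.1 fun j =>
      h.prob_not_smallNoise_le hg hp hF hb (by omega) hNs hδ.le hδ' hNδ hq hL j).trans_eq ?_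
    rw [Fintype.card_fin]
    ring

end SecondStage

section Rough

variable {M d : ℕ} {H : Matrix (Fin M) (Fin M) ℂ} {ψ : Sys M} {p lam : Fin M → ℝ} {m₀ : Fin M}
  {Δ p₀ : ℝ}

theorem abs_shift_le (l : Fin (2 * d + 1)) : |(shift d l : ℝ)| ≤ d := by
  have h : |shift d l| ≤ d := by
    rw [abs_le, shift]
    omega
  exact_mod_cast h

theorem shift_last (d : ℕ) : shift d (Fin.last (2 * d)) = d := by
  simp only [shift, Fin.val_last]
  omega

theorem iSup_abs_shift_add (d : ℕ) {t : ℝ} (ht : 0 ≤ t) :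
    ⨆ l : Fin (2 * d + 1), |(shift d l : ℝ) + t| = d + t := by
  refine le_antisymm (ciSup_le fun l => ?_) ?_
  · refine (abs_add_le _ _).trans ?_
    rw [abs_of_nonneg ht]
    gcongr
    exact abs_shift_le l
  · refine le_ciSup_of_le (Set.finite_range _).bddAbove (Fin.last (2 * d)) ?_
    rw [shift_last, Int.cast_natCast]
    exact le_abs_self _

/-- The probability distribution of the random shift in the rough estimation, proportional
to `1 / (1 + |l|)`. It dominates the coefficients of all the step filters at once, so that the same
samples serve for all of them. -/
def harmonicWeight (d : ℕ) (l : Fin (2 * d + 1)) : ℝ :=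
  1 / (1 + |(shift d l : ℝ)|) / harmonicMass d

theorem harmonicWeight_pos (l : Fin (2 * d + 1)) : 0 < harmonicWeight d l :=
  div_pos (by positivity) (harmonicMass_pos d)

theorem sum_harmonicWeight (d : ℕ) : ∑ l, harmonicWeight d l = 1 := by
  simp only [harmonicWeight, ← Finset.sum_div]
  exact div_self (harmonicMass_pos d).ne'

theorem harmonicWeight_mem_stdSimplex (d : ℕ) :
    harmonicWeight d ∈ stdSimplex ℝ (Fin (2 * d + 1)) :=
  ⟨fun l => (harmonicWeight_pos l).le, sum_harmonicWeight d⟩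

theorem norm_div_harmonicWeight_le {z : ℂ} {l : Fin (2 * d + 1)}
    (hz : ‖z‖ ≤ 1 / (1 + |(shift d l : ℝ)|)) :
    ‖z / (harmonicWeight d l : ℂ)‖ ≤ harmonicMass d := by
  rw [norm_div, Complex.norm_real, Real.norm_of_nonneg (harmonicWeight_pos l).le,
    div_le_iff₀ (harmonicWeight_pos l), harmonicWeight, mul_div_cancel₀ _ (harmonicMass_pos d).ne']
  exact hz

/-- The degree of the filters used for the rough estimate. -/
def roughDegree (Δ p₀ : ℝ) : ℕ := filterPower (p₀ / 8) * filterBase (Δ / 8)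

/-- The grid of step `Δ / 8` on which the spectral distribution is scanned from below. -/
def gridPoint (Δ : ℝ) (i : ℕ) : ℝ := -Real.pi + i * (Δ / 8)

/-- The step filter that keeps the spectrum below the grid point `i`. -/
def gridFilter (Δ p₀ : ℝ) (i : ℕ) : Fin (2 * roughDegree Δ p₀ + 1) → ℂ :=
  stepFilter (filterPower (p₀ / 8)) (filterBase (Δ / 8)) (gridPoint Δ i)

/-- The statistic of a sample whose mean is the filtered spectral weight below the grid
point `i`. -/
def gridValue (Δ p₀ : ℝ) (i : ℕ) (s : Sample (2 * roughDegree Δ p₀ + 1)) : ℝ :=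
  (weightedValue (fun l => gridFilter Δ p₀ i l / (harmonicWeight (roughDegree Δ p₀) l : ℂ)) s).re

/-- The average of `gridValue` over `n` samples. -/
def gridScore (Δ p₀ : ℝ) (n i : ℕ) (ω : Fin n → Sample (2 * roughDegree Δ p₀ + 1)) : ℝ :=
  (∑ k, gridValue Δ p₀ i (ω k)) / n

/-- The rough estimate from `n` samples: the first grid point below which the estimated spectral
weight is at least `p₀ / 2`. -/
def roughEstimator (Δ p₀ : ℝ) (n : ℕ) : RoughEstimator where
  numTimes := 2 * roughDegree Δ p₀ + 1
  time l := shift (roughDegree Δ p₀) l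
  weight := harmonicWeight (roughDegree Δ p₀)
  weight_pos := harmonicWeight_pos
  weight_sum := sum_harmonicWeight _
  numSamples := n
  estimate ω := gridPoint Δ (sInf {i | p₀ / 2 ≤ gridScore Δ p₀ n i ω})

theorem maxTime_roughEstimator (Δ p₀ : ℝ) (n : ℕ) :
    (roughEstimator Δ p₀ n).maxTime = roughDegree Δ p₀ := by
  have hsup := iSup_abs_shift_add (roughDegree Δ p₀) le_rfl
  simp only [add_zero] at hsup
  exact hsup

theorem gridPoint_mem_Icc (hΔ : 0 < Δ) {i : ℕ} (hi : i ≤ ⌊16 * Real.pi / Δ⌋₊) :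
    gridPoint Δ i ∈ Set.Icc (-Real.pi) Real.pi := by
  have hi' : (i : ℝ) ≤ 16 * Real.pi / Δ := (Nat.le_floor_iff (by positivity)).1 hi
  rw [le_div_iff₀ hΔ] at hi'
  refine ⟨le_add_of_nonneg_right (by positivity), ?_⟩
  rw [gridPoint]
  linarith

theorem monotone_gridPoint (hΔ : 0 ≤ Δ) : Monotone (gridPoint Δ) := fun i j hij => by
  unfold gridPoint
  gcongr

theorem exists_gridPoint_mem_Icc (hΔ : 0 < Δ) {x : ℝ} (hx : x ∈ spectralRange Δ) :
    ∃ i ≤ ⌊16 * Real.pi / Δ⌋₊, gridPoint Δ i ∈ Set.Icc (x + Δ / 8) (x + Δ / 4) := by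
  obtain ⟨hx₁, hx₂⟩ := hx
  set y := (x + Δ / 8 + Real.pi) / (Δ / 8)
  have hy₀ : 0 ≤ y := div_nonneg (by linarith) (by positivity)
  have hyΔ : y * (Δ / 8) = x + Δ / 8 + Real.pi := div_mul_cancel₀ _ (by positivity)
  have hlow : y * (Δ / 8) ≤ ⌈y⌉₊ * (Δ / 8) := by
    gcongr
    exact Nat.le_ceil y
  have hhigh : ⌈y⌉₊ * (Δ / 8) ≤ (y + 1) * (Δ / 8) := by
    gcongr
    exact (Nat.ceil_lt_add_one hy₀).le
  refine ⟨⌈y⌉₊, ?_, ?_, ?_⟩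
  · rw [Nat.le_floor_iff (by positivity), le_div_iff₀ hΔ]
    linarith
  · rw [gridPoint]
    linarith
  · rw [gridPoint]
    linarith

/-- The weight that the spectral distribution `p` has below the grid point `i`, as seen through the
filter. -/
def gridWeight (p lam : Fin M → ℝ) (Δ p₀ : ℝ) (i : ℕ) : ℝ :=
  ∑ m, p m * (trigPoly (gridFilter Δ p₀ i) (lam m)).re

theorem gridWeight_eq_re_filteredSignal (p lam : Fin M → ℝ) (Δ p₀ : ℝ) (i : ℕ) :
    gridWeight p lam Δ p₀ i = (filteredSignal p lam (gridFilter Δ p₀ i) 0).re := by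
  simp [gridWeight, filteredSignal, Complex.re_sum]

theorem le_gridWeight (hp : p ∈ stdSimplex ℝ (Fin M)) (hp₀ : 0 < p₀) (hΔ : 0 < Δ) {i : ℕ}
    (hi : i ≤ ⌊16 * Real.pi / Δ⌋₊) (hm₀ : lam m₀ ∈ spectralRange Δ)
    (hlam : lam m₀ + Δ / 8 ≤ gridPoint Δ i) :
    p m₀ * (1 - p₀ / 8) ≤ gridWeight p lam Δ p₀ i := by
  have hmem := gridPoint_mem_Icc hΔ hi
  have hnorm : ‖trigPoly (gridFilter Δ p₀ i) (lam m₀) - 1‖ ≤ p₀ / 8 :=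
    norm_trigPoly_stepFilter_sub_one_le (w := Δ / 8) (by positivity) (by positivity) hmem.2
      (by linarith [hm₀.1]) (by linarith)
  have hre : 1 - p₀ / 8 ≤ (trigPoly (gridFilter Δ p₀ i) (lam m₀)).re := by
    have := (abs_le.1 ((Complex.abs_re_le_norm _).trans hnorm)).1
    rw [Complex.sub_re, Complex.one_re] at this
    linarith
  refine (mul_le_mul_of_nonneg_left hre (hp.1 m₀)).trans <| Finset.single_le_sum
    (f := fun m => p m * (trigPoly (gridFilter Δ p₀ i) (lam m)).re) (fun m _ => ?_)
    (Finset.mem_univ m₀)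
  obtain ⟨y, hy, hy'⟩ := exists_trigPoly_stepFilter_eq (m := filterPower (p₀ / 8))
    (B := filterBase (Δ / 8)) hmem (lam m)
  have hyre : (trigPoly (gridFilter Δ p₀ i) (lam m)).re = y := congrArg Complex.re hy'
  exact mul_nonneg (hp.1 m) (hyre ▸ hy.1)

theorem gridWeight_le (hp : p ∈ stdSimplex ℝ (Fin M)) (hp₀ : 0 < p₀) (hΔ : 0 < Δ) {i : ℕ}
    (hi : i ≤ ⌊16 * Real.pi / Δ⌋₊) (hlam : ∀ m, lam m ∈ spectralRange Δ)
    (hlow : ∀ m, gridPoint Δ i + Δ / 8 ≤ lam m) : gridWeight p lam Δ p₀ i ≤ p₀ / 8 := by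
  have hre (m : Fin M) : (trigPoly (gridFilter Δ p₀ i) (lam m)).re ≤ p₀ / 8 :=
    (Complex.re_le_norm _).trans <| norm_trigPoly_stepFilter_le (w := Δ / 8) (by positivity)
      (by positivity) (gridPoint_mem_Icc hΔ hi).1 (hlow m) (by linarith [(hlam m).2])
  calc gridWeight p lam Δ p₀ i ≤ ∑ m, p m * (p₀ / 8) :=
        Finset.sum_le_sum fun m _ => mul_le_mul_of_nonneg_left (hre m) (hp.1 m)
    _ = p₀ / 8 := by rw [← Finset.sum_mul, hp.2, one_mul]

theorem abs_gridPoint_sInf_sub_le (hp : p ∈ stdSimplex ℝ (Fin M)) (hp₀ : 0 < p₀)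
    (hpm : p₀ ≤ p m₀) (hΔ : 0 < Δ) (hmin : ∀ m, lam m₀ ≤ lam m)
    (hlam : ∀ m, lam m ∈ spectralRange Δ) {s : ℕ → ℝ}
    (hs : ∀ i ≤ ⌊16 * Real.pi / Δ⌋₊, |s i - gridWeight p lam Δ p₀ i| ≤ p₀ / 8) :
    |gridPoint Δ (sInf {i | p₀ / 2 ≤ s i}) - lam m₀| ≤ Δ / 4 := by
  have hp₁ : p m₀ ≤ 1 := hp.2 ▸ Finset.single_le_sum (fun m _ => hp.1 m) (Finset.mem_univ m₀)
  have habove : ∀ i ≤ ⌊16 * Real.pi / Δ⌋₊, lam m₀ + Δ / 8 ≤ gridPoint Δ i → p₀ / 2 ≤ s i := by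
    intro i hi hb
    have hweight := le_gridWeight hp hp₀ hΔ hi (hlam m₀) hb
    have hscore := (abs_le.1 (hs i hi)).1
    nlinarith
  have hbelow : ∀ i ≤ ⌊16 * Real.pi / Δ⌋₊, p₀ / 2 ≤ s i → lam m₀ - Δ / 8 ≤ gridPoint Δ i := by
    intro i hi hsi
    by_contra! hb
    have hweight := gridWeight_le hp hp₀ hΔ hi hlam fun m => by linarith [hmin m]
    have hscore := (abs_le.1 (hs i hi)).2
    linarith
  obtain ⟨i, hi, hi₁, hi₂⟩ := exists_gridPoint_mem_Icc hΔ (hlam m₀)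
  have hmem : i ∈ {i | p₀ / 2 ≤ s i} := habove i hi hi₁
  have hle := Nat.sInf_le hmem
  have hlow := hbelow _ (hle.trans hi) (Nat.sInf_mem ⟨i, hmem⟩)
  have hhigh := monotone_gridPoint hΔ.le hle
  exact abs_le.2 ⟨by linarith, by linarith⟩

theorem abs_gridValue_le (hΔ : 0 < Δ) {i : ℕ} (hi : i ≤ ⌊16 * Real.pi / Δ⌋₊)
    (s : Sample (2 * roughDegree Δ p₀ + 1)) :
    |gridValue Δ p₀ i s| ≤ 2 * harmonicMass (roughDegree Δ p₀) :=
  (Complex.abs_re_le_norm _).trans <| norm_weightedValue_le (fun l =>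
    norm_div_harmonicWeight_le (norm_stepFilter_le (gridPoint_mem_Icc hΔ hi) l)) s

theorem sum_sampleProb_mul_gridValue (hg : Measures H ψ (signal p lam)) (Δ p₀ : ℝ) (i : ℕ) :
    ∑ s, sampleProb H ψ (harmonicWeight (roughDegree Δ p₀))
        (fun l => shift (roughDegree Δ p₀) l) s * gridValue Δ p₀ i s
      = gridWeight p lam Δ p₀ i := by
  have hmean : ∑ s, (sampleProb H ψ (harmonicWeight (roughDegree Δ p₀))
        (fun l => shift (roughDegree Δ p₀) l) s : ℂ) * weightedValue
        (fun l => gridFilter Δ p₀ i l / (harmonicWeight (roughDegree Δ p₀) l : ℂ)) s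
      = filteredSignal p lam (gridFilter Δ p₀ i) 0 := by
    rw [hg.sum_sampleProb_mul_weightedValue, ← sum_mul_signal]
    refine Finset.sum_congr rfl fun l _ => ?_
    rw [mul_div_cancel₀ _ (mod_cast (harmonicWeight_pos l).ne'), add_zero]
  rw [gridWeight_eq_re_filteredSignal, ← hmean, Complex.re_sum]
  exact Finset.sum_congr rfl fun s _ => (Complex.re_ofReal_mul _ _).symm

theorem dataProb_roughEstimator_mem_stdSimplex {g : ℝ → ℂ} (hg : Measures H ψ g) (Δ p₀ : ℝ)
    (n : ℕ) : (roughEstimator Δ p₀ n).dataProb H ψ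
      ∈ stdSimplex ℝ (Fin n → Sample (2 * roughDegree Δ p₀ + 1)) :=
  prod_mem_stdSimplex fun _ => hg.sampleProb_mem_stdSimplex (harmonicWeight_mem_stdSimplex _) _

theorem prob_abs_gridScore_sub_ge_le (hg : Measures H ψ (signal p lam)) (hp₀ : 0 < p₀)
    (hΔ : 0 < Δ) {n : ℕ} {L : ℝ} (hL : 2048 * harmonicMass (roughDegree Δ p₀) ^ 2 * L ≤ n * p₀ ^ 2)
    {i : ℕ} (hi : i ≤ ⌊16 * Real.pi / Δ⌋₊) :
    prob ((roughEstimator Δ p₀ n).dataProb H ψ)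
      (fun ω => p₀ / 8 ≤ |gridScore Δ p₀ n i ω - gridWeight p lam Δ p₀ i|)
      ≤ 2 * Real.exp (-L) := by
  have hmass := harmonicMass_pos (roughDegree Δ p₀)
  have htail := prob_abs_average_sub_ge_le (hg.sampleProb_mem_stdSimplex
    (harmonicWeight_mem_stdSimplex _) fun l => shift (roughDegree Δ p₀) l)
    (abs_gridValue_le (p₀ := p₀) hΔ hi) n (t := p₀ / 8) (by positivity)
  rw [sum_sampleProb_mul_gridValue hg] at htail
  refine htail.trans ?_
  gcongr
  rw [le_div_iff₀ (by positivity)]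
  linarith

theorem one_sub_le_prob_abs_estimate_sub_le (hg : Measures H ψ (signal p lam))
    (hp : p ∈ stdSimplex ℝ (Fin M)) (hp₀ : 0 < p₀) (hpm : p₀ ≤ p m₀) (hΔ : 0 < Δ)
    (hmin : ∀ m, lam m₀ ≤ lam m) (hlam : ∀ m, lam m ∈ spectralRange Δ) {n : ℕ} {L : ℝ}
    (hL : 2048 * harmonicMass (roughDegree Δ p₀) ^ 2 * L ≤ n * p₀ ^ 2) :
    1 - (16 * Real.pi / Δ + 1) * (2 * Real.exp (-L)) ≤
      prob ((roughEstimator Δ p₀ n).dataProb H ψ)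
        (fun ω => |(roughEstimator Δ p₀ n).estimate ω - lam m₀| ≤ Δ / 4) := by
  have hw := dataProb_roughEstimator_mem_stdSimplex hg Δ p₀ n
  have hbad := prob_exists_le hw.1 (κ := Fin (⌊16 * Real.pi / Δ⌋₊ + 1)) fun i =>
    prob_abs_gridScore_sub_ge_le hg hp₀ hΔ hL (Nat.le_of_lt_succ i.2)
  refine one_sub_le_prob hw (fun ω hω => abs_gridPoint_sInf_sub_le hp hp₀ hpm hΔ hmin hlam
    fun i hi => ?_) (hbad.trans ?_)
  · simp only [not_exists, not_le] at hω
    exact (hω ⟨i, Nat.lt_succ_of_le hi⟩).le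
  · rw [Fintype.card_fin]
    push_cast
    gcongr
    exact Nat.floor_le (by positivity)

end Rough

section Asymptotics

namespace ThetaTilde

variable {c C c' C' L L' f f' g g' : ℝ} {k k' : ℕ}

theorem mono (h : ThetaTilde c C k L f g) (hf : 0 ≤ f) (hc : c' ≤ c) (hC₀ : 0 ≤ C) (hC : C ≤ C')
    (hk : k ≤ k') (hL : 1 ≤ L) (hL' : L ≤ L') : ThetaTilde c' C' k' L' f g := by
  refine ⟨(mul_le_mul_of_nonneg_right hc hf).trans h.1, h.2.trans ?_⟩
  have hpow : L ^ k ≤ L' ^ k' :=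
    (pow_le_pow_right₀ hL hk).trans (pow_le_pow_left₀ (zero_le_one.trans hL) hL' k')
  calc C * f * L ^ k ≤ C' * f * L ^ k := by gcongr
    _ ≤ C' * f * L' ^ k' := mul_le_mul_of_nonneg_left hpow (mul_nonneg (hC₀.trans hC) hf)

theorem mul (h : ThetaTilde c C k L f g) (h' : ThetaTilde c' C' k' L f' g') (hc : 0 ≤ c)
    (hc' : 0 ≤ c') (hf : 0 ≤ f) (hf' : 0 ≤ f') :
    ThetaTilde (c * c') (C * C') (k + k') L (f * f') (g * g') := by
  have hg : 0 ≤ g := (mul_nonneg hc hf).trans h.1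
  have hg' : 0 ≤ g' := (mul_nonneg hc' hf').trans h'.1
  constructor
  · calc c * c' * (f * f') = c * f * (c' * f') := by ring
      _ ≤ g * g' := mul_le_mul h.1 h'.1 (mul_nonneg hc' hf') hg
  · calc g * g' ≤ C * f * L ^ k * (C' * f' * L ^ k') := mul_le_mul h.2 h'.2 hg' (hg.trans h.2)
      _ = C * C' * (f * f') * L ^ (k + k') := by ring

theorem const_mul (h : ThetaTilde c C k L f g) {a : ℝ} (ha : 0 ≤ a) :
    ThetaTilde (a * c) (a * C) k L f (a * g) := by
  refine ⟨?_, (mul_le_mul_of_nonneg_left h.2 ha).trans_eq (by ring)⟩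
  exact (mul_assoc a c f).trans_le (mul_le_mul_of_nonneg_left h.1 ha)

theorem trans (h : ThetaTilde c C k L f g) (h' : ThetaTilde c' C' k' L g g') (hc' : 0 ≤ c')
    (hC' : 0 ≤ C') (hL : 0 ≤ L) : ThetaTilde (c' * c) (C' * C) (k' + k) L f g' := by
  constructor
  · calc c' * c * f = c' * (c * f) := mul_assoc _ _ _
      _ ≤ g' := (mul_le_mul_of_nonneg_left h.1 hc').trans h'.1
  · calc g' ≤ C' * g * L ^ k' := h'.2
      _ ≤ C' * (C * f * L ^ k) * L ^ k' := by gcongr; exact h.2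
      _ = C' * C * f * L ^ (k' + k) := by ring

theorem add_right (h : ThetaTilde c C k L f g) {x : ℝ} (hx : 0 ≤ x) (hc : c ≤ 1) (hC : 1 ≤ C)
    (hL : 1 ≤ L) : ThetaTilde c C k L (f + x) (g + x) := by
  constructor
  · rw [mul_add]
    exact add_le_add h.1 (mul_le_of_le_one_left hx hc)
  · rw [mul_add, add_mul]
    have hCL : 1 ≤ C * L ^ k := one_le_mul_of_one_le_of_one_le hC (one_le_pow₀ hL)
    refine add_le_add h.2 ?_
    calc x ≤ C * L ^ k * x := le_mul_of_one_le_left hx hCL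
      _ = C * x * L ^ k := by ring

end ThetaTilde

end Asymptotics

section Logarithms

variable {x y : ℝ}

theorem log_inv_nonneg (hx : 0 < x) (hx' : x ≤ 1) : 0 ≤ Real.log x⁻¹ :=
  Real.log_nonneg ((one_le_inv₀ hx).2 hx')

theorem log_one_add_inv_nonneg (hx : 0 < x) : 0 ≤ Real.log (1 + x⁻¹) :=
  Real.log_nonneg (le_add_of_nonneg_right (inv_nonneg.2 hx.le))

theorem log_inv_mul_inv (hx : 0 < x) (hy : 0 < y) :
    Real.log (x⁻¹ * y⁻¹) = Real.log x⁻¹ + Real.log y⁻¹ :=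
  Real.log_mul (inv_ne_zero hx.ne') (inv_ne_zero hy.ne')

theorem one_le_one_add_log_inv_mul_inv (hx : 0 < x) (hx' : x ≤ 1) (hy : 0 < y) (hy' : y ≤ 1) :
    1 ≤ 1 + Real.log (x⁻¹ * y⁻¹) := by
  rw [log_inv_mul_inv hx hy]
  have hsum := add_nonneg (log_inv_nonneg hx hx') (log_inv_nonneg hy hy')
  linarith

/-- The polylogarithmic factor `1 + log y + log (1 + Δ⁻¹)` of the cost estimates, where `y` is the
product of the inverses of the relevant precision parameters. -/
def logFactor (Δ y : ℝ) : ℝ := 1 + Real.log y + Real.log (1 + Δ⁻¹)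

theorem one_add_log_le_logFactor {Δ : ℝ} (hΔ : 0 < Δ) (hx : 0 < x) (hxy : x ≤ y) :
    1 + Real.log x ≤ logFactor Δ y := by
  have hlog := Real.log_le_log hx hxy
  rw [logFactor]
  linarith [log_one_add_inv_nonneg hΔ]

theorem one_add_log_le_logFactor_mul_right {Δ : ℝ} (hΔ : 0 < Δ) (hx : 0 < x) (hy : 1 ≤ y) :
    1 + Real.log x ≤ logFactor Δ (x * y) :=
  one_add_log_le_logFactor hΔ hx (le_mul_of_one_le_right hx.le hy)

theorem one_add_log_inv_mul_inv_le_logFactor {Δ p₀ δ η ε : ℝ} (hΔ : 0 < Δ) (hp₀ : 0 < p₀)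
    (hδ : 0 < δ) (hη : 0 < η) (hη' : η ≤ 1) (hε : 0 < ε) (hε' : ε ≤ 1) :
    1 + Real.log (p₀⁻¹ * δ⁻¹) ≤ logFactor Δ (p₀⁻¹ * δ⁻¹ * η⁻¹ * ε⁻¹) := by
  rw [mul_assoc _ η⁻¹]
  exact one_add_log_le_logFactor_mul_right hΔ (by positivity)
    (one_le_mul_of_one_le_of_one_le ((one_le_inv₀ hη).2 hη') ((one_le_inv₀ hε).2 hε'))

theorem one_add_log_inv_le_logFactor {Δ p₀ δ η ε : ℝ} (hΔ : 0 < Δ) (hp₀ : 0 < p₀) (hp₀' : p₀ ≤ 1)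
    (hδ : 0 < δ) (hδ' : δ ≤ 1) (hη : 0 < η) (hη' : η ≤ 1) (hε : 0 < ε) :
    1 + Real.log ε⁻¹ ≤ logFactor Δ (p₀⁻¹ * δ⁻¹ * η⁻¹ * ε⁻¹) := by
  rw [mul_comm _ ε⁻¹]
  exact one_add_log_le_logFactor_mul_right hΔ (by positivity) (one_le_mul_of_one_le_of_one_le
    (one_le_mul_of_one_le_of_one_le ((one_le_inv₀ hp₀).2 hp₀') ((one_le_inv₀ hδ).2 hδ'))
    ((one_le_inv₀ hη).2 hη'))

theorem pow_le_exp_natCast (n : ℕ) : (2.718 : ℝ) ^ n ≤ Real.exp n := by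
  rw [← Real.exp_one_pow]
  exact pow_le_pow_left₀ (by norm_num) (by linarith [Real.exp_one_gt_d9]) n

theorem log_le_natCast {n : ℕ} (hx : 0 < x) (h : x ≤ 2.718 ^ n) : Real.log x ≤ n :=
  (Real.log_le_iff_le_exp hx).2 (h.trans (pow_le_exp_natCast n))

theorem natCast_ceil_mul_le (hx : 0 ≤ x) (hy : 1 ≤ y) : (⌈x * y⌉₊ : ℝ) ≤ (x + 1) * y := by
  have hceil := (Nat.ceil_lt_add_one (mul_nonneg hx (zero_le_one.trans hy))).le
  linarith

end Logarithms

section Parameters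

variable {ζ Δ p₀ δ η ε q x K L : ℝ}

theorem one_le_filterPower (q : ℝ) : (1 : ℝ) ≤ filterPower q := by
  rw [filterPower, Nat.cast_add_one]
  exact le_add_of_nonneg_left (Nat.cast_nonneg _)

theorem filterPower_le (hx : 1 ≤ x) (hq : 0 < q) (h : 2 / q ≤ 1600 * x ^ 2) :
    (filterPower q : ℝ) ≤ 10 * (1 + Real.log x) := by
  have hlogx : 0 ≤ Real.log x := Real.log_nonneg hx
  have hconst : Real.log (1600 : ℝ) ≤ (8 : ℕ) := log_le_natCast (by norm_num) (by norm_num)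
  have hlog : Real.log (2 / q) ≤ 8 + 2 * Real.log x := by
    calc Real.log (2 / q) ≤ Real.log (1600 * x ^ 2) := Real.log_le_log (by positivity) h
      _ = Real.log 1600 + 2 * Real.log x := by
        rw [Real.log_mul (by norm_num) (by positivity), Real.log_pow, Nat.cast_ofNat]
      _ ≤ 8 + 2 * Real.log x := by push_cast at hconst; linarith
  have hceil : (⌈Real.log (2 / q)⌉₊ : ℝ) < 8 + 2 * Real.log x + 1 :=
    (Nat.cast_le.2 (Nat.ceil_mono hlog)).trans_lt (Nat.ceil_lt_add_one (by positivity))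
  rw [filterPower, Nat.cast_add_one]
  linarith

theorem inv_le_filterBase {r : ℝ} (hΔ : 0 < Δ) (hr : 1 ≤ r) : Δ⁻¹ ≤ filterBase (Δ / r) := by
  have hπr : 1 ≤ 4 * Real.pi * r :=
    one_le_mul_of_one_le_of_one_le (by linarith [Real.pi_gt_three]) hr
  calc Δ⁻¹ = 1 / Δ := inv_eq_one_div Δ
    _ ≤ 4 * Real.pi * r / Δ := by gcongr
    _ = 4 * Real.pi / (Δ / r) := (div_div_eq_mul_div _ _ _).symm
    _ ≤ filterBase (Δ / r) := Nat.le_ceil _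

theorem filterBase_le {r : ℝ} (hΔ : 0 < Δ) (hΔ' : Δ ≤ 2 * Real.pi) (hr : 0 ≤ r) (hr' : r ≤ 8) :
    (filterBase (Δ / r) : ℝ) ≤ 110 * Δ⁻¹ := by
  have hone : 1 ≤ 2 * Real.pi * Δ⁻¹ := by rwa [← div_eq_mul_inv, one_le_div hΔ]
  calc (filterBase (Δ / r) : ℝ) ≤ 4 * Real.pi / (Δ / r) + 1 :=
        (Nat.ceil_lt_add_one (by positivity)).le
    _ = 4 * Real.pi * r * Δ⁻¹ + 1 := by rw [div_div_eq_mul_div, div_eq_mul_inv]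
    _ ≤ 4 * Real.pi * 8 * Δ⁻¹ + 2 * Real.pi * Δ⁻¹ := by gcongr
    _ = 34 * Real.pi * Δ⁻¹ := by ring
    _ ≤ 34 * 3.15 * Δ⁻¹ := by gcongr; exact Real.pi_lt_d2.le
    _ ≤ 110 * Δ⁻¹ := by gcongr; norm_num

theorem thetaTilde_filterPower_mul_filterBase {r : ℝ} (hΔ : 0 < Δ) (hΔ' : Δ ≤ 2 * Real.pi)
    (hr : 1 ≤ r) (hr' : r ≤ 8) (hx : 1 ≤ x) (hq : 0 < q) (h : 2 / q ≤ 1600 * x ^ 2) :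
    ThetaTilde 1 1100 1 (1 + Real.log x) Δ⁻¹ (filterPower q * filterBase (Δ / r) : ℕ) := by
  have hΔinv : 0 < Δ⁻¹ := inv_pos.2 hΔ
  have hlogx : 0 ≤ Real.log x := Real.log_nonneg hx
  rw [Nat.cast_mul]
  constructor
  · exact mul_le_mul (one_le_filterPower q) (inv_le_filterBase hΔ hr) hΔinv.le (Nat.cast_nonneg _)
  · calc (filterPower q : ℝ) * filterBase (Δ / r)
        ≤ 10 * (1 + Real.log x) * (110 * Δ⁻¹) := by
          gcongr
          exacts [filterPower_le hx hq h, filterBase_le hΔ hΔ' (zero_le_one.trans hr) hr']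
      _ = 1100 * Δ⁻¹ * (1 + Real.log x) ^ 1 := by ring

/-- The degree of the eigenvalue filter of accuracy `q` for the gap `Δ`. -/
def filterDegree (Δ q : ℝ) : ℕ := filterPower q * filterBase (Δ / 4)

theorem thetaTilde_filterDegree (hΔ : 0 < Δ) (hΔ' : Δ ≤ 2 * Real.pi) (hp₀ : 0 < p₀)
    (hp₀' : p₀ ≤ 1) (hδ : 0 < δ) (hδ' : δ ≤ 1) :
    ThetaTilde 1 1100 1 (1 + Real.log (p₀⁻¹ * δ⁻¹)) Δ⁻¹
      (filterDegree Δ (p₀ * δ ^ 2 / 800)) := by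
  have hp₀inv : 1 ≤ p₀⁻¹ := (one_le_inv₀ hp₀).2 hp₀'
  have hδinv : 1 ≤ δ⁻¹ := (one_le_inv₀ hδ).2 hδ'
  refine thetaTilde_filterPower_mul_filterBase hΔ hΔ' (by norm_num) (by norm_num)
    (one_le_mul_of_one_le_of_one_le hp₀inv hδinv) (by positivity) ?_
  calc 2 / (p₀ * δ ^ 2 / 800) = 1600 * (p₀⁻¹ * δ⁻¹ ^ 2) := by field_simp; norm_num
    _ ≤ 1600 * (p₀⁻¹ ^ 2 * δ⁻¹ ^ 2) := by gcongr; exact le_self_pow₀ hp₀inv two_ne_zero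
    _ = 1600 * (p₀⁻¹ * δ⁻¹) ^ 2 := by rw [mul_pow]

theorem thetaTilde_roughDegree (hΔ : 0 < Δ) (hΔ' : Δ ≤ 2 * Real.pi) (hp₀ : 0 < p₀)
    (hp₀' : p₀ ≤ 1) :
    ThetaTilde 1 1100 1 (1 + Real.log p₀⁻¹) Δ⁻¹ (roughDegree Δ p₀) := by
  have hp₀inv : 1 ≤ p₀⁻¹ := (one_le_inv₀ hp₀).2 hp₀'
  refine thetaTilde_filterPower_mul_filterBase hΔ hΔ' (by norm_num) le_rfl hp₀inv
    (by positivity) ?_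
  calc 2 / (p₀ / 8) = 16 * p₀⁻¹ := by field_simp; norm_num
    _ ≤ 1600 * p₀⁻¹ ^ 2 := by gcongr; exacts [by norm_num, le_self_pow₀ hp₀inv two_ne_zero]

theorem harmonicMass_le_mul {d : ℕ} {l : ℝ} (hΔ : 0 < Δ) (hl : 1 ≤ l)
    (hlL : l + Real.log (1 + Δ⁻¹) ≤ L) (hd : (d : ℝ) ≤ 1100 * Δ⁻¹ * l) :
    harmonicMass d ≤ 18 * L := by
  have hΔinv : 0 < Δ⁻¹ := inv_pos.2 hΔ
  have hconst : Real.log (1101 : ℝ) ≤ (8 : ℕ) := log_le_natCast (by norm_num) (by norm_num)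
  have hdeg : (d : ℝ) + 1 ≤ 1101 * l * (1 + Δ⁻¹) := by
    have := mul_pos (zero_lt_one.trans_le hl) hΔinv
    linarith
  have hlog : Real.log (d + 1) ≤ 7 + l + Real.log (1 + Δ⁻¹) := by
    calc Real.log (d + 1) ≤ Real.log (1101 * l * (1 + Δ⁻¹)) :=
          Real.log_le_log (by positivity) hdeg
      _ = Real.log 1101 + Real.log l + Real.log (1 + Δ⁻¹) := by
        rw [Real.log_mul (by positivity) (by positivity),
          Real.log_mul (by norm_num) (by positivity)]
      _ ≤ 7 + l + Real.log (1 + Δ⁻¹) := by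
        have := Real.log_le_sub_one_of_pos (zero_lt_one.trans_le hl)
        push_cast at hconst
        linarith
  have hL : 1 ≤ L := by linarith [log_one_add_inv_nonneg hΔ]
  linarith [harmonicMass_le d]

theorem numLevels_le (hε : 0 < ε) (hε' : ε ≤ 1) :
    (numLevels ε : ℝ) ≤ 2 + 3 / 2 * Real.log ε⁻¹ := by
  have hlog : 0 ≤ Real.log ε⁻¹ := log_inv_nonneg hε hε'
  have hlogb : Real.logb 2 (1 / ε) ≤ 3 / 2 * Real.log ε⁻¹ := by
    rw [Real.logb, one_div, div_le_iff₀ (Real.log_pos one_lt_two)]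
    calc Real.log ε⁻¹ ≤ (3 / 2 * Real.log 2) * Real.log ε⁻¹ :=
          le_mul_of_one_le_left hlog (by linarith [Real.log_two_gt_d9])
      _ = 3 / 2 * Real.log ε⁻¹ * Real.log 2 := by ring
  have hceil : (⌈Real.logb 2 (1 / ε)⌉₊ : ℝ) < 3 / 2 * Real.log ε⁻¹ + 1 :=
    (Nat.cast_le.2 (Nat.ceil_mono hlogb)).trans_lt (Nat.ceil_lt_add_one (by positivity))
  rw [numLevels, Nat.cast_add_one]
  linarith

theorem numLevels_le_inv (hε : 0 < ε) (hε' : ε ≤ 1) : (numLevels ε : ℝ) ≤ 2 * ε⁻¹ := by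
  have hlog := Real.log_le_sub_one_of_pos (inv_pos.2 hε)
  have hinv := (one_le_inv₀ hε).2 hε'
  have hlevels := numLevels_le hε hε'
  linarith

/-- The number `N` of data points per level; it is even, so that the data points can be split
into pairs `n`, `n + N / 2`. -/
def numPoints (ζ δ : ℝ) : ℕ := 2 * ⌈2 * δ ^ (-(2 + ζ))⌉₊

theorem one_le_rpow_neg (hζ : 0 ≤ ζ) (hδ : 0 < δ) (hδ' : δ ≤ 1) : 1 ≤ δ ^ (-(2 + ζ)) :=
  Real.one_le_rpow_of_pos_of_le_one_of_nonpos hδ hδ' (by linarith)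

theorem thetaTilde_numPoints (hζ : 0 ≤ ζ) (hδ : 0 < δ) (hδ' : δ ≤ 1) (L : ℝ) :
    ThetaTilde 4 6 0 L (δ ^ (-(2 + ζ))) (numPoints ζ δ) := by
  have hlower := Nat.le_ceil (2 * δ ^ (-(2 + ζ)))
  have hupper := natCast_ceil_mul_le zero_le_two (one_le_rpow_neg hζ hδ hδ')
  rw [numPoints, Nat.cast_mul, Nat.cast_ofNat, ThetaTilde, pow_zero, mul_one]
  constructor <;> linarith

theorem four_le_numPoints (hζ : 0 ≤ ζ) (hδ : 0 < δ) (hδ' : δ ≤ 1) : 4 ≤ numPoints ζ δ := by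
  have h : (4 : ℝ) ≤ numPoints ζ δ := by
    linarith [(thetaTilde_numPoints hζ hδ hδ' 1).1, one_le_rpow_neg hζ hδ hδ']
  exact_mod_cast h

theorem one_le_numPoints_mul_sq (hζ : 0 ≤ ζ) (hδ : 0 < δ) (hδ' : δ ≤ 1) :
    1 ≤ numPoints ζ δ * δ ^ 2 := by
  calc (1 : ℝ) ≤ δ ^ (-ζ) := Real.one_le_rpow_of_pos_of_le_one_of_nonpos hδ hδ' (by linarith)
    _ = δ ^ (-(2 + ζ)) * δ ^ 2 := by
      rw [← Real.rpow_natCast δ 2, ← Real.rpow_add hδ]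
      congr 1
      push_cast
      ring
    _ ≤ numPoints ζ δ * δ ^ 2 := by
      gcongr
      linarith [one_le_rpow_neg hζ hδ hδ', (thetaTilde_numPoints hζ hδ hδ' 1).1]

/-- The number of independent samples, `K L³ / p₀²` rounded up. -/
def sampleCount (K L p₀ : ℝ) : ℕ := ⌈K * L ^ 3 * (p₀ ^ 2)⁻¹⌉₊

theorem le_sampleCount_mul_sq (hp₀ : 0 < p₀) : K * L ^ 3 ≤ sampleCount K L p₀ * p₀ ^ 2 := by
  rw [← div_le_iff₀ (pow_pos hp₀ 2), div_eq_mul_inv]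
  exact Nat.le_ceil _

theorem thetaTilde_sampleCount (hK : 0 ≤ K) (hL : 1 ≤ L) (hp₀ : 0 < p₀) (hp₀' : p₀ ≤ 1) :
    ThetaTilde K (K + 1) 3 L (p₀ ^ 2)⁻¹ (sampleCount K L p₀) := by
  have hP : 1 ≤ (p₀ ^ 2)⁻¹ := (one_le_inv₀ (by positivity)).2 (pow_le_one₀ hp₀.le hp₀')
  have hL3 : 1 ≤ L ^ 3 := one_le_pow₀ hL
  constructor
  · calc K * (p₀ ^ 2)⁻¹ ≤ K * L ^ 3 * (p₀ ^ 2)⁻¹ := by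
          gcongr
          exact le_mul_of_one_le_right hK hL3
      _ ≤ sampleCount K L p₀ := Nat.le_ceil _
  · rw [sampleCount, mul_assoc]
    calc (⌈K * (L ^ 3 * (p₀ ^ 2)⁻¹)⌉₊ : ℝ) ≤ (K + 1) * (L ^ 3 * (p₀ ^ 2)⁻¹) :=
          natCast_ceil_mul_le hK (one_le_mul_of_one_le_of_one_le hL3 hP)
      _ = (K + 1) * (p₀ ^ 2)⁻¹ * L ^ 3 := by ring

theorem two_hundred_eighty_eight_mul_exp_neg_six_le : 288 * Real.exp (-6) ≤ 1 := by
  have hexp : (288 : ℝ) ≤ Real.exp 6 := by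
    have h := pow_le_exp_natCast 6
    push_cast at h
    linarith
  rw [Real.exp_neg, ← div_eq_mul_inv]
  exact (div_le_one (Real.exp_pos 6)).2 hexp

theorem failure_le (hζ : 0 ≤ ζ) (hδ : 0 < δ) (hδ' : δ ≤ 1) (hη : 0 < η) (hη' : η ≤ 1)
    (hε : 0 < ε) (hε' : ε ≤ 1)
    (hL : 1 + Real.log δ⁻¹ + Real.log η⁻¹ + Real.log ε⁻¹ ≤ L) :
    12 * numLevels ε * numPoints ζ δ * Real.exp (-((7 + ζ) * L)) ≤ η / 2 := by
  have hlogδ := log_inv_nonneg hδ hδ'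
  have hlogη := log_inv_nonneg hη hη'
  have hlogε := log_inv_nonneg hε hε'
  have hnum := (thetaTilde_numPoints hζ hδ hδ' 1).2
  rw [pow_zero, mul_one] at hnum
  have hexp : Real.exp (-((7 + ζ) * L)) ≤ Real.exp (-6) * (ε * δ ^ (2 + ζ) * η) := by
    have hexponent : -((7 + ζ) * L)
        ≤ -6 + (Real.log ε + Real.log δ * (2 + ζ) + Real.log η) := by
      have hζL := mul_le_mul_of_nonneg_left hL (by linarith : 0 ≤ 7 + ζ)
      have hζη := mul_nonneg hζ hlogη
      have hζε := mul_nonneg hζ hlogε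
      simp only [Real.log_inv] at hlogδ hlogη hlogε hζL hζη hζε
      linarith
    calc Real.exp (-((7 + ζ) * L)) ≤ _ := Real.exp_le_exp.2 hexponent
      _ = Real.exp (-6) * (ε * δ ^ (2 + ζ) * η) := by
        rw [Real.exp_add, Real.exp_add, Real.exp_add, Real.exp_log hε, Real.exp_log hη,
          Real.rpow_def_of_pos hδ]
  calc 12 * numLevels ε * numPoints ζ δ * Real.exp (-((7 + ζ) * L))
      ≤ 12 * (2 * ε⁻¹) * (6 * δ ^ (-(2 + ζ))) * (Real.exp (-6) * (ε * δ ^ (2 + ζ) * η)) := by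
        gcongr
        exact numLevels_le_inv hε hε'
    _ = 288 * Real.exp (-6) * (η / 2) := by
      have hδζ : δ ^ (2 + ζ) ≠ 0 := (Real.rpow_pos_of_pos hδ _).ne'
      rw [Real.rpow_neg hδ.le]
      field_simp
      norm_num
    _ ≤ η / 2 := mul_le_of_le_one_left (by positivity) two_hundred_eighty_eight_mul_exp_neg_six_le

theorem rough_failure_le (hΔ : 0 < Δ) (hη : 0 < η) (hη' : η ≤ 1)
    (hL : 1 + Real.log η⁻¹ + Real.log (1 + Δ⁻¹) ≤ L) :
    (16 * Real.pi / Δ + 1) * (2 * Real.exp (-(7 * L))) ≤ η / 2 := by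
  have hΔinv : 0 < Δ⁻¹ := inv_pos.2 hΔ
  have hgrid : 16 * Real.pi / Δ + 1 ≤ 51 * (1 + Δ⁻¹) := by
    rw [div_eq_mul_inv]
    nlinarith [Real.pi_lt_d2]
  have hexp : Real.exp (-(7 * L)) ≤ Real.exp (-6) * (η * (1 + Δ⁻¹)⁻¹) := by
    have hexponent : -(7 * L) ≤ -6 + (Real.log η + -Real.log (1 + Δ⁻¹)) := by
      have hlogη := log_inv_nonneg hη hη'
      have hlogΔ := log_one_add_inv_nonneg hΔ
      rw [Real.log_inv] at hlogη hL
      linarith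
    calc Real.exp (-(7 * L)) ≤ _ := Real.exp_le_exp.2 hexponent
      _ = Real.exp (-6) * (η * (1 + Δ⁻¹)⁻¹) := by
        rw [Real.exp_add, Real.exp_add, Real.exp_log hη, Real.exp_neg (Real.log _),
          Real.exp_log (by positivity)]
  calc (16 * Real.pi / Δ + 1) * (2 * Real.exp (-(7 * L)))
      ≤ 51 * (1 + Δ⁻¹) * (2 * (Real.exp (-6) * (η * (1 + Δ⁻¹)⁻¹))) := by gcongr
    _ = 204 * Real.exp (-6) * (η / 2) := by field_simp; norm_num
    _ ≤ 288 * Real.exp (-6) * (η / 2) := by gcongr; norm_num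
    _ ≤ η / 2 := mul_le_of_le_one_left (by positivity) two_hundred_eighty_eight_mul_exp_neg_six_le

end Parameters

section Cost

variable {δ ε : ℝ} {N : ℕ} [NeZero N]

theorem sub_one_mul_timeStep_last (δ ε : ℝ) :
    ((N : ℝ) - 1) * timeStep δ ε N (numLevels ε - 1) = (1 - 1 / (N : ℝ)) * (δ / ε) := by
  have hN : (N : ℝ) ≠ 0 := NeZero.ne _
  rw [← mul_timeStep_last (N := N) δ ε]
  field_simp

theorem natCast_mul_timeStep_nonneg (hδ : 0 < δ) (hε : 0 < ε) (j n : ℕ) :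
    0 ≤ n * timeStep δ ε N j :=
  mul_nonneg (Nat.cast_nonneg n) (timeStep_pos hδ hε j).le

theorem natCast_mul_timeStep_le (hδ : 0 < δ) (hε : 0 < ε) (j : Fin (numLevels ε)) (n : Fin N) :
    (n : ℕ) * timeStep δ ε N j ≤ (1 - 1 / (N : ℝ)) * (δ / ε) := by
  have hmono : Monotone (timeStep δ ε N) := monotone_nat_of_le_succ fun i => by
    rw [timeStep_succ]
    linarith [timeStep_pos (N := N) hδ hε i]
  have hn : ((n : ℕ) : ℝ) ≤ N - 1 := le_sub_iff_add_le.2 (by exact_mod_cast n.2)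
  rw [← sub_one_mul_timeStep_last]
  exact mul_le_mul hn (hmono (Nat.le_sub_one_of_lt j.2)) (timeStep_pos hδ hε j).le
    ((Nat.cast_nonneg _).trans hn)

theorem natCast_mul_timeStep_le_div (hδ : 0 < δ) (hε : 0 < ε) (j : Fin (numLevels ε))
    (n : Fin N) : (n : ℕ) * timeStep δ ε N j ≤ δ / ε :=
  (natCast_mul_timeStep_le hδ hε j n).trans
    (mul_le_of_le_one_left (by positivity) (sub_le_self 1 (by positivity)))

theorem numLevels_sub_one_lt (ε : ℝ) : numLevels ε - 1 < numLevels ε :=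
  Nat.sub_one_lt (Nat.succ_ne_zero _)

theorem lossMaxTime_eq (d : ℕ) (hδ : 0 < δ) (hε : 0 < ε) :
    lossMaxTime (numLevels ε) N d (timeStep δ ε N) = d + (1 - 1 / (N : ℝ)) * (δ / ε) := by
  have hN : 0 < N := NeZero.pos N
  let lastRun : Fin (numLevels ε) × Fin N × Fin (2 * d + 1) :=
    (⟨numLevels ε - 1, numLevels_sub_one_lt ε⟩, ⟨N - 1, Nat.sub_one_lt hN.ne'⟩, Fin.last (2 * d))
  have : Nonempty (Fin (numLevels ε) × Fin N × Fin (2 * d + 1)) := ⟨lastRun⟩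
  refine le_antisymm (ciSup_le fun i => ?_) ?_
  · refine (abs_add_le _ _).trans (add_le_add (abs_shift_le _) ?_)
    rw [abs_of_nonneg (natCast_mul_timeStep_nonneg hδ hε _ _)]
    exact natCast_mul_timeStep_le hδ hε _ _
  · refine le_trans (le_of_eq ?_) (le_ciSup (Set.finite_range _).bddAbove lastRun)
    have htime := natCast_mul_timeStep_nonneg (N := N) hδ hε (numLevels ε - 1) (N - 1)
    simp only [lastRun, shift_last, Int.cast_natCast]
    rw [abs_of_nonneg (add_nonneg (Nat.cast_nonneg d) htime), Nat.cast_pred hN,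
      sub_one_mul_timeStep_last]

theorem lossTotalTime_eq (Ns d : ℕ) (hδ : 0 < δ) (hε : 0 < ε) :
    lossTotalTime (numLevels ε) N Ns d (timeStep δ ε N)
      = ∑ j : Fin (numLevels ε), ∑ n : Fin N,
          2 * (Ns : ℝ) * (d + (n : ℕ) * timeStep δ ε N j) :=
  Finset.sum_congr rfl fun j _ => Finset.sum_congr rfl fun n _ => by
    rw [iSup_abs_shift_add d (natCast_mul_timeStep_nonneg hδ hε _ _)]

theorem lossTotalTime_le (Ns d : ℕ) (hδ : 0 < δ) (hε : 0 < ε) :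
    lossTotalTime (numLevels ε) N Ns d (timeStep δ ε N)
      ≤ numLevels ε * (N * (2 * Ns * (d + δ / ε))) := by
  rw [lossTotalTime_eq Ns d hδ hε]
  calc _ ≤ ∑ _j : Fin (numLevels ε), ∑ _n : Fin N, 2 * (Ns : ℝ) * (d + δ / ε) := by
        gcongr with j _ n _
        exact natCast_mul_timeStep_le_div hδ hε j n
    _ = numLevels ε * (N * (2 * Ns * (d + δ / ε))) := by
      simp only [Finset.sum_const, Finset.card_univ, Fintype.card_fin, nsmul_eq_mul]

theorem sum_fin_natCast_mul_two (N : ℕ) [NeZero N] :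
    (∑ n : Fin N, ((n : ℕ) : ℝ)) * 2 = N * (N - 1) := by
  rw [Fin.sum_univ_eq_sum_range (fun n => (n : ℝ)) N, ← Nat.cast_pred (NeZero.pos N)]
  have hsum : (((∑ n ∈ Finset.range N, n) * 2 : ℕ) : ℝ) = (N * (N - 1) : ℕ) :=
    congrArg _ (Finset.sum_range_id_mul_two N)
  push_cast at hsum
  exact hsum

theorem sum_fin_mul_add_natCast_mul (a b t : ℝ) :
    ∑ n : Fin N, a * (b + (n : ℕ) * t) = a * (N * b + N * (N - 1) / 2 * t) := by
  rw [← sum_fin_natCast_mul_two N, ← Finset.mul_sum, Finset.sum_add_distrib, ← Finset.sum_mul]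
  simp only [Finset.sum_const, Finset.card_univ, Fintype.card_fin, nsmul_eq_mul]
  ring

theorem le_lossTotalTime (Ns d : ℕ) (hδ : 0 < δ) (hε : 0 < ε) (hN : 2 ≤ N) :
    1 / 2 * (N * Ns * (d + δ / ε)) ≤ lossTotalTime (numLevels ε) N Ns d (timeStep δ ε N) := by
  have hhalf : 1 / 2 * (δ / ε) ≤ (1 - 1 / (N : ℝ)) * (δ / ε) := by
    have hinv : 1 / (N : ℝ) ≤ 1 / 2 :=
      one_div_le_one_div_of_le two_pos (by exact_mod_cast hN)
    gcongr
    linarith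
  let lastLevel : Fin (numLevels ε) := ⟨numLevels ε - 1, numLevels_sub_one_lt ε⟩
  calc 1 / 2 * (N * Ns * (d + δ / ε)) = N * Ns * (1 / 2 * d + 1 / 2 * (δ / ε)) := by ring
    _ ≤ N * Ns * (2 * d + (1 - 1 / (N : ℝ)) * (δ / ε)) := by
      gcongr
      norm_num
    _ = ∑ n : Fin N, 2 * (Ns : ℝ) * (d + (n : ℕ) * timeStep δ ε N lastLevel) := by
      rw [sum_fin_mul_add_natCast_mul, ← sub_one_mul_timeStep_last]
      ring
    _ ≤ ∑ j : Fin (numLevels ε), ∑ n : Fin N,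
          2 * (Ns : ℝ) * (d + (n : ℕ) * timeStep δ ε N j) := by
      refine Finset.single_le_sum
        (f := fun j : Fin (numLevels ε) =>
          ∑ n : Fin N, 2 * (Ns : ℝ) * (d + (n : ℕ) * timeStep δ ε N j))
        (fun j _ => Finset.sum_nonneg fun n _ => ?_) (Finset.mem_univ lastLevel)
      exact mul_nonneg (by positivity)
        (add_nonneg (Nat.cast_nonneg d) (natCast_mul_timeStep_nonneg hδ hε j n))
    _ = lossTotalTime (numLevels ε) N Ns d (timeStep δ ε N) := (lossTotalTime_eq Ns d hδ hε).symm

theorem thetaTilde_lossTotalTime (Ns d : ℕ) (hδ : 0 < δ) (hε : 0 < ε) (hε' : ε ≤ 1)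
    (hN : 2 ≤ N) {L : ℝ} (hL : 1 + Real.log ε⁻¹ ≤ L) :
    ThetaTilde (1 / 2) 4 1 L (N * Ns * (d + δ / ε))
      (lossTotalTime (numLevels ε) N Ns d (timeStep δ ε N)) := by
  refine ⟨le_lossTotalTime Ns d hδ hε hN, (lossTotalTime_le Ns d hδ hε).trans ?_⟩
  have hlevels : (numLevels ε : ℝ) ≤ 2 * L := by
    linarith [numLevels_le hε hε', log_inv_nonneg hε hε']
  calc numLevels ε * (N * (2 * Ns * (d + δ / ε)))
      ≤ 2 * L * (N * (2 * Ns * (d + δ / ε))) := by gcongr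
    _ = 4 * (N * Ns * (d + δ / ε)) * L ^ 1 := by ring

end Cost

section TwoStages

section Product

variable {Ω Ω' : Type} [Fintype Ω] [Fintype Ω'] {w : Ω → ℝ} {w' : Ω → Ω' → ℝ} {E : Ω → Prop}
  {E' : Ω → Ω' → Prop}

theorem prob_mul_and : prob (fun ω : Ω × Ω' => w ω.1 * w' ω.1 ω.2) (fun ω => E ω.1 ∧ E' ω.1 ω.2)
    = ∑ ω, Set.indicator {ω | E ω} w ω * prob (w' ω) (E' ω) := by
  rw [prob, Fintype.sum_prod_type]
  refine Finset.sum_congr rfl fun ω _ => ?_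
  rw [prob, Finset.mul_sum]
  refine Finset.sum_congr rfl fun ω' _ => ?_
  by_cases hE : E ω <;> by_cases hE' : E' ω ω' <;> simp [hE, hE']

theorem one_sub_add_le_prob_and (hw : ∀ ω, 0 ≤ w ω) {a b : ℝ} (ha : 0 ≤ a) (hb : 0 ≤ b)
    (hb' : b ≤ 1) (hE : 1 - a ≤ prob w E) (hE' : ∀ ω, E ω → 1 - b ≤ prob (w' ω) (E' ω)) :
    1 - (a + b) ≤ prob (fun ω : Ω × Ω' => w ω.1 * w' ω.1 ω.2)
      (fun ω => E ω.1 ∧ E' ω.1 ω.2) := by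
  rw [prob_mul_and]
  calc 1 - (a + b) ≤ (1 - a) * (1 - b) := by linarith [mul_nonneg ha hb]
    _ ≤ prob w E * (1 - b) := mul_le_mul_of_nonneg_right hE (sub_nonneg.2 hb')
    _ ≤ ∑ ω, Set.indicator {ω | E ω} w ω * prob (w' ω) (E' ω) := by
      rw [prob, Finset.sum_mul]
      refine Finset.sum_le_sum fun ω _ => ?_
      by_cases h : E ω
      · exact mul_le_mul_of_nonneg_left (hE' ω h) (Set.indicator_nonneg (fun ω _ => hw ω) ω)
      · simp [h]

end Product

/-- The Fourier coefficients `F̂_l` of the eigenvalue filter: the step filter of accuracy `q` whose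
jump, of width `Δ / 4` on either side, is centred between the intervals `I` and `I'`. -/
def eigenvalueFilter (Δ q lamPrior : ℝ) : Fin (2 * filterDegree Δ q + 1) → ℂ :=
  stepFilter (filterPower q) (filterBase (Δ / 4)) (lamPrior + Δ / 2)

variable {M : ℕ} {H : Matrix (Fin M) (Fin M) ℂ} {ψ : Sys M} {lam p : Fin M → ℝ} {m₀ : Fin M}
  {ζ Δ p₀ δ η ε q lamPrior L : ℝ} {n Ns : ℕ}

theorem isFilter_eigenvalueFilter (hΔ : 0 < Δ) (hq : 0 < q)
    (hprior : lamPrior ∈ Set.Icc (-Real.pi) (Real.pi - Δ)) :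
    IsFilter (eigenvalueFilter Δ q lamPrior) q lamPrior Δ := by
  obtain ⟨hlower, hupper⟩ := hprior
  refine ⟨fun x hx => ?_, fun x hx => ?_⟩
  · exact norm_trigPoly_stepFilter_sub_one_le (by positivity) hq (by linarith)
      (by linarith [hx.1.1]) (by linarith [hx.2.2])
  · have hx' : lamPrior + 3 * Δ / 4 < x := by
      by_contra! h
      exact hx.2 ⟨by linarith [hx.1.1], h⟩
    exact norm_trigPoly_stepFilter_le (by positivity) hq (by linarith)
      (by linarith) (by linarith [hx.1.2])

theorem add_half_gap_mem_Ioc [Nontrivial (Fin M)] (hΔ : 0 < Δ)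
    (hlam : ∀ m, lam m ∈ spectralRange Δ) (hgap : ∀ m ≠ m₀, Δ ≤ lam m - lam m₀)
    (hprior : |lamPrior - lam m₀| ≤ Δ / 4) :
    lamPrior + Δ / 2 ∈ Set.Ioc (-Real.pi) Real.pi := by
  obtain ⟨m, hm⟩ := exists_ne m₀
  obtain ⟨hlower, hupper⟩ := abs_le.1 hprior
  constructor <;> linarith [hgap m hm, (hlam m).2, (hlam m₀).1]

theorem isolates_eigenvalueFilter [Nontrivial (Fin M)] (hΔ : 0 < Δ) (hq : 0 < q)
    (hlam : ∀ m, lam m ∈ spectralRange Δ) (hgap : ∀ m ≠ m₀, Δ ≤ lam m - lam m₀)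
    (hprior : |lamPrior - lam m₀| ≤ Δ / 4) :
    Isolates (eigenvalueFilter Δ q lamPrior) lam m₀ q := by
  have hcut := add_half_gap_mem_Ioc hΔ hlam hgap hprior
  obtain ⟨hlower, hupper⟩ := abs_le.1 hprior
  refine ⟨?_, fun m hm => ?_⟩
  · exact norm_trigPoly_stepFilter_sub_one_le (by positivity) hq hcut.2 (by linarith [(hlam m₀).1])
      (by linarith)
  · exact norm_trigPoly_stepFilter_le (by positivity) hq hcut.1.le (by linarith [hgap m hm])
      (hlam m).2

theorem one_sub_half_le_prob_succeeds [Nontrivial (Fin M)] (hg : Measures H ψ (signal p lam))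
    (hp : p ∈ stdSimplex ℝ (Fin M)) (hp₀ : 0 < p₀) (hpm : p₀ ≤ p m₀)
    (hlam : ∀ m, lam m ∈ spectralRange Δ) (hgap : ∀ m ≠ m₀, Δ ≤ lam m - lam m₀)
    (hζ : 0 ≤ ζ) (hΔ : 0 < Δ) (hΔ' : Δ ≤ 2 * Real.pi) (hδ : 0 < δ) (hδ' : δ ≤ 1)
    (hη : 0 < η) (hη' : η ≤ 1) (hε : 0 < ε) (hε' : ε ≤ 1)
    (hL : logFactor Δ (p₀⁻¹ * δ⁻¹ * η⁻¹ * ε⁻¹) ≤ L)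
    (hNs : 81920000 * 18 ^ 2 * (7 + ζ) * L ^ 3 ≤ Ns * p₀ ^ 2)
    (hprior : |lamPrior - lam m₀| ≤ Δ / 4) :
    1 - η / 2 ≤ prob
      (filteredDataProb H ψ (timeStep δ ε (numPoints ζ δ))
        (eigenvalueFilter Δ (p₀ * δ ^ 2 / 800) lamPrior) :
          FilteredData (numLevels ε) (numPoints ζ δ) Ns _ → ℝ)
      (fun ω => Succeeds (timeStep δ ε (numPoints ζ δ))
        (dataPoint (eigenvalueFilter Δ (p₀ * δ ^ 2 / 800) lamPrior) ω) ε (lam m₀)) := by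
  have hp₀' : p₀ ≤ 1 := hpm.trans (mem_Icc_of_mem_stdSimplex hp m₀).2
  have hlogp₀ := log_inv_nonneg hp₀ hp₀'
  have hlogδ := log_inv_nonneg hδ hδ'
  have hlogη := log_inv_nonneg hη hη'
  have hlogε := log_inv_nonneg hε hε'
  have hlogΔ := log_one_add_inv_nonneg hΔ
  rw [logFactor, Real.log_mul (by positivity) (by positivity),
    Real.log_mul (by positivity) (by positivity), log_inv_mul_inv hp₀ hδ] at hL
  have hL₁ : 1 ≤ L := by linarith
  have hcut := add_half_gap_mem_Ioc hΔ hlam hgap hprior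
  have hmass : filterMass (eigenvalueFilter Δ (p₀ * δ ^ 2 / 800) lamPrior) ≤ 18 * L := by
    have hdegree := (thetaTilde_filterDegree hΔ hΔ' hp₀ hp₀' hδ hδ').2
    rw [pow_one, log_inv_mul_inv hp₀ hδ] at hdegree
    exact (filterMass_stepFilter_le (Set.Ioc_subset_Icc_self hcut)).trans
      (harmonicMass_le_mul hΔ (by linarith) (by linarith) hdegree)
  have hNs₀ : 0 < Ns := by
    have hpos : (0 : ℝ) < Ns * p₀ ^ 2 := lt_of_lt_of_le (by positivity) hNs
    exact_mod_cast pos_of_mul_pos_left hpos (by positivity)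
  refine le_trans (sub_le_sub_left (failure_le hζ hδ hδ' hη hη' hε hε' (L := L) (by linarith)) 1) ?_
  refine (isolates_eigenvalueFilter hΔ (by positivity) hlam hgap hprior).one_sub_le_prob_succeeds
    hg hp (hp₀.trans_le hpm) ⟨by linarith [(hlam m₀).1], by linarith [(hlam m₀).2]⟩
    (filterMass_stepFilter_pos hcut.1) hmass (four_le_numPoints hζ hδ hδ') (even_two_mul _) hNs₀
    hδ hδ' hε (one_le_numPoints_mul_sq hζ hδ hδ') (by gcongr) ?_
  calc 81920000 * (18 * L) ^ 2 * ((7 + ζ) * L)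
      = 81920000 * 18 ^ 2 * (7 + ζ) * L ^ 3 := by ring
    _ ≤ Ns * p₀ ^ 2 := hNs
    _ ≤ Ns * p m₀ ^ 2 := by gcongr

theorem one_sub_half_le_prob_abs_estimate_sub_le (hg : Measures H ψ (signal p lam))
    (hp : p ∈ stdSimplex ℝ (Fin M)) (hp₀ : 0 < p₀) (hpm : p₀ ≤ p m₀)
    (hmin : ∀ m, lam m₀ ≤ lam m) (hlam : ∀ m, lam m ∈ spectralRange Δ)
    (hΔ : 0 < Δ) (hΔ' : Δ ≤ 2 * Real.pi) (hη : 0 < η) (hη' : η ≤ 1)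
    (hL : logFactor Δ (p₀⁻¹ * η⁻¹) ≤ L)
    (hn : 2048 * 18 ^ 2 * 7 * L ^ 3 ≤ n * p₀ ^ 2) :
    1 - η / 2 ≤ prob ((roughEstimator Δ p₀ n).dataProb H ψ)
      (fun ω => |(roughEstimator Δ p₀ n).estimate ω - lam m₀| ≤ Δ / 4) := by
  have hp₀' : p₀ ≤ 1 := hpm.trans (mem_Icc_of_mem_stdSimplex hp m₀).2
  have hlogp₀ := log_inv_nonneg hp₀ hp₀'
  have hlogη := log_inv_nonneg hη hη'
  have hlogΔ := log_one_add_inv_nonneg hΔ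
  rw [logFactor, log_inv_mul_inv hp₀ hη] at hL
  have hL₁ : 1 ≤ L := by linarith
  have hmass : harmonicMass (roughDegree Δ p₀) ≤ 18 * L := by
    have hdegree := (thetaTilde_roughDegree hΔ hΔ' hp₀ hp₀').2
    rw [pow_one] at hdegree
    exact harmonicMass_le_mul hΔ (by linarith) (by linarith) hdegree
  refine le_trans (sub_le_sub_left (rough_failure_le hΔ hη hη' (L := L) (by linarith)) 1) ?_
  refine one_sub_le_prob_abs_estimate_sub_le hg hp hp₀ hpm hΔ hmin hlam ?_
  calc 2048 * harmonicMass (roughDegree Δ p₀) ^ 2 * (7 * L)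
      ≤ 2048 * (18 * L) ^ 2 * (7 * L) := by
        gcongr
        exact (harmonicMass_pos _).le
    _ = 2048 * 18 ^ 2 * 7 * L ^ 3 := by ring
    _ ≤ n * p₀ ^ 2 := hn

end TwoStages

section TotalCost

/-- The constant `K` in the number `⌈K L³ / p₀²⌉` of samples per data point. -/
def sampleConstant (ζ : ℝ) : ℝ := 81920000 * 18 ^ 2 * (7 + ζ)

/-- The constant `K` in the number `⌈K L³ / p₀²⌉` of samples of the rough estimation. -/
def roughSampleConstant : ℝ := 2048 * 18 ^ 2 * 7

/-- `g = Θ̃(f)` with constants depending only on `ζ` that serve all the cost estimates of the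
algorithm simultaneously. -/
def UniformThetaTilde (ζ L f g : ℝ) : Prop :=
  ThetaTilde (1 / 800) (26400 * (sampleConstant ζ + 1)) 5 L f g

variable {ζ Δ p₀ δ ε c C L f g : ℝ} {k : ℕ}

theorem one_le_roughSampleConstant : 1 ≤ roughSampleConstant := by
  norm_num [roughSampleConstant]

theorem roughSampleConstant_add_four_le (hζ : 0 ≤ ζ) :
    roughSampleConstant + 4 ≤ sampleConstant ζ := by
  rw [roughSampleConstant, sampleConstant]
  linarith

theorem four_le_sampleConstant (hζ : 0 ≤ ζ) : 4 ≤ sampleConstant ζ := by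
  linarith [roughSampleConstant_add_four_le hζ, one_le_roughSampleConstant]

theorem ThetaTilde.uniform (h : ThetaTilde c C k L f g) (hf : 0 ≤ f) (hc : 1 / 800 ≤ c)
    (hC₀ : 0 ≤ C) (hC : C ≤ 26400 * (sampleConstant ζ + 1)) (hk : k ≤ 5) (hL : 1 ≤ L) :
    UniformThetaTilde ζ L f g :=
  h.mono hf hc hC₀ hC hk hL le_rfl

theorem uniformThetaTilde_filterDegree (hζ : 0 ≤ ζ) (hΔ : 0 < Δ) (hΔ' : Δ ≤ 2 * Real.pi)
    (hp₀ : 0 < p₀) (hp₀' : p₀ ≤ 1) (hδ : 0 < δ) (hδ' : δ ≤ 1) :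
    UniformThetaTilde ζ (1 + Real.log (p₀⁻¹ * δ⁻¹)) Δ⁻¹ (filterDegree Δ (p₀ * δ ^ 2 / 800)) :=
  (thetaTilde_filterDegree hΔ hΔ' hp₀ hp₀' hδ hδ').uniform (inv_pos.2 hΔ).le (by norm_num)
    (by norm_num) (by linarith [four_le_sampleConstant hζ]) (by norm_num)
    (one_le_one_add_log_inv_mul_inv hp₀ hp₀' hδ hδ')

theorem inv_sq_le_sampleCount (hζ : 0 ≤ ζ) (hp₀ : 0 < p₀) (hp₀' : p₀ ≤ 1) (hL : 1 ≤ L) :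
    (p₀ ^ 2)⁻¹ ≤ sampleCount (sampleConstant ζ) L p₀ := by
  have hK := four_le_sampleConstant hζ
  exact (le_mul_of_one_le_left (by positivity) (by linarith)).trans
    (thetaTilde_sampleCount (by linarith) hL hp₀ hp₀').1

theorem mul_inv_sq_le_sampleCount (hζ : 0 ≤ ζ) (hp₀ : 0 < p₀) (hp₀' : p₀ ≤ 1) (hL : 1 ≤ L) :
    1 / 800 * (p₀ ^ 2)⁻¹ ≤ sampleCount (sampleConstant ζ) L p₀ :=
  (mul_le_of_le_one_left (by positivity) (by norm_num)).trans
    (inv_sq_le_sampleCount hζ hp₀ hp₀' hL)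

theorem div_le_mul_sampleConstant_add_one (hζ : 0 ≤ ζ) {x : ℝ} (hx : 0 ≤ x) :
    x / 800 ≤ 26400 * (sampleConstant ζ + 1) * x := by
  rw [div_eq_inv_mul]
  exact mul_le_mul_of_nonneg_right (by linarith [four_le_sampleConstant hζ]) hx

theorem thetaTilde_numPoints_mul_sampleCount (hζ : 0 ≤ ζ) (hp₀ : 0 < p₀) (hp₀' : p₀ ≤ 1)
    (hδ : 0 < δ) (hδ' : δ ≤ 1) (hL : 1 ≤ L) :
    ThetaTilde 1 (6 * (sampleConstant ζ + 1)) 3 L ((p₀ ^ 2)⁻¹ * δ ^ (-(2 + ζ)))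
      (numPoints ζ δ * sampleCount (sampleConstant ζ) L p₀) := by
  have hK := four_le_sampleConstant hζ
  rw [mul_comm (numPoints ζ δ : ℝ)]
  exact ((thetaTilde_sampleCount (by linarith) hL hp₀ hp₀').mul (thetaTilde_numPoints hζ hδ hδ' L)
    (by linarith) (by norm_num) (by positivity) (by positivity)).mono (by positivity)
    (by linarith) (by linarith) (by linarith) le_rfl hL le_rfl

theorem uniformThetaTilde_numPoints_mul_sampleCount (hζ : 0 ≤ ζ) (hp₀ : 0 < p₀) (hp₀' : p₀ ≤ 1)
    (hδ : 0 < δ) (hδ' : δ ≤ 1) (hL : 1 ≤ L) :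
    UniformThetaTilde ζ L ((p₀ ^ 2)⁻¹ * δ ^ (-(2 + ζ)))
      (numPoints ζ δ * sampleCount (sampleConstant ζ) L p₀) := by
  have hK := four_le_sampleConstant hζ
  exact (thetaTilde_numPoints_mul_sampleCount hζ hp₀ hp₀' hδ hδ' hL).uniform (by positivity)
    (by norm_num) (by linarith) (by linarith) (by norm_num) hL

theorem uniformThetaTilde_min_numPoints_sampleCount (hζ : 0 ≤ ζ) (hp₀ : 0 < p₀) (hp₀' : p₀ ≤ 1)
    (hδ : 0 < δ) (hδ' : δ ≤ 1) (hL : 1 ≤ L) (h : (p₀ ^ 2)⁻¹ ≤ δ ^ (-(2 + ζ))) :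
    UniformThetaTilde ζ L (p₀ ^ 2)⁻¹
      (min (numPoints ζ δ) (sampleCount (sampleConstant ζ) L p₀) : ℕ) := by
  have hK := four_le_sampleConstant hζ
  have hsamples := thetaTilde_sampleCount (K := sampleConstant ζ) (by linarith) hL hp₀ hp₀'
  have hmin : ThetaTilde 1 (sampleConstant ζ + 1) 3 L (p₀ ^ 2)⁻¹
      (min (numPoints ζ δ) (sampleCount (sampleConstant ζ) L p₀) : ℕ) := by
    rw [Nat.cast_min, ThetaTilde, one_mul]
    refine ⟨le_min ?_ (inv_sq_le_sampleCount hζ hp₀ hp₀' hL), (min_le_right _ _).trans hsamples.2⟩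
    exact h.trans ((le_mul_of_one_le_left (by positivity) (by norm_num)).trans
      (thetaTilde_numPoints hζ hδ hδ' L).1)
  exact hmin.uniform (by positivity) (by norm_num) (by linarith) (by linarith) (by norm_num) hL

theorem thetaTilde_maxTime_roughEstimator (hΔ : 0 < Δ) (hΔ' : Δ ≤ 2 * Real.pi) (hp₀ : 0 < p₀)
    (hp₀' : p₀ ≤ 1) (hL : 1 + Real.log p₀⁻¹ ≤ L) (n : ℕ) :
    ThetaTilde 1 1100 1 L Δ⁻¹ (roughEstimator Δ p₀ n).maxTime := by
  rw [maxTime_roughEstimator]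
  exact (thetaTilde_roughDegree hΔ hΔ' hp₀ hp₀').mono (inv_pos.2 hΔ).le le_rfl (by norm_num)
    le_rfl le_rfl (by linarith [log_inv_nonneg hp₀ hp₀']) hL

theorem uniformThetaTilde_maxTime_roughEstimator (hζ : 0 ≤ ζ) (hΔ : 0 < Δ)
    (hΔ' : Δ ≤ 2 * Real.pi) (hp₀ : 0 < p₀) (hp₀' : p₀ ≤ 1) (hL : 1 + Real.log p₀⁻¹ ≤ L) (n : ℕ) :
    UniformThetaTilde ζ L Δ⁻¹ (roughEstimator Δ p₀ n).maxTime :=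
  (thetaTilde_maxTime_roughEstimator hΔ hΔ' hp₀ hp₀' hL n).uniform (inv_pos.2 hΔ).le
    (by norm_num) (by norm_num) (by linarith [four_le_sampleConstant hζ]) (by norm_num)
    (by linarith [log_inv_nonneg hp₀ hp₀'])

theorem uniformThetaTilde_totalTime_roughEstimator (hζ : 0 ≤ ζ) (hΔ : 0 < Δ)
    (hΔ' : Δ ≤ 2 * Real.pi) (hp₀ : 0 < p₀) (hp₀' : p₀ ≤ 1) (hL : 1 + Real.log p₀⁻¹ ≤ L) :
    UniformThetaTilde ζ L (Δ⁻¹ * (p₀ ^ 2)⁻¹)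
      (roughEstimator Δ p₀ (sampleCount roughSampleConstant L p₀)).totalTime := by
  have hK := roughSampleConstant_add_four_le hζ
  have hK₀ := one_le_roughSampleConstant
  have hL₁ : 1 ≤ L := by linarith [log_inv_nonneg hp₀ hp₀']
  rw [RoughEstimator.totalTime, mul_assoc, mul_comm Δ⁻¹]
  exact (((thetaTilde_sampleCount (by linarith) hL₁ hp₀ hp₀').mul
    (thetaTilde_maxTime_roughEstimator hΔ hΔ' hp₀ hp₀' hL _) (by linarith) (by norm_num)
    (by positivity) (by positivity)).const_mul zero_le_two).uniform (by positivity) (by linarith)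
    (by linarith) (by linarith) (by norm_num) hL₁

theorem uniformThetaTilde_lossTotalTime (hζ : 0 ≤ ζ) (hΔ : 0 < Δ) (hΔ' : Δ ≤ 2 * Real.pi)
    (hp₀ : 0 < p₀) (hp₀' : p₀ ≤ 1) (hδ : 0 < δ) (hδ' : δ ≤ 1) (hε : 0 < ε) (hε' : ε ≤ 1)
    (hL : 1 + Real.log (p₀⁻¹ * δ⁻¹) ≤ L) (hL' : 1 + Real.log ε⁻¹ ≤ L) :
    UniformThetaTilde ζ L ((p₀ ^ 2)⁻¹ * δ ^ (-(2 + ζ)) * (Δ⁻¹ + δ / ε))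
      (lossTotalTime (numLevels ε) (numPoints ζ δ) (sampleCount (sampleConstant ζ) L p₀)
        (filterDegree Δ (p₀ * δ ^ 2 / 800)) (timeStep δ ε (numPoints ζ δ))) := by
  have hK := four_le_sampleConstant hζ
  have hL₁ : 1 ≤ L := by linarith [log_inv_nonneg hε hε']
  have hN := four_le_numPoints hζ hδ hδ'
  have : NeZero (numPoints ζ δ) := ⟨by omega⟩
  have htime := ((thetaTilde_filterDegree hΔ hΔ' hp₀ hp₀' hδ hδ').mono (inv_pos.2 hΔ).le le_rfl
    (by norm_num) le_rfl le_rfl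
    (one_le_one_add_log_inv_mul_inv hp₀ hp₀' hδ hδ') hL).add_right
    (div_pos hδ hε).le le_rfl (by norm_num) hL₁
  exact (((thetaTilde_numPoints_mul_sampleCount hζ hp₀ hp₀' hδ hδ' hL₁).mul htime zero_le_one
    zero_le_one (by positivity) (by positivity)).trans
    (thetaTilde_lossTotalTime _ _ hδ hε hε' (by omega) hL') (by norm_num) (by norm_num)
    (by linarith)).uniform (by positivity) (by norm_num) (by linarith) (by linarith) le_rfl hL₁

end TotalCost

section Correctness

variable {M : ℕ} {H : Matrix (Fin M) (Fin M) ℂ} {ψ : Sys M} {lam p : Fin M → ℝ} {m₀ : Fin M}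
  {ζ Δ p₀ δ η ε : ℝ} {n Ns : ℕ}

theorem one_sub_le_prob_abs_estimate_sub_le_and_succeeds [Nontrivial (Fin M)]
    (hg : Measures H ψ (signal p lam)) (hp : p ∈ stdSimplex ℝ (Fin M)) (hp₀ : 0 < p₀)
    (hpm : p₀ ≤ p m₀) (hlam : ∀ m, lam m ∈ spectralRange Δ)
    (hgap : ∀ m ≠ m₀, Δ ≤ lam m - lam m₀) (hζ : 0 ≤ ζ) (hΔ : 0 < Δ) (hΔ' : Δ ≤ 2 * Real.pi)
    (hδ : 0 < δ) (hδ' : δ ≤ 1) (hη : 0 < η) (hη' : η ≤ 1) (hε : 0 < ε) (hε' : ε ≤ 1)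
    (hn : roughSampleConstant * logFactor Δ (p₀⁻¹ * η⁻¹) ^ 3 ≤ n * p₀ ^ 2)
    (hNs : sampleConstant ζ * logFactor Δ (p₀⁻¹ * δ⁻¹ * η⁻¹ * ε⁻¹) ^ 3
      ≤ Ns * p₀ ^ 2) :
    1 - η ≤ prob
      (fun ω : (roughEstimator Δ p₀ n).Data × FilteredData (numLevels ε) (numPoints ζ δ) Ns _ =>
        (roughEstimator Δ p₀ n).dataProb H ψ ω.1 *
          filteredDataProb H ψ (timeStep δ ε (numPoints ζ δ))
            (eigenvalueFilter Δ (p₀ * δ ^ 2 / 800) ((roughEstimator Δ p₀ n).estimate ω.1)) ω.2)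
      (fun ω => |(roughEstimator Δ p₀ n).estimate ω.1 - lam m₀| ≤ Δ / 4 ∧
        Succeeds (timeStep δ ε (numPoints ζ δ))
          (dataPoint (eigenvalueFilter Δ (p₀ * δ ^ 2 / 800)
            ((roughEstimator Δ p₀ n).estimate ω.1)) ω.2) ε (lam m₀)) := by
  have hmin : ∀ m, lam m₀ ≤ lam m := fun m => by
    rcases eq_or_ne m m₀ with rfl | hm
    · exact le_rfl
    · linarith [hgap m hm]
  have hrough := one_sub_half_le_prob_abs_estimate_sub_le hg hp hp₀ hpm hmin hlam hΔ hΔ' hη hη'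
    le_rfl hn
  have hsucceeds := fun {lamPrior : ℝ} => one_sub_half_le_prob_succeeds hg hp hp₀ hpm hlam hgap
    hζ hΔ hΔ' hδ hδ' hη hη' hε hε' le_rfl hNs (lamPrior := lamPrior)
  have hboth := one_sub_add_le_prob_and (dataProb_roughEstimator_mem_stdSimplex hg Δ p₀ n).1
    (half_pos hη).le (half_pos hη).le (by linarith) hrough fun _ hω => hsucceeds hω
  rwa [add_halves] at hboth

end Correctness

end QCELS

end

open QCELS in
theorem mainTheorem4_general (ζ : ℝ) (hζ : 0 ≤ ζ) :
    ∃ c C : ℝ, ∃ k : ℕ, 0 < c ∧ 0 < C ∧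
    ∀ Δ p₀ δ η ε : ℝ, 0 < Δ → Δ ≤ 2 * Real.pi → 0 < p₀ → p₀ ≤ 1 → 0 < δ → δ ≤ 1 →
      0 < η → η ≤ 1 → 0 < ε → ε ≤ 1 →
    ∃ (A : RoughEstimator) (d N Ns : ℕ) (q : ℝ) (F : ℝ → Fin (2 * d + 1) → ℂ),
      ThetaTilde c C k (1 + Real.log (p₀⁻¹ * δ⁻¹)) Δ⁻¹ d ∧
      c * (p₀ * δ ^ 2) ≤ q ∧ q ≤ C * (p₀ * δ ^ 2) ∧
      2 ≤ N ∧ c * (p₀ ^ 2)⁻¹ ≤ Ns ∧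
      ThetaTilde c C k (1 + Real.log (p₀⁻¹ * δ⁻¹ * η⁻¹ * ε⁻¹) + Real.log (1 + Δ⁻¹))
        ((p₀ ^ 2)⁻¹ * δ ^ (-(2 + ζ))) (N * Ns) ∧
      ((p₀ ^ 2)⁻¹ ≤ δ ^ (-(2 + ζ)) →
        ThetaTilde c C k (1 + Real.log (p₀⁻¹ * δ⁻¹ * η⁻¹ * ε⁻¹) + Real.log (1 + Δ⁻¹))
          (p₀ ^ 2)⁻¹ (min N Ns : ℕ)) ∧
      (∀ lamPrior ∈ Set.Icc (-Real.pi) (Real.pi - Δ),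
        IsFilter (F lamPrior) q lamPrior Δ) ∧
      ThetaTilde c C k (1 + Real.log (p₀⁻¹ * η⁻¹) + Real.log (1 + Δ⁻¹))
        Δ⁻¹ A.maxTime ∧
      ThetaTilde c C k (1 + Real.log (p₀⁻¹ * η⁻¹) + Real.log (1 + Δ⁻¹))
        (Δ⁻¹ * (p₀ ^ 2)⁻¹) A.totalTime ∧
      lossMaxTime (numLevels ε) N d (timeStep δ ε N)
        = d + (1 - 1 / (N : ℝ)) * (δ / ε) ∧
      ThetaTilde c C k (1 + Real.log (p₀⁻¹ * δ⁻¹ * η⁻¹ * ε⁻¹) + Real.log (1 + Δ⁻¹))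
        ((p₀ ^ 2)⁻¹ * δ ^ (-(2 + ζ)) * (Δ⁻¹ + δ / ε))
        (lossTotalTime (numLevels ε) N Ns d (timeStep δ ε N)) ∧
      ∀ (M : ℕ) (H : Matrix (Fin (M + 2)) (Fin (M + 2)) ℂ) (lam : Fin (M + 2) → ℝ)
        (v : OrthonormalBasis (Fin (M + 2)) ℂ (Sys (M + 2))) (ψ : Sys (M + 2))
        (m₀ : Fin (M + 2)),
        (∀ m, Matrix.toEuclideanLin H (v m) = (lam m : ℂ) • v m) →
        (∀ m, lam m ∈ spectralRange Δ) → (∀ m ≠ m₀, Δ ≤ lam m - lam m₀) →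
        ‖ψ‖ = 1 → p₀ ≤ ‖inner ℂ (v m₀) ψ‖ ^ 2 →
        1 - η ≤ prob
          (fun ω : A.Data × FilteredData (numLevels ε) N Ns d =>
            A.dataProb H ψ ω.1 *
              filteredDataProb H ψ (timeStep δ ε N) (F (A.estimate ω.1)) ω.2)
          (fun ω => |A.estimate ω.1 - lam m₀| ≤ Δ / 4 ∧
            Succeeds (timeStep δ ε N)
              (dataPoint (F (A.estimate ω.1)) ω.2) ε (lam m₀)) ∧
        ∀ lamPrior : ℝ, |lamPrior - lam m₀| ≤ Δ / 4 →
          1 - η ≤ prob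
            (fun ω : FilteredData (numLevels ε) N Ns d =>
              filteredDataProb H ψ (timeStep δ ε N) (F lamPrior) ω)
            (fun ω => Succeeds (timeStep δ ε N)
              (dataPoint (F lamPrior) ω) ε (lam m₀)) := by
  refine ⟨1 / 800, 26400 * (sampleConstant ζ + 1), 5, by norm_num,
    by linarith [four_le_sampleConstant hζ], ?_⟩
  intro Δ p₀ δ η ε hΔ hΔ' hp₀ hp₀' hδ hδ' hη hη' hε hε'
  have hL₁ := one_add_log_le_logFactor_mul_right hΔ (inv_pos.2 hp₀) ((one_le_inv₀ hη).2 hη')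
  have hL₂ := one_add_log_inv_mul_inv_le_logFactor hΔ hp₀ hδ hη hη' hε hε'
  have hL₂' := one_add_log_inv_le_logFactor hΔ hp₀ hp₀' hδ hδ' hη hη' hε
  have hL := (one_le_one_add_log_inv_mul_inv hp₀ hp₀' hδ hδ').trans hL₂
  have hN := four_le_numPoints hζ hδ hδ'
  have : NeZero (numPoints ζ δ) := ⟨by omega⟩
  refine ⟨roughEstimator Δ p₀ (sampleCount roughSampleConstant (logFactor Δ (p₀⁻¹ * η⁻¹)) p₀),
    filterDegree Δ (p₀ * δ ^ 2 / 800), numPoints ζ δ, sampleCount (sampleConstant ζ) _ p₀,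
    p₀ * δ ^ 2 / 800, eigenvalueFilter Δ (p₀ * δ ^ 2 / 800),
    uniformThetaTilde_filterDegree hζ hΔ hΔ' hp₀ hp₀' hδ hδ', by linarith,
    div_le_mul_sampleConstant_add_one hζ (by positivity), by omega,
    mul_inv_sq_le_sampleCount hζ hp₀ hp₀' hL,
    uniformThetaTilde_numPoints_mul_sampleCount hζ hp₀ hp₀' hδ hδ' hL,
    uniformThetaTilde_min_numPoints_sampleCount hζ hp₀ hp₀' hδ hδ' hL,
    fun _ => isFilter_eigenvalueFilter hΔ (by positivity),
    uniformThetaTilde_maxTime_roughEstimator hζ hΔ hΔ' hp₀ hp₀' hL₁ _,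
    uniformThetaTilde_totalTime_roughEstimator hζ hΔ hΔ' hp₀ hp₀' hL₁, lossMaxTime_eq _ hδ hε,
    uniformThetaTilde_lossTotalTime hζ hΔ hΔ' hp₀ hp₀' hδ hδ' hε hε' hL₂ hL₂', ?_⟩
  intro M H lam v ψ m₀ hv hlam hgap hψ hpm
  have hg := IsEigenbasis.measures hv hψ
  have hp := overlap_mem_stdSimplex v hψ
  exact ⟨one_sub_le_prob_abs_estimate_sub_le_and_succeeds hg hp hp₀ hpm hlam hgap hζ hΔ hΔ' hδ hδ'
      hη hη' hε hε' (le_sampleCount_mul_sq hp₀) (le_sampleCount_mul_sq hp₀),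
    fun _ hprior => (by linarith : 1 - η ≤ 1 - η / 2).trans
      (one_sub_half_le_prob_succeeds hg hp hp₀ hpm hlam hgap hζ hΔ hΔ' hδ hδ' hη hη' hε hε'
        le_rfl (le_sampleCount_mul_sq hp₀) hprior)⟩

theorem mainTheorem4 (ζ : ℝ) (hζ : 0 < ζ) :
    ∃ c C : ℝ, ∃ k : ℕ, 0 < c ∧ 0 < C ∧
    ∀ Δ p₀ δ η ε : ℝ, 0 < Δ → Δ < 2 * Real.pi → 0 < p₀ → p₀ ≤ 1 → 0 < δ → δ < 1 →
      0 < η → η < 1 → 0 < ε → ε < 1 / 2 →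
    ∃ (A : QCELS.RoughEstimator) (d N Ns : ℕ) (q : ℝ) (F : ℝ → Fin (2 * d + 1) → ℂ),
      -- the parameters
      QCELS.ThetaTilde c C k (1 + Real.log (p₀⁻¹ * δ⁻¹)) Δ⁻¹ d ∧
      c * (p₀ * δ ^ 2) ≤ q ∧ q ≤ C * (p₀ * δ ^ 2) ∧
      2 ≤ N ∧ c * (p₀ ^ 2)⁻¹ ≤ Ns ∧
      QCELS.ThetaTilde c C k (1 + Real.log (p₀⁻¹ * δ⁻¹ * η⁻¹ * ε⁻¹) + Real.log (1 + Δ⁻¹))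
        ((p₀ ^ 2)⁻¹ * δ ^ (-(2 + ζ))) (N * Ns) ∧
      ((p₀ ^ 2)⁻¹ ≤ δ ^ (-(2 + ζ)) →
        QCELS.ThetaTilde c C k (1 + Real.log (p₀⁻¹ * δ⁻¹ * η⁻¹ * ε⁻¹) + Real.log (1 + Δ⁻¹))
          (p₀ ^ 2)⁻¹ (min N Ns : ℕ)) ∧
      (∀ lamPrior ∈ Set.Icc (-Real.pi) (Real.pi - Δ),
        QCELS.IsFilter (F lamPrior) q lamPrior Δ) ∧
      -- the cost of the rough estimation
      QCELS.ThetaTilde c C k (1 + Real.log (p₀⁻¹ * η⁻¹) + Real.log (1 + Δ⁻¹))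
        Δ⁻¹ A.maxTime ∧
      QCELS.ThetaTilde c C k (1 + Real.log (p₀⁻¹ * η⁻¹) + Real.log (1 + Δ⁻¹))
        (Δ⁻¹ * (p₀ ^ 2)⁻¹) A.totalTime ∧
      -- the cost of the construction of the loss functions
      QCELS.lossMaxTime (QCELS.numLevels ε) N d (QCELS.timeStep δ ε N)
        = d + (1 - 1 / (N : ℝ)) * (δ / ε) ∧
      QCELS.ThetaTilde c C k (1 + Real.log (p₀⁻¹ * δ⁻¹ * η⁻¹ * ε⁻¹) + Real.log (1 + Δ⁻¹))
        ((p₀ ^ 2)⁻¹ * δ ^ (-(2 + ζ)) * (Δ⁻¹ + δ / ε))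
        (QCELS.lossTotalTime (QCELS.numLevels ε) N Ns d (QCELS.timeStep δ ε N)) ∧
      -- correctness for all Hamiltonians and initial states with these parameters
      ∀ (M : ℕ) (H : Matrix (Fin (M + 2)) (Fin (M + 2)) ℂ) (lam : Fin (M + 2) → ℝ)
        (v : OrthonormalBasis (Fin (M + 2)) ℂ (QCELS.Sys (M + 2))) (ψ : QCELS.Sys (M + 2)),
        H.IsHermitian → Monotone lam →
        (∀ m, Matrix.toEuclideanLin H (v m) = (lam m : ℂ) • v m) →
        (∀ m, lam m ∈ QCELS.spectralRange Δ) → lam 1 - lam 0 = Δ →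
        ‖ψ‖ = 1 → ‖inner ℂ (v 0) ψ‖ ^ 2 = p₀ →
        -- the whole algorithm
        1 - η ≤ QCELS.prob
          (fun ω : A.Data × QCELS.FilteredData (QCELS.numLevels ε) N Ns d =>
            A.dataProb H ψ ω.1 *
              QCELS.filteredDataProb H ψ (QCELS.timeStep δ ε N) (F (A.estimate ω.1)) ω.2)
          (fun ω => |A.estimate ω.1 - lam 0| ≤ Δ / 4 ∧
            QCELS.Succeeds (QCELS.timeStep δ ε N)
              (QCELS.dataPoint (F (A.estimate ω.1)) ω.2) ε (lam 0)) ∧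
        -- the second stage alone, from any admissible rough estimate
        ∀ lamPrior : ℝ, |lamPrior - lam 0| ≤ Δ / 4 →
          1 - η ≤ QCELS.prob
            (fun ω : QCELS.FilteredData (QCELS.numLevels ε) N Ns d =>
              QCELS.filteredDataProb H ψ (QCELS.timeStep δ ε N) (F lamPrior) ω)
            (fun ω => QCELS.Succeeds (QCELS.timeStep δ ε N)
              (QCELS.dataPoint (F lamPrior) ω) ε (lam 0)) := by
  obtain ⟨c, C, k, hc, hC, h⟩ := mainTheorem4_general ζ hζ.le
  refine ⟨c, C, k, hc, hC, fun Δ p₀ δ η ε hΔ hΔ' hp₀ hp₀' hδ hδ' hη hη' hε hε' => ?_⟩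
  obtain ⟨A, d, N, Ns, q, F, hd, hq, hq', hN, hNs, hNNs, hmin, hF, hmax₁, htot₁, hmax₂, htot₂,
    hcorrect⟩ := h Δ p₀ δ η ε hΔ hΔ'.le hp₀ hp₀' hδ hδ'.le hη hη'.le hε (by linarith)
  refine ⟨A, d, N, Ns, q, F, hd, hq, hq', hN, hNs, hNNs, hmin, hF, hmax₁, htot₁, hmax₂, htot₂, ?_⟩
  intro M H lam v ψ _ hmono hv hlam hgap hψ hp
  refine hcorrect M H lam v ψ 0 hv hlam (fun m hm => ?_) hψ hp.ge
  rw [← hgap]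
  exact sub_le_sub_right (hmono (Fin.one_le_of_ne_zero hm)) _
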